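/- Let $G$ be a group with a subgroup $\mathbb{Z}^n\leq G$ that is normal, of finite index and fully characteristic (mapped into itself by every endomorphism of $G$), and let $\Sigma$ be a finite set generating $G$ as a monoid, with a weight function $\omega\colon\Sigma\to\{1,2,\dots\}$. The weight $\omega(g)$ of $g\in G$ is the minimal total weight of a word in $\Sigma^*$ representing $g$. A description of $G$ consists of: a basis $B=\{e_1,\dots,e_n\}$ of $\mathbb{Z}^n$; a transversal $T\ni 1$ of $\mathbb{Z}^n$ in $G$; the function sending each pair $(a,b)$ of letters of $B^{\pm1}\cup T$ to the normal form $e_1^{v_1}\cdots e_n^{v_n}t$ ($v_i\in\mathbb{Z}$, $t\in T$) of the product $ab$; the elements of $\Sigma$ as words over $B^{\pm1}\cup T$; and their weights. Let $S\subset G$ be the set of all elements represented by words in $\Sigma^*$ of length between $1$ and $[G:\mathbb{Z}^n]$, let $X=S\cap\mathbb{Z}^n=\{x_1,\dots,x_r\}$ and $Y=S\setminus X$ (enumerated in a fixed way determined by the description), and give each letter $s\in S$ the weight $\omega(s)$. A word in $S^*$ is geodesic if its weight equals the weight of the element of $G$ that it represents. A pattern is a word $\pi=y_{i_1}\cdots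 y_{i_k}\in Y^*$ with $k\leq[G:\mathbb{Z}^n]$; let $P$ be the finite set of patterns, put $m_\pi=(k+1)r$, let $$W^\pi=\{x_1^{w_1}\cdots x_r^{w_r}\,y_{i_1}\,x_1^{w_{r+1}}\cdots x_r^{w_{2r}}\,y_{i_2}\cdots y_{i_k}\,x_1^{w_{kr+1}}\cdots x_r^{w_{kr+r}} : w_1,\dots,w_{kr+r}\in\mathbb{N}\}\subset S^*,$$ and let $\phi_\pi\colon W^\pi\to\mathbb{N}^{m_\pi}$ be the bijection sending such a word to $(w_1,\dots,w_{m_\pi})$. A subset of $\mathbb{Z}^m$ is polyhedral if it is a finite union of finite intersections of sets of the form $\{z: u\cdot z=a\}$, $\{z:u\cdot z\equiv a \bmod b\}$ or $\{z:u\cdot z>a\}$ with $u\in\mathbb{Z}^m$, $a\in\mathbb{Z}$ and $b$ a positive integer; such an expression is called a description of the set. Let $H$ be a subgroup of $\mathbb{Z}^n$, given by a basis written in coordinates with respect to $B$. Then for each $\pi\in P$ there is a set $U^\pi_H\subset W^\pi$ such that: 1. every word in $U^\pi_H$ is geodesic, and its weight is the minimal weight of an element of the coset $Hg$, where $g$ is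 the element represented by the word; 2. $\phi_\pi(U^\pi_H)\subset\mathbb{N}^{m_\pi}$ is a polyhedral set and is effectively constructible: there is a single algorithm, independent of $G$ and $H$, that takes as input a description of $G$, the basis of $H$ and the pattern $\pi$, and outputs a description of the polyhedral set $\phi_\pi(U^\pi_H)$; 3. the sets $U^\pi_H$, $\pi\in P$, are pairwise disjoint, and their union contains exactly one word representing an element of each right coset $Hg$ of $H$ in $G$. -/

import Mathlib

universe u

namespace VirtAb

/-! ### Polyhedral sets -/

/-- Elementary subsets of `ℤ^k`. -/
inductive IsElementary {k : ℕ} : Set (Fin k → ℤ) → Prop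
  | eq (c : Fin k → ℤ) (a : ℤ) : IsElementary {z | ∑ i, c i * z i = a}
  | modEq (c : Fin k → ℤ) (a : ℤ) (b : ℕ+) : IsElementary {z | ∑ i, c i * z i ≡ a [ZMOD (b : ℕ)]}
  | gt (c : Fin k → ℤ) (a : ℤ) : IsElementary {z | ∑ i, c i * z i > a}

/-- Basic polyhedral sets: finite intersections of elementary sets. -/
def IsBasicPolyhedral {k : ℕ} (X : Set (Fin k → ℤ)) : Prop :=
  ∃ F : Set (Set (Fin k → ℤ)), F.Finite ∧ (∀ Y ∈ F, IsElementary Y) ∧ X = ⋂₀ F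

/-- Polyhedral sets: finite unions of basic polyhedral sets. -/
def IsPolyhedral {k : ℕ} (X : Set (Fin k → ℤ)) : Prop :=
  ∃ F : Set (Set (Fin k → ℤ)), F.Finite ∧ (∀ Y ∈ F, IsBasicPolyhedral Y) ∧ X = ⋃₀ F

/-- The finite data describing an elementary set: `(u, a)` for `u · z = a`, `(u, a, b)` for
`u · z ≡ a mod b`, and `(u, a)` for `u · z > a`; the vector `u` is the list of its entries. -/
abbrev ElementaryCode : Type := (List ℤ × ℤ) ⊕ (List ℤ × ℤ × ℕ+) ⊕ (List ℤ × ℤ)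

/-- The vector of `ℤ^k` with the given list of entries (missing entries are zero, superfluous
entries are ignored). -/
def vecOfList (k : ℕ) (l : List ℤ) : Fin k → ℤ := fun i => l.getD i 0

/-- The elementary subset of `ℤ^k` with the given data. -/
def ElementaryCode.toSet (k : ℕ) : ElementaryCode → Set (Fin k → ℤ)
  | .inl (c, a) => {z | ∑ i, vecOfList k c i * z i = a}
  | .inr (.inl (c, a, b)) => {z | ∑ i, vecOfList k c i * z i ≡ a [ZMOD (b : ℕ)]}
  | .inr (.inr (c, a)) => {z | ∑ i, vecOfList k c i * z i > a}

/-- The finite data describing a polyhedral set as a finite union (outer list) of finite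
intersections (inner lists) of elementary sets. -/
abbrev PolyhedralCode : Type := List (List ElementaryCode)

/-- The polyhedral subset of `ℤ^k` with the given description. -/
def PolyhedralCode.toSet (k : ℕ) (c : PolyhedralCode) : Set (Fin k → ℤ) :=
  {z | ∃ b ∈ c, ∀ s ∈ b, z ∈ ElementaryCode.toSet k s}

/-! ### Descriptions of virtually abelian groups -/

/-- The alphabet `B^{±1} ∪ T`, where `B = {e_i}` has `n` and `T = {t_j}` has `d` elements:
`inl (i, true)` is `e_i`, `inl (i, false)` is `e_i⁻¹`, and `inr j` is `t_j`. -/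
abbrev Letter (n d : ℕ) : Type := (Fin n × Bool) ⊕ Fin d

/-- Subgroup-transversal normal forms: `(v, j)` is the word `e_1^{v_1} ⋯ e_n^{v_n} t_j`. -/
abbrev NormalForm (n d : ℕ) : Type := (Fin n → ℤ) × Fin d

section Evaluation

variable {G : Type u} [Group G] {A : Subgroup G} {n d : ℕ}

/-- The element of `A ≅ ℤ^n` with coordinate vector `v`, as an element of `G`. -/
def evalVec (basis : Multiplicative (Fin n → ℤ) ≃* A) (v : Fin n → ℤ) : G :=
  (basis (Multiplicative.ofAdd v) : G)

/-- The element of `G` given by a letter. -/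
def evalLetter (basis : Multiplicative (Fin n → ℤ) ≃* A) (t : Fin d → G) : Letter n d → G
  | .inl (i, true) => evalVec basis (Pi.single i 1)
  | .inl (i, false) => (evalVec basis (Pi.single i 1))⁻¹
  | .inr j => t j

/-- The element of `G` given by a normal form. -/
def evalNormalForm (basis : Multiplicative (Fin n → ℤ) ≃* A) (t : Fin d → G)
    (x : NormalForm n d) : G :=
  evalVec basis x.1 * t x.2

end Evaluation

/-- A description of a virtually abelian group `G` with a finite weighted monoid generating
set. -/
structure Description (G : Type u) [Group G] where
  /-- the rank `n` of the finite-index free abelian subgroup -/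
  n : ℕ
  /-- the subgroup `ℤ^n` -/
  A : Subgroup G
  normal : A.Normal
  finiteIndex : A.FiniteIndex
  /-- `A` is fully characteristic -/
  fullyCharacteristic : ∀ f : G →* G, A.map f ≤ A
  /-- the identification of `A` with `ℤ^n`, that is, a basis `e_1, …, e_n` of `A` -/
  basis : Multiplicative (Fin n → ℤ) ≃* A
  /-- the number of elements of the transversal -/
  d : ℕ
  /-- the transversal `T` -/
  t : Fin d → G
  transversal : ∀ g : G, ∃! j, g * (t j)⁻¹ ∈ A
  one_mem_transversal : ∃ j, t j = 1
  /-- the function sending a pair of letters to the normal form of its product -/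
  f : Letter n d → Letter n d → NormalForm n d
  f_spec : ∀ a b, evalNormalForm basis t (f a b) = evalLetter basis t a * evalLetter basis t b
  /-- the number of generators in `Σ` -/
  m : ℕ
  /-- the generators, as words over `B^{±1} ∪ T` -/
  gens : Fin m → List (Letter n d)
  generates :
    Submonoid.closure (Set.range fun i => ((gens i).map (evalLetter basis t)).prod) = ⊤
  /-- the weights of the generators -/
  weight : Fin m → ℕ
  weight_pos : ∀ i, 0 < weight i

/-! ### Encoding descriptions as finite data -/

/-- Code of a letter. -/
abbrev LetterCode : Type := (ℕ × Bool) ⊕ ℕ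

/-- Code of a normal form: the list of exponents and the number of the transversal element. -/
abbrev NormalFormCode : Type := List ℤ × ℕ

/-- Code of a description: `n`, the size of `T`, the graph of `f`, and the list of generators with
their weights. -/
abbrev DescriptionCode : Type :=
  ℕ × ℕ × List ((LetterCode × LetterCode) × NormalFormCode) × List (List LetterCode × ℕ)

def Letter.code {n d : ℕ} : Letter n d → LetterCode
  | .inl (i, s) => .inl (i, s)
  | .inr j => .inr j

def NormalForm.code {n d : ℕ} (x : NormalForm n d) : NormalFormCode :=
  (List.ofFn x.1, x.2)

/-- The list of all letters. -/
def allLetters (n d : ℕ) : List (Letter n d) :=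
  ((List.finRange n).flatMap fun i => [.inl (i, true), .inl (i, false)]) ++
    (List.finRange d).map .inr

theorem mem_allLetters {n d : ℕ} (a : Letter n d) : a ∈ allLetters n d := by
  rcases a with ⟨i, s⟩ | j
  · cases s <;> simp [allLetters]
  · simp [allLetters]

namespace Description

variable {G : Type u} [Group G] (D : Description G)

/-- The finite data of a description, as it is given to an algorithm. -/
def code : DescriptionCode :=
  (D.n, D.d,
    ((allLetters D.n D.d).product (allLetters D.n D.d)).map
      (fun p => ((Letter.code p.1, Letter.code p.2), NormalForm.code (D.f p.1 p.2))),
    List.ofFn fun i => ((D.gens i).map Letter.code, D.weight i))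

/-! ### Weights -/

/-- The element of `G` given by the `i`-th generator in `Σ`. -/
def gen (i : Fin D.m) : G := ((D.gens i).map (evalLetter D.basis D.t)).prod

/-- The element of `G` represented by a word in `Σ^*`. -/
def evalGens (l : List (Fin D.m)) : G := (l.map D.gen).prod

/-- The weight `ω(g)` of an element `g`: the minimal weight of a word in `Σ^*` representing it. -/
noncomputable def omega (g : G) : ℕ :=
  sInf {c | ∃ l : List (Fin D.m), D.evalGens l = g ∧ (l.map D.weight).sum = c}

/-- The weight `ω(V) = min {ω(g) : g ∈ V}` of a (non-empty) subset of `G`. -/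
noncomputable def omegaSet (V : Set G) : ℕ := sInf (D.omega '' V)

/-- The weight of a word whose letters are elements of `G`, a letter `s` having weight `ω(s)`. -/
noncomputable def wordWeight (w : List G) : ℕ := (w.map D.omega).sum

/-- A word is geodesic if its weight is that of the element which it represents. -/
def IsGeodesic (w : List G) : Prop := D.wordWeight w = D.omega w.prod

/-! ### The extended generating set -/

/-- The extended generating set `S`: all elements represented by words in `Σ^*` of length between
`1` and the index `[G : A]`. -/
def extendedGenerators : Set G :=
  {g | ∃ l : List (Fin D.m), 1 ≤ l.length ∧ l.length ≤ D.A.index ∧ D.evalGens l = g}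

/-- The list of all words of length `k` in `Σ^*`, in lexicographic order. -/
def wordsOfLength (m : ℕ) : ℕ → List (List (Fin m))
  | 0 => [[]]
  | k + 1 => (List.finRange m).flatMap fun i => (wordsOfLength m k).map (i :: ·)

theorem mem_wordsOfLength {m k : ℕ} {l : List (Fin m)} :
    l ∈ wordsOfLength m k ↔ l.length = k := by
  induction k generalizing l with
  | zero => simp [wordsOfLength]
  | succ k ih => cases l <;> simp [wordsOfLength, ih]

open Classical in
/-- The elements of `S`, listed without repetition in a fixed order. -/
noncomputable def listS : List G :=
  ((List.range D.A.index).flatMap fun k => (wordsOfLength D.m (k + 1)).map D.evalGens).dedup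

theorem mem_listS {g : G} : g ∈ D.listS ↔ g ∈ D.extendedGenerators := by
  simp only [listS, extendedGenerators, List.mem_dedup, List.mem_flatMap, List.mem_range,
    List.mem_map, mem_wordsOfLength, Set.mem_ofPred_eq]
  constructor
  · rintro ⟨k, hk, l, hl, rfl⟩
    exact ⟨l, by omega, by omega, rfl⟩
  · rintro ⟨l, h1, h2, rfl⟩
    exact ⟨l.length - 1, by omega, l, by omega, rfl⟩

open Classical in
/-- The elements `x_1, …, x_r` of `X = S ∩ A`. -/
noncomputable def listX : List G := D.listS.filter (fun g => g ∈ D.A)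

open Classical in
/-- The elements `y_1, …, y_s` of `Y = S \ X`. -/
noncomputable def listY : List G := D.listS.filter (fun g => g ∉ D.A)

/-- The number of elements of `X`. -/
noncomputable def r : ℕ := D.listX.length

/-- The number of elements of `Y`. -/
noncomputable def s : ℕ := D.listY.length

/-- The enumeration of `X`. -/
noncomputable def x (i : Fin D.r) : G := D.listX.get i

/-- The enumeration of `Y`. -/
noncomputable def y (i : Fin D.s) : G := D.listY.get i

theorem x_mem (i : Fin D.r) : D.x i ∈ D.A := by
  have h : D.x i ∈ D.listX := List.get_mem _ _
  simpa using (List.mem_filter.1 h).2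

theorem y_notMem (i : Fin D.s) : D.y i ∉ D.A := by
  have h : D.y i ∈ D.listY := List.get_mem _ _
  simpa using (List.mem_filter.1 h).2

theorem x_injective : Function.Injective D.x := by
  classical
  exact List.nodup_iff_injective_get.1 ((List.nodup_dedup _).filter _)

theorem y_injective : Function.Injective D.y := by
  classical
  exact List.nodup_iff_injective_get.1 ((List.nodup_dedup _).filter _)

theorem range_x : Set.range D.x = D.extendedGenerators ∩ D.A := by
  ext g
  have h : g ∈ Set.range D.x ↔ g ∈ D.listX := List.mem_iff_get.symm
  rw [h, listX]
  simp [mem_listS]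

theorem range_y : Set.range D.y = D.extendedGenerators \ D.A := by
  ext g
  have h : g ∈ Set.range D.y ↔ g ∈ D.listY := List.mem_iff_get.symm
  rw [h, listY]
  simp [mem_listS]

/-! ### Patterns -/

/-- Patterns: words in `Y^*`, given by the list of the numbers of their letters, of length at most
`[G : A]`. -/
abbrev Pattern : Type := {p : List (Fin D.s) // p.length ≤ D.A.index}

/-- The number `m_π = (k + 1) r` of coordinates, for a pattern `π` of length `k`. -/
noncomputable abbrev dim (p : D.Pattern) : ℕ := (p.1.length + 1) * D.r

/-- The word `x_1^{v_1} ⋯ x_r^{v_r}`. -/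
noncomputable def block (v : Fin D.r → ℕ) : List G :=
  (List.finRange D.r).flatMap fun i => List.replicate (v i) (D.x i)

/-- The word `b_0 y_{i_1} b_1 y_{i_2} ⋯ y_{i_k} b_k` for the pattern `y_{i_1} ⋯ y_{i_k}`, where
`b_j` is the block with exponents `v j`. -/
noncomputable def interleave :
    (p : List (Fin D.s)) → (Fin (p.length + 1) → Fin D.r → ℕ) → List G
  | [], v => D.block (v 0)
  | i :: p, v => D.block (v 0) ++ D.y i :: interleave p (fun j => v j.succ)

/-- The `π`-patterned word with exponent vector `(w_1, …, w_{m_π})`; the exponent of `x_i` in the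
`j`-th block (both counted from zero) is the entry with number `j r + i`. -/
noncomputable def patternedWord (p : D.Pattern) (w : Fin (D.dim p) → ℕ) : List G :=
  D.interleave p.1 fun j i => w (finProdFinEquiv (j, i))

/-- The set `W^π` of `π`-patterned words. -/
def W (p : D.Pattern) : Set (List G) := Set.range (D.patternedWord p)

theorem mem_block {v : Fin D.r → ℕ} {g : G} (h : g ∈ D.block v) : g ∈ D.A := by
  simp only [block, List.mem_flatMap, List.mem_replicate] at h
  obtain ⟨i, -, -, rfl⟩ := h
  exact D.x_mem i

open Classical in
theorem count_block (v : Fin D.r → ℕ) (i : Fin D.r) : (D.block v).count (D.x i) = v i := by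
  rw [block, List.count_flatMap]
  have h : (List.count (D.x i) ∘ fun j => List.replicate (v j) (D.x j)) =
      fun j => if j = i then v i else 0 := by
    funext j
    by_cases hj : j = i
    · subst hj; simp
    · have : D.x j ≠ D.x i := fun h => hj (D.x_injective h)
      simp [hj, List.count_replicate, this]
  rw [h, ← List.ofFn_eq_map, List.sum_ofFn]
  simp

theorem block_injective : Function.Injective D.block := by
  classical
  intro v w h
  funext i
  rw [← D.count_block v i, ← D.count_block w i, h]

theorem interleave_injective (p : List (Fin D.s)) : Function.Injective (D.interleave p) := by
  classical
  induction p with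
  | nil =>
    intro v w h
    funext j
    have hj : j = 0 := Fin.ext (by simp)
    rw [hj]
    exact D.block_injective h
  | cons i p ih =>
    intro v w h
    have key : ∀ (v : Fin D.r → ℕ) (R : List G),
        (D.block v ++ D.y i :: R).takeWhile (fun g => decide (g ∈ D.A)) = D.block v := by
      intro v R
      rw [List.takeWhile_append_of_pos (fun a ha => by simpa using D.mem_block ha)]
      simp [D.y_notMem i]
    simp only [interleave] at h
    have h0 : D.block (v 0) = D.block (w 0) := by
      rw [← key (v 0) (D.interleave p fun j => v j.succ), h, key]
    rw [h0] at h
    have h1 := ih (List.cons.inj (List.append_cancel_left h)).2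
    funext j
    refine Fin.cases ?_ (fun j => ?_) j
    · exact D.block_injective h0
    · exact congrFun h1 j

theorem patternedWord_injective (p : D.Pattern) : Function.Injective (D.patternedWord p) := by
  intro v w h
  have h1 := D.interleave_injective p.1 h
  funext q
  have h2 := congrFun (congrFun h1 (finProdFinEquiv.symm q).1) (finProdFinEquiv.symm q).2
  simpa only [Prod.mk.eta, Equiv.apply_symm_apply] using h2

/-- The bijection `φ_π : W^π → ℕ^{m_π}`, recording the exponents of the `x_i`. -/
noncomputable def phi (p : D.Pattern) : D.W p ≃ (Fin (D.dim p) → ℕ) :=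
  (Equiv.ofInjective (D.patternedWord p) (D.patternedWord_injective p)).symm

/-- The image `φ_π(U)` of a set `U` of words in `W^π`, as a subset of `ℤ^{m_π}`. -/
def phiImage (p : D.Pattern) (U : Set (List G)) : Set (Fin (D.dim p) → ℤ) :=
  {z | ∃ w : D.W p, w.1 ∈ U ∧ z = fun q => ((D.phi p w q : ℕ) : ℤ)}

/-! ### Subgroups of `ℤ^n` -/

/-- The subgroup `H ≤ A` generated by the elements with coordinate vectors `h_1, …, h_k`. -/
def spanSubgroup {k : ℕ} (h : Fin k → Fin D.n → ℤ) : Subgroup G :=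
  Subgroup.closure (Set.range fun j => evalVec D.basis (h j))

/-- The input of the algorithm: the description, the basis of `H`, and a pattern. -/
def input {k : ℕ} (h : Fin k → Fin D.n → ℤ) (p : D.Pattern) :
    DescriptionCode × List (List ℤ) × List ℕ :=
  (D.code, List.ofFn fun j => List.ofFn (h j), p.1.map Fin.val)

end Description

end VirtAb

/-! ### Primitive recursive functions

Closure properties of primitive recursive functions, in the compositional form that lets `fun_prop`
prove that a function given by an explicit term is primitive recursive. -/

attribute [fun_prop] Primrec

namespace VirtAb

section PrimrecToolkit

variable {α β γ σ : Type*} [Primcodable α] [Primcodable β] [Primcodable γ] [Primcodable σ]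

@[fun_prop]
theorem primrec_id : Primrec fun a : α => a := Primrec.id

@[fun_prop]
theorem primrec_const (c : β) : Primrec fun _ : α => c := Primrec.const c

@[fun_prop]
theorem primrec_comp {f : β → γ} {g : α → β} (hf : Primrec f) (hg : Primrec g) :
    Primrec fun a => f (g a) := hf.comp hg

@[fun_prop]
theorem primrec_fst {f : α → β × γ} (hf : Primrec f) : Primrec fun a => (f a).1 :=
  Primrec.fst.comp hf

@[fun_prop]
theorem primrec_snd {f : α → β × γ} (hf : Primrec f) : Primrec fun a => (f a).2 :=
  Primrec.snd.comp hf

@[fun_prop]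
theorem primrec_pair {f : α → β} {g : α → γ} (hf : Primrec f) (hg : Primrec g) :
    Primrec fun a => (f a, g a) := hf.pair hg

@[fun_prop]
theorem primrec_sum_inl {f : α → β} (hf : Primrec f) :
    Primrec fun a => (Sum.inl (f a) : β ⊕ γ) := Primrec.sumInl.comp hf

@[fun_prop]
theorem primrec_sum_inr {f : α → γ} (hf : Primrec f) :
    Primrec fun a => (Sum.inr (f a) : β ⊕ γ) := Primrec.sumInr.comp hf

@[fun_prop]
theorem primrec_encode {f : α → β} (hf : Primrec f) : Primrec fun a => Encodable.encode (f a) :=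
  Primrec.encode.comp hf

@[fun_prop]
theorem primrec_nat_add {f g : α → ℕ} (hf : Primrec f) (hg : Primrec g) :
    Primrec fun a => f a + g a := Primrec.nat_add.comp hf hg

@[fun_prop]
theorem primrec_nat_sub {f g : α → ℕ} (hf : Primrec f) (hg : Primrec g) :
    Primrec fun a => f a - g a := Primrec.nat_sub.comp hf hg

@[fun_prop]
theorem primrec_nat_mul {f g : α → ℕ} (hf : Primrec f) (hg : Primrec g) :
    Primrec fun a => f a * g a := Primrec.nat_mul.comp hf hg

@[fun_prop]
theorem primrec_nat_div {f g : α → ℕ} (hf : Primrec f) (hg : Primrec g) :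
    Primrec fun a => f a / g a := Primrec.nat_div.comp hf hg

@[fun_prop]
theorem primrec_nat_mod {f g : α → ℕ} (hf : Primrec f) (hg : Primrec g) :
    Primrec fun a => f a % g a := Primrec.nat_mod.comp hf hg

@[fun_prop]
theorem primrec_nat_min {f g : α → ℕ} (hf : Primrec f) (hg : Primrec g) :
    Primrec fun a => min (f a) (g a) := Primrec.nat_min.comp hf hg

@[fun_prop]
theorem primrec_nat_max {f g : α → ℕ} (hf : Primrec f) (hg : Primrec g) :
    Primrec fun a => max (f a) (g a) := Primrec.nat_max.comp hf hg

@[fun_prop]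
theorem primrec_decide_nat_le {f g : α → ℕ} (hf : Primrec f) (hg : Primrec g) :
    Primrec fun a => decide (f a ≤ g a) := (Primrec.nat_le.comp hf hg).decide

@[fun_prop]
theorem primrec_decide_eq [DecidableEq β] {f g : α → β} (hf : Primrec f) (hg : Primrec g) :
    Primrec fun a => decide (f a = g a) := (Primrec.eq.comp hf hg).decide

@[fun_prop]
theorem primrec_and {f g : α → Bool} (hf : Primrec f) (hg : Primrec g) :
    Primrec fun a => f a && g a := Primrec.and.comp hf hg

@[fun_prop]
theorem primrec_or {f g : α → Bool} (hf : Primrec f) (hg : Primrec g) :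
    Primrec fun a => f a || g a := Primrec.or.comp hf hg

@[fun_prop]
theorem primrec_not {f : α → Bool} (hf : Primrec f) : Primrec fun a => !f a :=
  Primrec.not.comp hf

@[fun_prop]
theorem primrec_cond {c : α → Bool} {f g : α → β} (hc : Primrec c) (hf : Primrec f)
    (hg : Primrec g) : Primrec fun a => bif c a then f a else g a := Primrec.cond hc hf hg

@[fun_prop]
theorem primrec_nat_rec {f : α → ℕ} {g : α → β} {h : α → ℕ → β → β} (hf : Primrec f)
    (hg : Primrec g) (hh : Primrec fun p : α × ℕ × β => h p.1 p.2.1 p.2.2) :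
    Primrec fun a => Nat.rec (motive := fun _ => β) (g a) (h a) (f a) :=
  Primrec.nat_rec' (h := fun a p => h a p.1 p.2) hf hg hh

/-! #### Lists -/

@[fun_prop]
theorem primrec_list_cons {f : α → β} {g : α → List β} (hf : Primrec f) (hg : Primrec g) :
    Primrec fun a => f a :: g a := Primrec.list_cons.comp hf hg

@[fun_prop]
theorem primrec_list_append {f g : α → List β} (hf : Primrec f) (hg : Primrec g) :
    Primrec fun a => f a ++ g a := Primrec.list_append.comp hf hg

@[fun_prop]
theorem primrec_list_length {f : α → List β} (hf : Primrec f) :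
    Primrec fun a => (f a).length := Primrec.list_length.comp hf

@[fun_prop]
theorem primrec_list_tail {f : α → List β} (hf : Primrec f) :
    Primrec fun a => (f a).tail := Primrec.list_tail.comp hf

@[fun_prop]
theorem primrec_list_take {f : α → ℕ} {g : α → List β} (hf : Primrec f) (hg : Primrec g) :
    Primrec fun a => (g a).take (f a) := Primrec.list_take.comp hf hg

@[fun_prop]
theorem primrec_list_range {f : α → ℕ} (hf : Primrec f) :
    Primrec fun a => List.range (f a) := Primrec.list_range.comp hf

@[fun_prop]
theorem primrec_list_getD {f : α → List β} {g : α → ℕ} {h : α → β} (hf : Primrec f)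
    (hg : Primrec g) (hh : Primrec h) : Primrec fun a => (f a).getD (g a) (h a) :=
  (Primrec.option_getD.comp (Primrec.list_getElem?.comp hf hg) hh).of_eq fun a => by
    simp [List.getD]

@[fun_prop]
theorem primrec_list_map {f : α → List β} {g : α → β → γ} (hf : Primrec f)
    (hg : Primrec fun p : α × β => g p.1 p.2) : Primrec fun a => (f a).map (g a) :=
  Primrec.list_map hf hg

@[fun_prop]
theorem primrec_list_flatMap {f : α → List β} {g : α → β → List γ} (hf : Primrec f)
    (hg : Primrec fun p : α × β => g p.1 p.2) : Primrec fun a => (f a).flatMap (g a) :=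
  Primrec.list_flatMap hf hg

@[fun_prop]
theorem primrec_list_foldr {f : α → List β} {g : α → σ} {h : α → β → σ → σ} (hf : Primrec f)
    (hg : Primrec g) (hh : Primrec fun p : α × β × σ => h p.1 p.2.1 p.2.2) :
    Primrec fun a => (f a).foldr (h a) (g a) :=
  Primrec.list_foldr (h := fun a p => h a p.1 p.2) hf hg hh

@[fun_prop]
theorem primrec_list_foldl {f : α → List β} {g : α → σ} {h : α → σ → β → σ} (hf : Primrec f)
    (hg : Primrec g) (hh : Primrec fun p : α × σ × β => h p.1 p.2.1 p.2.2) :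
    Primrec fun a => (f a).foldl (h a) (g a) :=
  Primrec.list_foldl (h := fun a p => h a p.1 p.2) hf hg hh

@[fun_prop]
theorem primrec_list_filter {f : α → List β} {g : α → β → Bool} (hf : Primrec f)
    (hg : Primrec fun p : α × β => g p.1 p.2) : Primrec fun a => (f a).filter (g a) := by
  have h : Primrec fun a => (f a).foldr (fun b l => bif g a b then b :: l else l) [] := by
    fun_prop
  refine h.of_eq fun a => ?_
  induction f a with
  | nil => rfl
  | cons b l ih => cases hb : g a b <;> simp [hb, ih]

@[fun_prop]
theorem primrec_list_all {f : α → List β} {g : α → β → Bool} (hf : Primrec f)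
    (hg : Primrec fun p : α × β => g p.1 p.2) : Primrec fun a => (f a).all (g a) := by
  have h : Primrec fun a => (f a).foldr (fun b r => g a b && r) true := by fun_prop
  refine h.of_eq fun a => ?_
  induction f a with
  | nil => rfl
  | cons b l ih => simp [ih]

@[fun_prop]
theorem primrec_list_any {f : α → List β} {g : α → β → Bool} (hf : Primrec f)
    (hg : Primrec fun p : α × β => g p.1 p.2) : Primrec fun a => (f a).any (g a) := by
  have h : Primrec fun a => (f a).foldr (fun b r => g a b || r) false := by fun_prop
  refine h.of_eq fun a => ?_
  induction f a with
  | nil => rfl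
  | cons b l ih => simp [ih]

@[fun_prop]
theorem primrec_list_sum {f : α → List ℕ} (hf : Primrec f) : Primrec fun a => (f a).sum := by
  have h : Primrec fun a => (f a).foldr (fun b r => b + r) 0 := by fun_prop
  exact h

/-! #### Integers -/

theorem primrec_int_ofNat_sub {f g : α → ℕ} (hf : Primrec f) (hg : Primrec g) :
    Primrec fun a => (f a : ℤ) - (g a : ℤ) := by
  have h : Primrec fun a => Denumerable.ofNat ℤ
      (bif decide (g a ≤ f a) then 2 * (f a - g a) else 2 * (g a - f a - 1) + 1) :=
    (Primrec.ofNat ℤ).comp (by fun_prop)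
  refine h.of_eq fun a => ?_
  rw [show Denumerable.ofNat ℤ = Equiv.intEquivNat.symm from rfl, Equiv.symm_apply_eq]
  by_cases hab : g a ≤ f a
  · obtain ⟨c, hc⟩ := Nat.exists_eq_add_of_le hab
    rw [hc]
    simp [Equiv.intEquivNat, Equiv.intEquivNatSumNat]
    rfl
  · obtain ⟨c, hc⟩ := Nat.exists_eq_add_of_lt (not_le.1 hab)
    rw [hc]
    have : ((f a : ℤ) - ((f a + c + 1 : ℕ) : ℤ)) = Int.negSucc c := by
      rw [Int.negSucc_eq]; push_cast; ring
    rw [this]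
    have h2 : ¬ (f a + c + 1 ≤ f a) := by omega
    have h3 : f a + c + 1 - f a - 1 = c := by omega
    simp [Equiv.intEquivNat, Equiv.intEquivNatSumNat, h2, h3]

@[fun_prop]
theorem primrec_int_natCast {f : α → ℕ} (hf : Primrec f) : Primrec fun a => (f a : ℤ) :=
  (primrec_int_ofNat_sub hf (primrec_const 0)).of_eq fun a => by simp

theorem encode_int_natCast (n : ℕ) : Encodable.encode (n : ℤ) = 2 * n := by
  change Equiv.intEquivNat n = _
  simp [Equiv.intEquivNat, Equiv.intEquivNatSumNat]
  rfl

theorem encode_int_negSucc (n : ℕ) : Encodable.encode (Int.negSucc n) = 2 * n + 1 := by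
  change Equiv.intEquivNat (Int.negSucc n) = _
  simp [Equiv.intEquivNat, Equiv.intEquivNatSumNat]

@[fun_prop]
theorem primrec_int_toNat {f : α → ℤ} (hf : Primrec f) : Primrec fun a => (f a).toNat := by
  have h : Primrec fun a => bif decide (Encodable.encode (f a) % 2 = 0) then
      Encodable.encode (f a) / 2 else 0 := by fun_prop
  refine h.of_eq fun a => ?_
  rcases f a with n | n
  · simp only [Int.ofNat_eq_natCast, encode_int_natCast]; simp
  · rw [encode_int_negSucc]; simp [Nat.add_mod]

theorem primrec_int_neg_toNat {f : α → ℤ} (hf : Primrec f) :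
    Primrec fun a => (-f a).toNat := by
  have h : Primrec fun a => bif decide (Encodable.encode (f a) % 2 = 0) then 0 else
      Encodable.encode (f a) / 2 + 1 := by fun_prop
  refine h.of_eq fun a => ?_
  rcases f a with n | n
  · simp only [Int.ofNat_eq_natCast, encode_int_natCast]; simp
  · rw [encode_int_negSucc]
    have h1 : (2 * n + 1) % 2 = 1 := by omega
    have h2 : (2 * n + 1) / 2 = n := by omega
    simp [h1, h2]

@[fun_prop]
theorem primrec_int_neg {f : α → ℤ} (hf : Primrec f) : Primrec fun a => -f a :=
  (primrec_int_ofNat_sub (primrec_int_neg_toNat hf) (primrec_int_toNat hf)).of_eq fun a => by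
    omega

@[fun_prop]
theorem primrec_int_add {f g : α → ℤ} (hf : Primrec f) (hg : Primrec g) :
    Primrec fun a => f a + g a :=
  (primrec_int_ofNat_sub
    (primrec_nat_add (primrec_int_toNat hf) (primrec_int_toNat hg))
    (primrec_nat_add (primrec_int_neg_toNat hf) (primrec_int_neg_toNat hg))).of_eq fun a => by
    push_cast; omega

@[fun_prop]
theorem primrec_int_sub {f g : α → ℤ} (hf : Primrec f) (hg : Primrec g) :
    Primrec fun a => f a - g a := by
  simp only [sub_eq_add_neg]; fun_prop

@[fun_prop]
theorem primrec_int_mul {f g : α → ℤ} (hf : Primrec f) (hg : Primrec g) :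
    Primrec fun a => f a * g a := by
  have h1 := primrec_int_toNat hf
  have h2 := primrec_int_toNat hg
  have h3 := primrec_int_neg_toNat hf
  have h4 := primrec_int_neg_toNat hg
  refine (primrec_int_ofNat_sub
    (primrec_nat_add (primrec_nat_mul h1 h2) (primrec_nat_mul h3 h4))
    (primrec_nat_add (primrec_nat_mul h1 h4) (primrec_nat_mul h3 h2))).of_eq fun a => ?_
  have e : ∀ z : ℤ, z = (z.toNat : ℤ) - ((-z).toNat : ℤ) := fun z => by omega
  conv_rhs => rw [e (f a), e (g a)]
  push_cast
  ring

@[fun_prop]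
theorem primrec_int_natAbs {f : α → ℤ} (hf : Primrec f) : Primrec fun a => (f a).natAbs :=
  (primrec_nat_add (primrec_int_toNat hf) (primrec_int_neg_toNat hf)).of_eq fun a => by omega

@[fun_prop]
theorem primrec_succPNat {f : α → ℕ} (hf : Primrec f) : Primrec fun a => (f a).succPNat := by
  refine ((Primrec.ofNat ℕ+).comp hf).of_eq fun a => ?_
  rfl

end PrimrecToolkit

end VirtAb

namespace VirtAb

/-! ### Vectors given by lists -/

/-- Whether two lists describe the same vector of `ℤ^n`. -/
def eqVec (n : ℕ) (u v : List ℤ) : Bool :=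
  (List.range n).all fun i => decide (u.getD i 0 = v.getD i 0)

/-- The sum of two vectors. -/
def addVec (u v : List ℤ) : List ℤ :=
  (List.range (max u.length v.length)).map fun i => u.getD i 0 + v.getD i 0

/-- The multiple of a vector by an integer. -/
def smulVec (c : ℤ) (u : List ℤ) : List ℤ := u.map fun z => c * z

/-- The vector with integer entries given by a vector with natural entries. -/
def castList (y : List ℕ) : List ℤ := y.map fun k : ℕ => (k : ℤ)

/-- The linear combination of vectors with the given coefficients. -/
def lincomb (cols : List (List ℤ)) (y : List ℤ) : List ℤ :=
  (List.range cols.length).foldr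
    (fun i acc => addVec (smulVec (y.getD i 0) (cols.getD i [])) acc) []

/-- The sums of all sublists of a list of vectors. -/
def subsetSums (cols : List (List ℤ)) : List (List ℤ) :=
  cols.foldr (fun c acc => acc ++ acc.map fun u => addVec c u) [[]]

/-- Whether two vectors of `ℤ^n` are congruent modulo 2. -/
def eqVecModTwo (n : ℕ) (u v : List ℤ) : Bool :=
  (List.range n).all fun i => decide ((u.getD i 0 - v.getD i 0).natAbs % 2 = 0)

section Primrec

variable {α : Type*} [Primcodable α]

@[fun_prop]
theorem primrec_eqVec {f : α → ℕ} {g h : α → List ℤ} (hf : Primrec f) (hg : Primrec g)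
    (hh : Primrec h) : Primrec fun a => eqVec (f a) (g a) (h a) := by
  unfold eqVec; fun_prop

@[fun_prop]
theorem primrec_addVec {f g : α → List ℤ} (hf : Primrec f) (hg : Primrec g) :
    Primrec fun a => addVec (f a) (g a) := by
  unfold addVec; fun_prop

@[fun_prop]
theorem primrec_smulVec {f : α → ℤ} {g : α → List ℤ} (hf : Primrec f) (hg : Primrec g) :
    Primrec fun a => smulVec (f a) (g a) := by
  unfold smulVec; fun_prop

@[fun_prop]
theorem primrec_castList {f : α → List ℕ} (hf : Primrec f) :
    Primrec fun a => castList (f a) := by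
  unfold castList; fun_prop

@[fun_prop]
theorem primrec_lincomb {f : α → List (List ℤ)} {g : α → List ℤ} (hf : Primrec f)
    (hg : Primrec g) : Primrec fun a => lincomb (f a) (g a) := by
  unfold lincomb; fun_prop

@[fun_prop]
theorem primrec_subsetSums {f : α → List (List ℤ)} (hf : Primrec f) :
    Primrec fun a => subsetSums (f a) := by
  unfold subsetSums; fun_prop

@[fun_prop]
theorem primrec_eqVecModTwo {f : α → ℕ} {g h : α → List ℤ} (hf : Primrec f) (hg : Primrec g)
    (hh : Primrec h) : Primrec fun a => eqVecModTwo (f a) (g a) (h a) := by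
  unfold eqVecModTwo; fun_prop

end Primrec

theorem eqVec_iff {n : ℕ} {u v : List ℤ} :
    eqVec n u v = true ↔ vecOfList n u = vecOfList n v := by
  simp only [eqVec, List.all_eq_true, List.mem_range, decide_eq_true_eq, funext_iff, vecOfList]
  exact ⟨fun h i => h i i.2, fun h i hi => h ⟨i, hi⟩⟩

theorem getD_map_range {β : Type*} (f : ℕ → β) (n i : ℕ) (d : β) :
    ((List.range n).map f).getD i d = if i < n then f i else d := by
  split_ifs with h
  · simp [List.getD, h]
  · simp [List.getD, h]

theorem getD_addVec (u v : List ℤ) (i : ℕ) :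
    (addVec u v).getD i 0 = u.getD i 0 + v.getD i 0 := by
  rw [addVec, getD_map_range]
  split_ifs with h
  · rfl
  · rw [List.getD_eq_default _ _ (by omega), List.getD_eq_default _ _ (by omega), add_zero]

theorem getD_smulVec (c : ℤ) (u : List ℤ) (i : ℕ) :
    (smulVec c u).getD i 0 = c * u.getD i 0 := by
  by_cases h : i < u.length
  · simp [smulVec, List.getD, h]
  · simp [smulVec, List.getD, h]

theorem getD_castList (y : List ℕ) (i : ℕ) : (castList y).getD i 0 = (y.getD i 0 : ℕ) := by
  rw [castList, ← Nat.cast_zero (R := ℤ), List.getD_map]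

@[simp]
theorem vecOfList_addVec (n : ℕ) (u v : List ℤ) :
    vecOfList n (addVec u v) = vecOfList n u + vecOfList n v := by
  funext i; exact getD_addVec u v i

@[simp]
theorem vecOfList_smulVec (n : ℕ) (c : ℤ) (u : List ℤ) :
    vecOfList n (smulVec c u) = c • vecOfList n u := by
  funext i; exact getD_smulVec c u i

@[simp]
theorem vecOfList_nil (n : ℕ) : vecOfList n [] = 0 := by
  funext i; simp [vecOfList]

@[simp]
theorem vecOfList_ofFn {n : ℕ} (v : Fin n → ℤ) : vecOfList n (List.ofFn v) = v := by
  funext i; simp [vecOfList, List.getD]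

@[simp]
theorem vecOfList_cons (n : ℕ) (a : ℤ) (u : List ℤ) :
    vecOfList (n + 1) (a :: u) = Fin.cons a (vecOfList n u) := by
  funext i
  refine Fin.cases ?_ (fun i => ?_) i <;> simp [vecOfList]

/-- The linear combination of the elements of a list with coefficients `y 0, y 1, …`. -/
def comb {V : Type*} [AddCommGroup V] : List V → (ℕ → ℤ) → V
  | [], _ => 0
  | c :: l, y => y 0 • c + comb l fun i => y (i + 1)

theorem comb_eq_sum {V : Type*} [AddCommGroup V] (l : List V) (y : ℕ → ℤ) :
    comb l y = ∑ i : Fin l.length, y i • l.get i := by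
  induction l generalizing y with
  | nil => simp [comb]
  | cons c l ih => simp [comb, ih, Fin.sum_univ_succ]

theorem foldr_eq_comb (n : ℕ) (cols : List (List ℤ)) (y : ℕ → ℤ) :
    vecOfList n ((List.range cols.length).foldr
      (fun i acc => addVec (smulVec (y i) (cols.getD i [])) acc) []) =
      comb (cols.map (vecOfList n)) y := by
  induction cols generalizing y with
  | nil => simp [comb]
  | cons c l ih =>
    simp only [List.length_cons, List.range_succ_eq_map, List.foldr_cons, List.foldr_map,
      vecOfList_addVec, vecOfList_smulVec, List.map_cons, comb]
    rw [← ih]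
    simp

theorem vecOfList_lincomb (n : ℕ) (cols : List (List ℤ)) (y : List ℤ) :
    vecOfList n (lincomb cols y) = comb (cols.map (vecOfList n)) fun i => y.getD i 0 :=
  foldr_eq_comb n cols fun i => y.getD i 0

/-- The additive monoid generated by a list of vectors. -/
def monoidSpan (n : ℕ) (cols : List (List ℤ)) : AddSubmonoid (Fin n → ℤ) :=
  AddSubmonoid.closure {v | ∃ c ∈ cols, vecOfList n c = v}

theorem vecOfList_mem_monoidSpan {n : ℕ} {cols : List (List ℤ)} {c : List ℤ} (h : c ∈ cols) :
    vecOfList n c ∈ monoidSpan n cols := AddSubmonoid.subset_closure ⟨c, h, rfl⟩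

theorem monoidSpan_mono {n : ℕ} {l m : List (List ℤ)} (h : ∀ c ∈ l, c ∈ m) :
    monoidSpan n l ≤ monoidSpan n m :=
  AddSubmonoid.closure_mono fun _ ⟨c, hc, e⟩ => ⟨c, h c hc, e⟩

theorem comb_mem_monoidSpan (n : ℕ) (cols : List (List ℤ)) (y : ℕ → ℕ) :
    comb (cols.map (vecOfList n)) (fun i => (y i : ℤ)) ∈ monoidSpan n cols := by
  induction cols generalizing y with
  | nil => exact zero_mem _
  | cons c l ih =>
    simp only [List.map_cons, comb, natCast_zsmul]
    exact add_mem (nsmul_mem (vecOfList_mem_monoidSpan (by simp)) _)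
      (monoidSpan_mono (by simp +contextual) (ih fun i => y (i + 1)))

theorem monoidSpan_cons (n : ℕ) (c : List ℤ) (l : List (List ℤ)) :
    monoidSpan n (c :: l) = AddSubmonoid.closure {vecOfList n c} ⊔ monoidSpan n l := by
  rw [monoidSpan, monoidSpan, ← AddSubmonoid.closure_union]
  congr 1
  ext v
  simp [eq_comm]

theorem monoidSpan_append (n : ℕ) (l m : List (List ℤ)) :
    monoidSpan n (l ++ m) = monoidSpan n l ⊔ monoidSpan n m := by
  rw [monoidSpan, monoidSpan, monoidSpan, ← AddSubmonoid.closure_union]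
  congr 1
  ext v
  simp [or_and_right, exists_or]

theorem exists_comb_of_mem_monoidSpan {n : ℕ} {cols : List (List ℤ)} {v : Fin n → ℤ}
    (h : v ∈ monoidSpan n cols) :
    ∃ y : List ℕ, comb (cols.map (vecOfList n)) (fun i => ((y.getD i 0 : ℕ) : ℤ)) = v := by
  induction cols generalizing v with
  | nil =>
    refine ⟨[], ?_⟩
    have : v = 0 := by simpa [monoidSpan] using h
    simp [comb, this]
  | cons c l ih =>
    rw [monoidSpan_cons, AddSubmonoid.mem_sup] at h
    obtain ⟨a, ha, b, hb, rfl⟩ := h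
    obtain ⟨k, rfl⟩ := AddSubmonoid.mem_closure_singleton.1 ha
    obtain ⟨y, rfl⟩ := ih hb
    exact ⟨k :: y, by simp [comb]⟩

theorem exists_subsetSums_of_comb (n : ℕ) (cols : List (List ℤ)) (y : ℕ → ℕ) :
    ∃ e ∈ subsetSums cols, comb (cols.map (vecOfList n)) (fun i => (y i : ℤ)) =
      vecOfList n e + (2 : ℤ) • comb (cols.map (vecOfList n)) (fun i => ((y i / 2 : ℕ) : ℤ)) := by
  induction cols generalizing y with
  | nil => exact ⟨[], by simp [subsetSums], by simp [comb]⟩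
  | cons c l ih =>
    obtain ⟨e, he, h⟩ := ih fun i => y (i + 1)
    have hsub : subsetSums (c :: l) =
      subsetSums l ++ (subsetSums l).map fun u => addVec c u := rfl
    rcases Nat.mod_two_eq_zero_or_one (y 0) with h0 | h0
    · refine ⟨e, by simp [hsub, he], ?_⟩
      have hy : ((y 0 : ℕ) : ℤ) = 2 * ((y 0 / 2 : ℕ) : ℤ) := by omega
      simp only [List.map_cons, comb, h]
      rw [hy]
      module
    · refine ⟨addVec c e, by rw [hsub]; simp only [List.mem_append, List.mem_map]; exact Or.inr ⟨e, he, rfl⟩, ?_⟩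
      have hy : ((y 0 : ℕ) : ℤ) = 1 + 2 * ((y 0 / 2 : ℕ) : ℤ) := by omega
      simp only [List.map_cons, comb, h, vecOfList_addVec]
      rw [hy]
      module

theorem vecOfList_mem_monoidSpan_of_mem_subsetSums {n : ℕ} {cols : List (List ℤ)} {e : List ℤ}
    (h : e ∈ subsetSums cols) : vecOfList n e ∈ monoidSpan n cols := by
  induction cols generalizing e with
  | nil =>
    have : e = [] := by simpa [subsetSums] using h
    simp [this]
  | cons c l ih =>
    have hsub : subsetSums (c :: l) =
      subsetSums l ++ (subsetSums l).map fun u => addVec c u := rfl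
    rw [hsub] at h
    have hmono : monoidSpan n l ≤ monoidSpan n (c :: l) := monoidSpan_mono (by simp +contextual)
    rcases List.mem_append.1 h with h | h
    · exact hmono (ih h)
    · obtain ⟨u, hu, rfl⟩ := List.mem_map.1 h
      rw [vecOfList_addVec]
      exact add_mem (vecOfList_mem_monoidSpan (by simp)) (hmono (ih hu))

theorem exists_subsetSums_of_mem_monoidSpan {n : ℕ} {cols : List (List ℤ)} {v : Fin n → ℤ}
    (h : v ∈ monoidSpan n cols) :
    ∃ e ∈ subsetSums cols, ∃ w ∈ monoidSpan n cols, v = vecOfList n e + (2 : ℤ) • w := by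
  obtain ⟨y, rfl⟩ := exists_comb_of_mem_monoidSpan h
  obtain ⟨e, he, h⟩ := exists_subsetSums_of_comb n cols fun i => y.getD i 0
  exact ⟨e, he, _, comb_mem_monoidSpan n cols fun i => y.getD i 0 / 2, h⟩

theorem eqVecModTwo_iff {n : ℕ} {u v : List ℤ} :
    eqVecModTwo n u v = true ↔ ∃ w : Fin n → ℤ, vecOfList n u = vecOfList n v + (2 : ℤ) • w := by
  simp only [eqVecModTwo, List.all_eq_true, List.mem_range, decide_eq_true_eq]
  constructor
  · intro h
    refine ⟨fun i => (u.getD i 0 - v.getD i 0) / 2, ?_⟩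
    funext i
    have := h i i.2
    simp only [vecOfList, Pi.add_apply, Pi.smul_apply, smul_eq_mul]
    omega
  · rintro ⟨w, hw⟩ i hi
    have := congrFun hw ⟨i, hi⟩
    simp only [vecOfList, Pi.add_apply, Pi.smul_apply, smul_eq_mul] at this
    omega

/-! ### Certificates based on binary expansions -/

/-- The vectors of `ℤ^n` with entries of absolute value at most `M`. -/
def box (n : ℕ) (M : ℕ) : Set (Fin n → ℤ) := {v | ∀ i, |v i| ≤ (M : ℤ)}

theorem finite_box (n M : ℕ) : (box n M).Finite := by
  refine (Set.finite_Icc (fun _ : Fin n => -(M : ℤ)) fun _ => (M : ℤ)).subset fun v hv => ?_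
  exact ⟨fun i => (abs_le.1 (hv i)).1, fun i => (abs_le.1 (hv i)).2⟩

theorem exists_mem_box (n : ℕ) (l : List (List ℤ)) :
    ∃ M : ℕ, ∀ u ∈ l, vecOfList n u ∈ box n M := by
  induction l with
  | nil => exact ⟨0, by simp⟩
  | cons u l ih =>
    obtain ⟨M, hM⟩ := ih
    refine ⟨M + ∑ i, (vecOfList n u i).natAbs, ?_⟩
    intro v hv i
    push_cast
    have hs : (0 : ℤ) ≤ ∑ i, |vecOfList n u i| := Finset.sum_nonneg fun _ _ => abs_nonneg _
    rcases List.mem_cons.1 hv with rfl | hv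
    · have := Finset.single_le_sum (f := fun i => |vecOfList n v i|)
        (fun _ _ => abs_nonneg _) (Finset.mem_univ i)
      omega
    · have := hM v hv i
      omega

theorem exists_bound_comb (n : ℕ) (cols : List (List ℤ)) {v : Fin n → ℤ}
    (h : v ∈ monoidSpan n cols) : ∃ (N : ℕ) (y : ℕ → ℕ), (∀ i, y i < 2 ^ N) ∧
      comb (cols.map (vecOfList n)) (fun i => (y i : ℤ)) = v := by
  obtain ⟨y, hy⟩ := exists_comb_of_mem_monoidSpan h
  refine ⟨y.sum, fun i => y.getD i 0, fun i => ?_, hy⟩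
  refine lt_of_le_of_lt (?_ : y.getD i 0 ≤ y.sum) Nat.lt_two_pow_self
  by_cases hi : i < y.length
  · rw [List.getD_eq_getElem _ _ hi]
    exact List.le_sum_of_mem (List.getElem_mem hi)
  · rw [List.getD_eq_default _ _ (by omega)]
    exact Nat.zero_le _

theorem comb_zero {V : Type*} [AddCommGroup V] (l : List V) :
    comb l (fun _ => 0) = 0 := by
  simp [comb_eq_sum]

/-- Checks a certificate `S` for the fact that `b` is not in the monoid generated by `cols`: a
list of vectors that contains `b` but not the zero vector and is closed under subtracting a subset
sum of `cols` and halving. -/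
def checkInfeasible (n : ℕ) (cols : List (List ℤ)) (b : List ℤ) (S : List (List ℤ)) : Bool :=
  (S.any fun s => eqVec n b s) && S.all fun s => (!eqVec n s []) &&
    (subsetSums cols).all fun e => (!eqVecModTwo n s e) ||
      S.any fun s' => eqVec n s (addVec e (smulVec 2 s'))

theorem not_mem_of_checkInfeasible {n : ℕ} {cols : List (List ℤ)} {b : List ℤ}
    {S : List (List ℤ)} (h : checkInfeasible n cols b S = true) :
    vecOfList n b ∉ monoidSpan n cols := by
  simp only [checkInfeasible, Bool.and_eq_true, List.any_eq_true, List.all_eq_true,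
    Bool.not_eq_true', Bool.or_eq_true, ← Bool.not_eq_true, eqVec_iff, eqVecModTwo_iff,
    vecOfList_addVec, vecOfList_smulVec, vecOfList_nil] at h
  obtain ⟨⟨b', hb', hb⟩, h⟩ := h
  have key : ∀ (N : ℕ) (y : ℕ → ℕ), (∀ i, y i < 2 ^ N) → ∀ s ∈ S,
      comb (cols.map (vecOfList n)) (fun i => (y i : ℤ)) ≠ vecOfList n s := by
    intro N
    induction N with
    | zero =>
      intro y hy s hs he
      have : y = fun _ => 0 := by funext i; have := hy i; simp at this; exact this
      rw [this] at he
      exact (h s hs).1 (he.symm.trans (comb_zero _))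
    | succ N ih =>
      intro y hy s hs he
      obtain ⟨e, hes, h2⟩ := exists_subsetSums_of_comb n cols y
      rcases (h s hs).2 e hes with h3 | ⟨s', hs', h3⟩
      · exact h3 ⟨_, he.symm.trans h2⟩
      · refine ih (fun i => y i / 2) (fun i => ?_) s' hs' ?_
        · have := hy i
          rw [pow_succ] at this
          omega
        · have h4 := (h2.symm.trans he).trans h3
          have h5 := add_left_cancel h4
          exact smul_right_injective _ (two_ne_zero) h5
  intro hm
  obtain ⟨N, y, hy, he⟩ := exists_bound_comb n cols hm
  exact key N y hy b' hb' (he.trans hb)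

theorem exists_checkInfeasible {n : ℕ} {cols : List (List ℤ)} {b : List ℤ}
    (h : vecOfList n b ∉ monoidSpan n cols) : ∃ S, checkInfeasible n cols b S = true := by
  classical
  obtain ⟨M, hM⟩ := exists_mem_box n (b :: subsetSums cols)
  have hfin : (box n M ∩ {v | v ∉ monoidSpan n cols}).Finite := (finite_box n M).inter_of_left _
  have hmem : ∀ s : List ℤ, s ∈ hfin.toFinset.toList.map List.ofFn →
      vecOfList n s ∈ box n M ∧ vecOfList n s ∉ monoidSpan n cols := by
    intro s hs
    obtain ⟨v, hv, rfl⟩ := List.mem_map.1 hs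
    rw [vecOfList_ofFn]
    simpa using hv
  have hmem' : ∀ v : Fin n → ℤ, v ∈ box n M → v ∉ monoidSpan n cols →
      List.ofFn v ∈ hfin.toFinset.toList.map List.ofFn := by
    intro v h1 h2
    exact List.mem_map.2 ⟨v, by simpa using And.intro h1 h2, rfl⟩
  refine ⟨hfin.toFinset.toList.map List.ofFn, ?_⟩
  simp only [checkInfeasible, Bool.and_eq_true, List.any_eq_true, List.all_eq_true,
    Bool.not_eq_true', Bool.or_eq_true, ← Bool.not_eq_true, eqVec_iff, eqVecModTwo_iff,
    vecOfList_addVec, vecOfList_smulVec, vecOfList_nil]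
  refine ⟨⟨_, hmem' _ (hM b (by simp)) h, (vecOfList_ofFn _).symm⟩, fun s hs => ⟨?_, ?_⟩⟩
  · intro h0
    exact (hmem s hs).2 (h0 ▸ zero_mem _)
  · intro e he
    by_cases hp : ∃ w : Fin n → ℤ, vecOfList n s = vecOfList n e + (2 : ℤ) • w
    · obtain ⟨w, hw⟩ := hp
      refine Or.inr ⟨_, hmem' w (fun i => ?_) (fun hw' => (hmem s hs).2 ?_), by
        rw [vecOfList_ofFn, hw]⟩
      · have h1 := (hmem s hs).1 i
        have h2 := hM e (by simp [he]) i
        have h3 := congrFun hw i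
        simp only [Pi.add_apply, Pi.smul_apply, smul_eq_mul] at h3
        rw [abs_le] at *
        omega
      · rw [hw, two_smul]
        exact add_mem (vecOfList_mem_monoidSpan_of_mem_subsetSums he) (add_mem hw' hw')
    · exact Or.inl hp

/-- A linear system `B · y = s` in natural numbers: the list of the columns of `B`, and `s`. -/
abbrev LinSys : Type := List (List ℤ) × List ℤ

/-- For every element `a` of the monoid generated by `A`, one of the systems of `Q` becomes
solvable when `a` is subtracted from its right hand side. -/
def Covers (n : ℕ) (A : List (List ℤ)) (Q : List LinSys) : Prop :=
  ∀ a ∈ monoidSpan n A, ∃ q ∈ Q, vecOfList n q.2 - a ∈ monoidSpan n q.1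

/-- Checks a certificate for `Covers n A Q₀`: a list of lists of systems that contains `Q₀` and is
closed under reading a binary digit, together with solutions of one system of each list. -/
def checkCovers (n : ℕ) (A : List (List ℤ)) (Q₀ : List LinSys)
    (C : List (List LinSys) × List (List ℤ)) : Bool :=
  (C.1.any fun Q => decide (Q₀ = Q)) && C.1.all fun Q =>
    (Q.any fun q => C.2.any fun y => (y.all fun z => decide (z = (z.toNat : ℤ))) &&
      eqVec n (lincomb q.1 y) q.2) &&
    (subsetSums A).all fun a => C.1.any fun Q' => Q'.all fun q' => Q.any fun q =>
      decide (q.1 = q'.1) && (subsetSums q.1).any fun e =>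
        eqVec n q.2 (addVec a (addVec e (smulVec 2 q'.2)))

@[fun_prop]
theorem primrec_checkInfeasible {α : Type*} [Primcodable α] {f : α → ℕ} {g : α → List (List ℤ)}
    {h : α → List ℤ} {k : α → List (List ℤ)} (hf : Primrec f) (hg : Primrec g) (hh : Primrec h)
    (hk : Primrec k) : Primrec fun a => checkInfeasible (f a) (g a) (h a) (k a) := by
  unfold checkInfeasible; fun_prop

@[fun_prop]
theorem primrec_checkCovers {α : Type*} [Primcodable α] {f : α → ℕ} {g : α → List (List ℤ)}
    {h : α → List LinSys} {k : α → List (List LinSys) × List (List ℤ)} (hf : Primrec f)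
    (hg : Primrec g) (hh : Primrec h) (hk : Primrec k) :
    Primrec fun a => checkCovers (f a) (g a) (h a) (k a) := by
  unfold checkCovers; fun_prop

theorem checkCovers_iff {n : ℕ} {A : List (List ℤ)} {Q₀ : List LinSys}
    {C : List (List LinSys) × List (List ℤ)} :
    checkCovers n A Q₀ C = true ↔ Q₀ ∈ C.1 ∧ ∀ Q ∈ C.1,
      (∃ q ∈ Q, ∃ y ∈ C.2, (∀ z ∈ y, z = (z.toNat : ℤ)) ∧
        vecOfList n (lincomb q.1 y) = vecOfList n q.2) ∧
      ∀ a ∈ subsetSums A, ∃ Q' ∈ C.1, ∀ q' ∈ Q', ∃ q ∈ Q, q.1 = q'.1 ∧ ∃ e ∈ subsetSums q.1,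
        vecOfList n q.2 = vecOfList n a + (vecOfList n e + (2 : ℤ) • vecOfList n q'.2) := by
  simp only [checkCovers, Bool.and_eq_true, List.any_eq_true, List.all_eq_true, decide_eq_true_eq,
    eqVec_iff, vecOfList_addVec, vecOfList_smulVec, exists_eq_right']

theorem covers_of_checkCovers {n : ℕ} {A : List (List ℤ)} {Q₀ : List LinSys}
    {C : List (List LinSys) × List (List ℤ)} (h : checkCovers n A Q₀ C = true) :
    Covers n A Q₀ := by
  rw [checkCovers_iff] at h
  obtain ⟨hQ₀, h⟩ := h
  have key : ∀ (N : ℕ) (y : ℕ → ℕ), (∀ i, y i < 2 ^ N) → ∀ Q ∈ C.1, ∃ q ∈ Q,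
      vecOfList n q.2 - comb (A.map (vecOfList n)) (fun i => (y i : ℤ)) ∈ monoidSpan n q.1 := by
    intro N
    induction N with
    | zero =>
      intro y hy Q hQ
      have hy0 : y = fun _ => 0 := by funext i; have := hy i; simp at this; exact this
      obtain ⟨q, hq, z, -, hz, he⟩ := (h Q hQ).1
      refine ⟨q, hq, ?_⟩
      have h0 : comb (A.map (vecOfList n)) (fun i => (y i : ℤ)) = 0 := by
        rw [hy0]; exact comb_zero _
      rw [h0, sub_zero, ← he, vecOfList_lincomb]
      have := comb_mem_monoidSpan n q.1 fun i => (z.getD i 0).toNat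
      convert this using 3 with i
      by_cases hi : i < z.length
      · rw [List.getD_eq_getElem _ _ hi]
        exact hz _ (List.getElem_mem hi)
      · rw [List.getD_eq_default _ _ (by omega)]
        rfl
    | succ N ih =>
      intro y hy Q hQ
      obtain ⟨a, ha, h2⟩ := exists_subsetSums_of_comb n A y
      obtain ⟨Q', hQ', h3⟩ := (h Q hQ).2 a ha
      obtain ⟨q', hq', h4⟩ := ih (fun i => y i / 2) (fun i => by
        have := hy i
        rw [pow_succ] at this
        omega) Q' hQ'
      obtain ⟨q, hq, hqq, e, he, h5⟩ := h3 q' hq'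
      refine ⟨q, hq, ?_⟩
      rw [h5, h2]
      rw [← hqq] at h4
      have : vecOfList n a + (vecOfList n e + (2 : ℤ) • vecOfList n q'.2) -
        (vecOfList n a + (2 : ℤ) • comb (A.map (vecOfList n)) fun i => ((y i / 2 : ℕ) : ℤ)) =
        vecOfList n e + ((vecOfList n q'.2 - comb (A.map (vecOfList n))
          fun i => ((y i / 2 : ℕ) : ℤ)) + (vecOfList n q'.2 - comb (A.map (vecOfList n))
          fun i => ((y i / 2 : ℕ) : ℤ))) := by module
      rw [this]
      exact add_mem (vecOfList_mem_monoidSpan_of_mem_subsetSums he) (add_mem h4 h4)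
  intro a ha
  obtain ⟨N, y, hy, rfl⟩ := exists_bound_comb n A ha
  exact key N y hy Q₀ hQ₀

theorem exists_list_forall_mem {β γ : Type*} (l : List β) (R : β → γ → Prop)
    (h : ∀ b ∈ l, ∃ c, R b c) : ∃ C : List γ, ∀ b ∈ l, ∃ c ∈ C, R b c := by
  classical
  choose f hf using h
  exact ⟨l.attach.map fun b => f b.1 b.2, fun b hb => ⟨f b hb,
    List.mem_map.2 ⟨⟨b, hb⟩, by simp, rfl⟩, hf b hb⟩⟩

theorem exists_checkCovers {n : ℕ} {A : List (List ℤ)} {Q₀ : List LinSys}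
    (h : Covers n A Q₀) : ∃ C, checkCovers n A Q₀ C = true := by
  classical
  obtain ⟨M, hM⟩ := exists_mem_box n (Q₀.map Prod.snd ++ subsetSums A ++
    Q₀.flatMap fun q => subsetSums q.1)
  have hMs : ∀ q ∈ Q₀, vecOfList n q.2 ∈ box n M := fun q hq => hM _ (by
    simp only [List.mem_append, List.mem_map]; exact Or.inl (Or.inl ⟨q, hq, rfl⟩))
  have hMa : ∀ a ∈ subsetSums A, vecOfList n a ∈ box n M := fun a ha => hM _ (by simp [ha])
  have hMe : ∀ q ∈ Q₀, ∀ e ∈ subsetSums q.1, vecOfList n e ∈ box n M := fun q hq e he => hM _ (by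
    simp only [List.mem_append, List.mem_flatMap]; exact Or.inr ⟨q, hq, he⟩)
  set Ω : List LinSys := (Q₀.map Prod.fst).product
    ((finite_box n (2 * M)).toFinset.toList.map List.ofFn) with hΩ
  have hmem : ∀ q, q ∈ Ω → (∃ q₀ ∈ Q₀, q₀.1 = q.1) ∧ vecOfList n q.2 ∈ box n (2 * M) := by
    rintro ⟨B, s⟩ hq
    obtain ⟨h1, h2⟩ := List.pair_mem_product.1 hq
    obtain ⟨v, hv, rfl⟩ := List.mem_map.1 h2
    rw [vecOfList_ofFn]
    exact ⟨by simpa using h1, by simpa using hv⟩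
  have hmem' : ∀ q ∈ Q₀, ∀ v ∈ box n (2 * M), (q.1, List.ofFn v) ∈ Ω := by
    intro q hq v hv
    exact List.pair_mem_product.2
      ⟨List.mem_map.2 ⟨q, hq, rfl⟩, List.mem_map.2 ⟨v, by simpa using hv, rfl⟩⟩
  set 𝒮 : List (List LinSys) := Q₀ :: Ω.sublists.filter fun Q => decide (Covers n A Q) with h𝒮
  have hS : ∀ Q ∈ 𝒮, Covers n A Q ∧ ∀ q ∈ Q, (∃ q₀ ∈ Q₀, q₀.1 = q.1) ∧
      vecOfList n q.2 ∈ box n (2 * M) := by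
    intro Q hQ
    rcases List.mem_cons.1 hQ with rfl | hQ
    · refine ⟨h, fun q hq => ⟨⟨q, hq, rfl⟩, fun i => (hMs q hq i).trans ?_⟩⟩
      push_cast; omega
    · simp only [List.mem_filter, List.mem_sublists, decide_eq_true_eq] at hQ
      exact ⟨hQ.2, fun q hq => hmem q (hQ.1.subset hq)⟩
  obtain ⟨Y, hY⟩ := exists_list_forall_mem 𝒮 (fun Q (y : List ℤ) => ∃ q ∈ Q,
      (∀ z ∈ y, z = (z.toNat : ℤ)) ∧ vecOfList n (lincomb q.1 y) = vecOfList n q.2) (by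
    intro Q hQ
    obtain ⟨q, hq, h1⟩ := (hS Q hQ).1 0 (zero_mem _)
    rw [sub_zero] at h1
    obtain ⟨y, hy⟩ := exists_comb_of_mem_monoidSpan h1
    refine ⟨castList y, q, hq, fun z hz => ?_, ?_⟩
    · obtain ⟨k, -, rfl⟩ := List.mem_map.1 hz
      simp
    · simp only [vecOfList_lincomb, ← hy, getD_castList])
  refine ⟨(𝒮, Y), checkCovers_iff.2 ⟨by simp [h𝒮], fun Q hQ => ⟨?_, fun a ha => ?_⟩⟩⟩
  · obtain ⟨y, hy, q, hq, h1, h2⟩ := hY Q hQ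
    exact ⟨q, hq, y, hy, h1, h2⟩
  · set Q' : List LinSys := Ω.filter fun q' => decide (∃ q ∈ Q, q.1 = q'.1 ∧
      ∃ e ∈ subsetSums q.1, vecOfList n q.2 =
        vecOfList n a + (vecOfList n e + (2 : ℤ) • vecOfList n q'.2)) with hQ'
    refine ⟨Q', ?_, fun q' hq' => ?_⟩
    · refine List.mem_cons_of_mem _ (List.mem_filter.2 ⟨List.mem_sublists.2
        List.filter_sublist, decide_eq_true ?_⟩)
      intro a' ha'
      obtain ⟨q, hq, h1⟩ := (hS Q hQ).1 (vecOfList n a + (2 : ℤ) • a') (by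
        rw [two_smul]
        exact add_mem (vecOfList_mem_monoidSpan_of_mem_subsetSums ha) (add_mem ha' ha'))
      obtain ⟨e, he, c, hc, h2⟩ := exists_subsetSums_of_mem_monoidSpan h1
      have h3 : vecOfList n q.2 = vecOfList n a + (vecOfList n e + (2 : ℤ) • (a' + c)) := by
        rw [sub_eq_iff_eq_add] at h2
        rw [h2]; module
      obtain ⟨⟨q₀, hq₀, h4⟩, h5⟩ := (hS Q hQ).2 q hq
      have hbox : a' + c ∈ box n (2 * M) := by
        intro i
        have e1 := h5 i
        have e2 := hMa a ha i
        have e3 := hMe q₀ hq₀ e (h4 ▸ he) i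
        have e4 := congrFun h3 i
        rw [Pi.add_apply, Pi.add_apply, Pi.smul_apply, smul_eq_mul] at e4
        rw [abs_le] at *
        push_cast at *
        omega
      refine ⟨(q₀.1, List.ofFn (a' + c)), List.mem_filter.2 ⟨hmem' q₀ hq₀ _ hbox,
        decide_eq_true ⟨q, hq, h4.symm, e, he, by rw [vecOfList_ofFn]; exact h3⟩⟩, ?_⟩
      simp only [vecOfList_ofFn, add_sub_cancel_left]
      rw [h4]; exact hc
    · exact of_decide_eq_true (List.mem_filter.1 hq').2

end VirtAb

namespace VirtAb

/-! ### Polyhedral descriptions of proper linear sets -/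

/-- The vector with natural entries given by a list. -/
def natVec (m : ℕ) (u : List ℕ) : Fin m → ℕ := fun i => u.getD i 0

/-- The scalar product of two vectors of `ℤ^m`. -/
def dotVec (m : ℕ) (u v : List ℤ) : ℤ :=
  (List.range m).foldr (fun i acc => u.getD i 0 * v.getD i 0 + acc) 0

/-- The `j`-th standard basis vector. -/
def unitVec (j : ℕ) : List ℤ := (List.range j).map (fun _ => 0) ++ [1]

/-- The data `(b, P, F, d)` of a linear set with base `b`, periods `P` and a family `F` of integral
linear forms dual to `P` up to the factor `d + 1`. -/
abbrev LinPiece : Type := List ℕ × List (List ℕ) × List (List ℤ) × ℕ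

/-- The linear set with the given data. -/
def LinPiece.toSet (m : ℕ) (q : LinPiece) : Set (Fin m → ℕ) :=
  {w | ∃ a ∈ AddSubmonoid.closure {v | ∃ u ∈ q.2.1, natVec m u = v}, w = natVec m q.1 + a}

/-- Whether the linear forms are dual to the periods. -/
def LinPiece.check (m : ℕ) (q : LinPiece) : Bool :=
  decide (q.2.1.length = q.2.2.1.length) && (List.range q.2.1.length).all fun i =>
    (List.range q.2.1.length).all fun k =>
      decide (dotVec m (q.2.2.1.getD i []) (castList (q.2.1.getD k [])) =
        bif decide (i = k) then ((q.2.2.2 + 1 : ℕ) : ℤ) else 0)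

/-- The linear form which vanishes on the linear span of the periods and is the difference of `d + 1`
times the `j`-th coordinate and a combination of the dual forms. -/
def LinPiece.row (q : LinPiece) (j : ℕ) : List ℤ :=
  addVec (smulVec ((q.2.2.2 + 1 : ℕ) : ℤ) (unitVec j))
    (smulVec (-1) (lincomb q.2.2.1 (q.2.1.map fun u => ((u.getD j 0 : ℕ) : ℤ))))

/-- A description of the linear set as a basic polyhedral set. -/
def LinPiece.code (m : ℕ) (q : LinPiece) : List ElementaryCode :=
  ((List.range q.2.1.length).flatMap fun i =>
    [.inr (.inl (q.2.2.1.getD i [], dotVec m (q.2.2.1.getD i []) (castList q.1),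
      q.2.2.2.succPNat)),
     .inr (.inr (q.2.2.1.getD i [], dotVec m (q.2.2.1.getD i []) (castList q.1) - 1))]) ++
  (List.range m).map fun j => .inl (q.row j, dotVec m (q.row j) (castList q.1))

section Primrec

variable {α : Type*} [Primcodable α]

@[fun_prop]
theorem primrec_dotVec {f : α → ℕ} {g h : α → List ℤ} (hf : Primrec f) (hg : Primrec g)
    (hh : Primrec h) : Primrec fun a => dotVec (f a) (g a) (h a) := by
  unfold dotVec; fun_prop

@[fun_prop]
theorem primrec_unitVec {f : α → ℕ} (hf : Primrec f) : Primrec fun a => unitVec (f a) := by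
  unfold unitVec; fun_prop

@[fun_prop]
theorem primrec_linPiece_check {f : α → ℕ} {g : α → LinPiece} (hf : Primrec f)
    (hg : Primrec g) : Primrec fun a => (g a).check (f a) := by
  unfold LinPiece.check; fun_prop

@[fun_prop]
theorem primrec_linPiece_row {f : α → ℕ} {g : α → LinPiece} (hf : Primrec f)
    (hg : Primrec g) : Primrec fun a => (g a).row (f a) := by
  unfold LinPiece.row; fun_prop

@[fun_prop]
theorem primrec_linPiece_code {f : α → ℕ} {g : α → LinPiece} (hf : Primrec f)
    (hg : Primrec g) : Primrec fun a => (g a).code (f a) := by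
  unfold LinPiece.code; fun_prop

end Primrec

theorem dotVec_eq (m : ℕ) (u v : List ℤ) :
    dotVec m u v = ∑ i, vecOfList m u i * vecOfList m v i := by
  have h : ∀ f : ℕ → ℤ, (List.range m).foldr (fun i acc => f i + acc) 0 = ∑ i : Fin m, f i := by
    intro f
    induction m generalizing f with
    | zero => simp
    | succ m ih => simp [List.range_succ_eq_map, List.foldr_map, ih, Fin.sum_univ_succ]
  exact h fun i => u.getD i 0 * v.getD i 0

theorem vecOfList_castList (m : ℕ) (u : List ℕ) :
    vecOfList m (castList u) = fun i => ((natVec m u i : ℕ) : ℤ) := by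
  funext i; exact getD_castList u i

theorem vecOfList_unitVec {m : ℕ} (j : Fin m) : vecOfList m (unitVec j) = Pi.single j 1 := by
  funext i
  rw [vecOfList, unitVec]
  rcases lt_trichotomy (i : ℕ) j with h | h | h
  · rw [Pi.single_eq_of_ne (by rintro rfl; omega), List.getD_append _ _ _ _ (by simpa using h),
      getD_map_range, if_pos h]
  · have : i = j := Fin.ext h
    subst this
    rw [List.getD_append_right _ _ _ _ (by simp)]
    simp
  · rw [Pi.single_eq_of_ne (by rintro rfl; omega), List.getD_eq_default]
    simpa using h

/-- The value of the linear form with number `i` at a vector. -/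
def LinPiece.form (m : ℕ) (q : LinPiece) (i : ℕ) : (Fin m → ℤ) →+ ℤ where
  toFun z := ∑ j, vecOfList m (q.2.2.1.getD i []) j * z j
  map_zero' := by simp
  map_add' x y := by simp [mul_add, Finset.sum_add_distrib]

theorem LinPiece.row_apply {m : ℕ} (q : LinPiece) (hq : q.2.1.length = q.2.2.1.length)
    (j : Fin m) (z : Fin m → ℤ) :
    ∑ l, vecOfList m (q.row j) l * z l = ((q.2.2.2 + 1 : ℕ) : ℤ) * z j -
      ∑ i : Fin q.2.1.length, ((q.2.1.get i).getD j 0 : ℕ) * q.form m i z := by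
  obtain ⟨b, P, F, d⟩ := q
  simp only at hq
  simp only [LinPiece.row, vecOfList_addVec, vecOfList_smulVec, vecOfList_lincomb,
    vecOfList_unitVec]
  have h1 : comb (F.map (vecOfList m)) (fun i => (P.map fun u => ((u.getD j 0 : ℕ) : ℤ)).getD i 0)
      = ∑ i : Fin P.length, (((P.get i).getD j 0 : ℕ) : ℤ) • vecOfList m (F.getD i []) := by
    rw [comb_eq_sum]
    refine Fintype.sum_equiv (finCongr (by simp [hq])) _ _ fun i => ?_
    have hi : (i : ℕ) < F.length := by simpa using i.2
    have hi' : (i : ℕ) < P.length := by omega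
    simp [List.getD, hi, hi']
  rw [h1]
  simp only [Pi.add_apply, Pi.smul_apply, Finset.sum_apply, smul_eq_mul, add_mul,
    Finset.sum_add_distrib, LinPiece.form, AddMonoidHom.coe_mk, ZeroHom.coe_mk]
  rw [sub_eq_add_neg]
  congr 1
  · rw [Finset.sum_eq_single j]
    · simp
    · intro l _ hl; simp [hl]
    · simp
  · simp only [neg_mul, one_mul, Finset.sum_neg_distrib, neg_inj, Finset.sum_mul, Finset.mul_sum]
    rw [Finset.sum_comm]
    exact Finset.sum_congr rfl fun i _ => Finset.sum_congr rfl fun l _ => by ring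

theorem LinPiece.mem_code_iff {m : ℕ} {q : LinPiece} (h : q.check m = true) (z : Fin m → ℤ) :
    (∀ s ∈ q.code m, z ∈ ElementaryCode.toSet m s) ↔
      ∃ w ∈ q.toSet m, z = fun i => ((w i : ℕ) : ℤ) := by
  simp only [LinPiece.check, Bool.and_eq_true, decide_eq_true_eq, List.all_eq_true,
    List.mem_range] at h
  obtain ⟨hlen, hdual⟩ := h
  set D : ℤ := ((q.2.2.2 + 1 : ℕ) : ℤ) with hD
  have hDpos : 0 < D := by positivity
  set b : Fin m → ℤ := fun i => ((natVec m q.1 i : ℕ) : ℤ) with hb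
  have hdual' : ∀ i < q.2.1.length, ∀ k < q.2.1.length, q.form m i
      (fun l => ((natVec m (q.2.1.getD k []) l : ℕ) : ℤ)) = if i = k then D else 0 := by
    intro i hi k hk
    have := hdual i hi k hk
    rw [dotVec_eq, vecOfList_castList] at this
    rw [LinPiece.form, AddMonoidHom.coe_mk, ZeroHom.coe_mk, this]
    by_cases hik : i = k <;> simp [hik]
  have hcode : (∀ s ∈ q.code m, z ∈ ElementaryCode.toSet m s) ↔
      (∀ i < q.2.1.length, (q.form m i z ≡ q.form m i b [ZMOD D]) ∧
        q.form m i z > q.form m i b - 1) ∧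
      ∀ j : Fin m, ∑ l, vecOfList m (q.row j) l * z l = ∑ l, vecOfList m (q.row j) l * b l := by
    have hd : D = (q.2.2.2 : ℤ) + 1 := by simp [hD]
    constructor
    · intro hs
      simp only [LinPiece.code, List.mem_append, List.mem_flatMap, List.mem_map,
        List.mem_range] at hs
      refine ⟨fun i hi => ⟨?_, ?_⟩, fun j => ?_⟩
      · have := hs _ (Or.inl ⟨i, hi, List.mem_cons_self ..⟩)
        simpa [ElementaryCode.toSet, dotVec_eq, vecOfList_castList, hd, hb, LinPiece.form] using this
      · have := hs _ (Or.inl ⟨i, hi, List.mem_cons_of_mem _ (List.mem_cons_self ..)⟩)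
        simpa [ElementaryCode.toSet, dotVec_eq, vecOfList_castList, LinPiece.form] using this
      · have := hs _ (Or.inr ⟨j, j.2, rfl⟩)
        simpa [ElementaryCode.toSet, dotVec_eq, vecOfList_castList] using this
    · rintro ⟨h1, h2⟩ s hs
      simp only [LinPiece.code, List.mem_append, List.mem_flatMap, List.mem_map,
        List.mem_range, List.mem_cons, List.not_mem_nil, or_false] at hs
      rcases hs with ⟨i, hi, rfl | rfl⟩ | ⟨j, hj, rfl⟩
      · simpa [ElementaryCode.toSet, dotVec_eq, vecOfList_castList, hd, hb, LinPiece.form] using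
          (h1 i hi).1
      · simpa [ElementaryCode.toSet, dotVec_eq, vecOfList_castList, LinPiece.form] using
          (h1 i hi).2
      · simpa [ElementaryCode.toSet, dotVec_eq, vecOfList_castList] using h2 ⟨j, hj⟩
  rw [hcode]
  simp only [LinPiece.row_apply q hlen, ← hD]
  constructor
  · rintro ⟨h1, h2⟩
    have h3 : ∀ i : Fin q.2.1.length, ∃ k : ℕ, q.form m i z - q.form m i b = D * k := by
      intro i
      obtain ⟨k, hk⟩ := (h1 i i.2).1.symm.dvd
      have h4 := (h1 i i.2).2
      have hk0 : 0 ≤ k := by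
        by_contra hneg
        have : D * k ≤ -D := by nlinarith
        omega
      exact ⟨k.toNat, by rw [hk, Int.toNat_of_nonneg hk0]⟩
    choose c hc using h3
    refine ⟨natVec m q.1 + ∑ i : Fin q.2.1.length, c i • natVec m (q.2.1.get i), ⟨_, ?_, rfl⟩, ?_⟩
    · refine sum_mem fun i _ => nsmul_mem ?_ _
      exact AddSubmonoid.subset_closure ⟨_, List.get_mem _ _, rfl⟩
    · funext j
      have h4 := h2 j
      have h5 : D * z j - D * b j = D * ∑ i : Fin q.2.1.length,
          (((q.2.1.get i).getD j 0 : ℕ) : ℤ) * c i := by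
        have : D * z j - D * b j = ∑ i : Fin q.2.1.length, (((q.2.1.get i).getD j 0 : ℕ) : ℤ) *
            (q.form m i z - q.form m i b) := by
          simp only [mul_sub, Finset.sum_sub_distrib]
          linarith
        rw [this, Finset.mul_sum]
        exact Finset.sum_congr rfl fun i _ => by rw [hc]; ring
      rw [← mul_sub] at h5
      have h6 := mul_left_cancel₀ hDpos.ne' h5
      simp only [Pi.add_apply, Finset.sum_apply, Pi.smul_apply, smul_eq_mul, Nat.cast_add,
        Nat.cast_sum, Nat.cast_mul]
      rw [sub_eq_iff_eq_add'] at h6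
      rw [h6]
      congr 1
      exact Finset.sum_congr rfl fun i _ => mul_comm _ _
  · clear hcode
    rintro ⟨w, ⟨a, ha, rfl⟩, rfl⟩
    have key : (∀ i < q.2.1.length, (D ∣ q.form m i fun l => ((a l : ℕ) : ℤ)) ∧
        0 ≤ q.form m i fun l => ((a l : ℕ) : ℤ)) ∧ ∀ j : Fin m, D * ((a j : ℕ) : ℤ) =
          ∑ i : Fin q.2.1.length, ((q.2.1.get i).getD j 0 : ℕ) *
            q.form m i fun l => ((a l : ℕ) : ℤ) := by
      induction ha using AddSubmonoid.closure_induction with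
      | mem v hv =>
        obtain ⟨u, hu, rfl⟩ := hv
        obtain ⟨k, hk, rfl⟩ := List.getElem_of_mem hu
        have hkk : q.2.1.getD k [] = q.2.1[k] := List.getD_eq_getElem _ _ hk
        have := fun i hi => hdual' i hi k hk
        rw [hkk] at this
        refine ⟨fun i hi => ?_, fun j => ?_⟩
        · rw [this i hi]
          split_ifs <;> simp [hDpos.le]
        · rw [Finset.sum_eq_single ⟨k, hk⟩]
          · rw [this k hk, if_pos rfl]
            simp [natVec, mul_comm]
          · intro i _ hik
            rw [this i i.2, if_neg (fun h => hik (Fin.ext h)), mul_zero]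
          · simp
      | zero =>
        have h0 : (fun l : Fin m => (((0 : Fin m → ℕ) l : ℕ) : ℤ)) = 0 := by funext; simp
        rw [h0]
        simp
      | add x y _ _ hx hy =>
        have h0 : (fun l : Fin m => (((x + y) l : ℕ) : ℤ)) =
          (fun l => ((x l : ℕ) : ℤ)) + fun l => ((y l : ℕ) : ℤ) := by funext; simp
        rw [h0]
        simp only [map_add, mul_add, Finset.sum_add_distrib]
        refine ⟨fun i hi => ⟨dvd_add (hx.1 i hi).1 (hy.1 i hi).1,
          add_nonneg (hx.1 i hi).2 (hy.1 i hi).2⟩, fun j => ?_⟩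
        rw [← hx.2 j, ← hy.2 j]
        push_cast [Pi.add_apply]
        ring
    have h0 : (fun l : Fin m => (((natVec m q.1 + a) l : ℕ) : ℤ)) =
        b + fun l => ((a l : ℕ) : ℤ) := by funext; simp [hb]
    rw [h0]
    simp only [map_add, mul_add, Finset.sum_add_distrib, Pi.add_apply]
    refine ⟨fun i hi => ⟨?_, ?_⟩, fun j => ?_⟩
    · exact (Int.modEq_iff_dvd.2 (by simpa using (key.1 i hi).1)).symm
    · have := (key.1 i hi).2
      omega
    · rw [← key.2 j]
      ring

theorem exists_dual_family {m N : ℕ} {t : Fin N → Fin m → ℕ}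
    (h : LinearIndependent ℕ t) : ∃ (d : ℕ) (F : Fin N → Fin m → ℤ), ∀ i k,
      ∑ j, F i j * ((t k j : ℕ) : ℤ) = if i = k then ((d + 1 : ℕ) : ℤ) else 0 := by
  have hQ : LinearIndependent ℚ fun i => (fun j => ((t i j : ℕ) : ℚ) : Fin m → ℚ) := by
    rw [← LinearIndependent.iff_fractionRing ℤ ℚ, Fintype.linearIndependent_iff]
    intro g hg i
    rw [Fintype.linearIndependent_iffₛ] at h
    have h1 := h (fun i => (g i).toNat) (fun i => (-g i).toNat) (by
      funext j
      have h2 := congrFun hg j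
      simp only [Finset.sum_apply, Pi.smul_apply, Pi.zero_apply] at h2
      simp only [zsmul_eq_mul] at h2
      simp only [Finset.sum_apply, Pi.smul_apply, smul_eq_mul]
      have h3 : ∑ x, (((g x).toNat : ℚ) * (t x j : ℚ) - ((-g x).toNat : ℚ) * (t x j : ℚ)) = 0 := by
        rw [← h2]
        refine Finset.sum_congr rfl fun x _ => ?_
        rw [← sub_mul]
        congr 1
        have h4 : (((g x).toNat : ℤ) : ℚ) - (((-g x).toNat : ℤ) : ℚ) = g x := by
          rw [← Int.cast_sub]
          congr 1
          omega
        simpa only [Int.cast_natCast] using h4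
      rw [Finset.sum_sub_distrib, sub_eq_zero] at h3
      exact_mod_cast h3) i
    omega
  obtain ⟨L, hL⟩ := LinearMap.exists_leftInverse_of_injective
    (Fintype.linearCombination ℚ fun i => (fun j => ((t i j : ℕ) : ℚ) : Fin m → ℚ))
    (LinearMap.ker_eq_bot.2 (linearIndependent_iff_injective_fintypeLinearCombination.1 hQ))
  obtain ⟨c, hc⟩ := IsLocalization.exist_integer_multiples_of_finite (nonZeroDivisors ℤ)
    fun p : Fin N × Fin m => L (Pi.single p.2 1) p.1
  choose g hg using fun p => hc p
  have hc0 : (c : ℤ) ≠ 0 := nonZeroDivisors.ne_zero c.2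
  refine ⟨(c * c : ℤ).toNat - 1, fun i j => c * g (i, j), fun i k => ?_⟩
  have hcc : (((c * c : ℤ).toNat - 1 + 1 : ℕ) : ℤ) = c * c := by
    have : (0 : ℤ) < c * c := mul_self_pos.2 hc0
    omega
  rw [hcc]
  have h1 : L (fun j => ((t k j : ℕ) : ℚ)) = Pi.single k 1 := by
    have := LinearMap.congr_fun hL (Pi.single k 1)
    simpa [Fintype.linearCombination_apply_single] using this
  have h2 : ∑ j, L (Pi.single j 1) i * ((t k j : ℕ) : ℚ) = if i = k then 1 else 0 := by
    have h3 : (fun j => ((t k j : ℕ) : ℚ)) = ∑ j, ((t k j : ℕ) : ℚ) • (Pi.single j 1 : Fin m → ℚ) := by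
      funext l
      simp [Finset.sum_apply, Pi.single_apply]
    rw [h3, map_sum] at h1
    have h4 := congrFun h1 i
    simp only [Finset.sum_apply, map_smul, Pi.smul_apply, smul_eq_mul, Pi.single_apply] at h4
    rw [← h4]
    exact Finset.sum_congr rfl fun j _ => mul_comm _ _
  have h5 : ((∑ j, c * g (i, j) * ((t k j : ℕ) : ℤ) : ℤ) : ℚ) =
      ((if i = k then (c * c : ℤ) else 0 : ℤ) : ℚ) := by
    push_cast
    have h6 : ∀ j, ((g (i, j) : ℤ) : ℚ) = (c : ℚ) * L (Pi.single j 1) i := by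
      intro j
      have := hg (i, j)
      simpa [Submonoid.smul_def] using this
    simp only [h6]
    have : ∑ x, (c : ℚ) * ((c : ℚ) * L (Pi.single x 1) i) * (t k x : ℚ) =
        (c * c : ℚ) * ∑ j, L (Pi.single j 1) i * ((t k j : ℕ) : ℚ) := by
      rw [Finset.mul_sum]
      exact Finset.sum_congr rfl fun j _ => by ring
    rw [this, h2]
    split_ifs <;> simp
  exact_mod_cast h5

theorem natVec_ofFn {m : ℕ} (v : Fin m → ℕ) : natVec m (List.ofFn v) = v := by
  funext i; simp [natVec, List.getD]

theorem exists_linPiece_of_isProperLinearSet {m : ℕ} {s : Set (Fin m → ℕ)}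
    (h : IsProperLinearSet s) : ∃ q : LinPiece, q.check m = true ∧ q.toSet m = s := by
  classical
  obtain ⟨a, t, hlin, rfl⟩ := isProperLinearSet_iff.1 h
  obtain ⟨N, ⟨e⟩⟩ : ∃ N, Nonempty (Fin N ≃ t) := ⟨_, ⟨t.equivFin.symm⟩⟩
  have hl : LinearIndependent ℕ fun i : Fin N => (e i : Fin m → ℕ) :=
    (LinearIndepOn.linearIndependent hlin).comp _ e.injective
  obtain ⟨d, F, hF⟩ := exists_dual_family hl
  refine ⟨(List.ofFn a, List.ofFn fun i => List.ofFn (e i : Fin m → ℕ),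
    List.ofFn fun i => List.ofFn (F i), d), ?_, ?_⟩
  · simp only [LinPiece.check, List.length_ofFn, decide_true, Bool.true_and, List.all_eq_true,
      List.mem_range, decide_eq_true_eq]
    intro i hi k hk
    rw [dotVec_eq, vecOfList_castList]
    have h1 : (List.ofFn fun i => List.ofFn (F i)).getD i [] = List.ofFn (F ⟨i, hi⟩) := by
      simp [List.getD, hi]
    have h2 : (List.ofFn fun i => List.ofFn (e i : Fin m → ℕ)).getD k [] =
        List.ofFn (e ⟨k, hk⟩ : Fin m → ℕ) := by
      simp [List.getD, hk]
    rw [h1, h2, vecOfList_ofFn, natVec_ofFn, hF]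
    by_cases hik : i = k <;> simp [hik]
  · ext w
    simp only [LinPiece.toSet, natVec_ofFn, Set.mem_ofPred_eq, Set.mem_vadd_set, vadd_eq_add,
      SetLike.mem_coe]
    have : {v | ∃ u ∈ List.ofFn fun i => List.ofFn (e i : Fin m → ℕ), natVec m u = v} =
        (t : Set (Fin m → ℕ)) := by
      ext v
      simp only [List.mem_ofFn, Set.mem_ofPred_eq, exists_exists_eq_and, natVec_ofFn]
      constructor
      · rintro ⟨i, rfl⟩; exact (e i).2
      · intro hv; exact ⟨e.symm ⟨v, hv⟩, by simp⟩
    rw [this]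
    exact exists_congr fun x => and_congr_right fun _ => eq_comm

theorem exists_linPieces_of_isSemilinearSet {m : ℕ} {s : Set (Fin m → ℕ)}
    (h : IsSemilinearSet s) : ∃ l : List LinPiece, (∀ q ∈ l, q.check m = true) ∧
      ∀ w, w ∈ s ↔ ∃ q ∈ l, w ∈ q.toSet m := by
  obtain ⟨S, hS, rfl⟩ := isProperSemilinearSet_iff.1 h.isProperSemilinearSet
  choose f hf hfs using fun t (ht : t ∈ S) => exists_linPiece_of_isProperLinearSet (hS t ht)
  refine ⟨S.toList.attach.map fun t => f t.1 (Finset.mem_toList.1 t.2), ?_, fun w => ?_⟩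
  · intro q hq
    obtain ⟨t, -, rfl⟩ := List.mem_map.1 hq
    exact hf _ _
  · simp only [Set.mem_sUnion, SetLike.mem_coe, List.mem_map, List.mem_attach, true_and,
      Subtype.exists, Finset.mem_toList]
    constructor
    · rintro ⟨t, ht, hw⟩
      exact ⟨_, ⟨t, ht, rfl⟩, by rwa [hfs]⟩
    · rintro ⟨q, ⟨t, ht, rfl⟩, hw⟩
      exact ⟨t, ht, by rwa [hfs] at hw⟩

theorem isPolyhedral_toSet (k : ℕ) (c : PolyhedralCode) :
    IsPolyhedral (PolyhedralCode.toSet k c) := by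
  refine ⟨{X | ∃ b ∈ c, X = {z | ∀ s ∈ b, z ∈ ElementaryCode.toSet k s}}, ?_, ?_, ?_⟩
  · refine (c.finite_toSet.image fun b => {z | ∀ s ∈ b, z ∈ ElementaryCode.toSet k s}).subset ?_
    rintro X ⟨b, hb, rfl⟩
    exact ⟨b, hb, rfl⟩
  · rintro X ⟨b, -, rfl⟩
    refine ⟨ElementaryCode.toSet k '' {s | s ∈ b}, b.finite_toSet.image _, ?_, ?_⟩
    · rintro Y ⟨s, -, rfl⟩
      rcases s with ⟨u, a⟩ | ⟨u, a, b⟩ | ⟨u, a⟩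
      · exact .eq _ _
      · exact .modEq _ _ _
      · exact .gt _ _
    · ext z
      simp
  · ext z
    simp only [PolyhedralCode.toSet, Set.mem_ofPred_eq, Set.mem_sUnion]
    constructor
    · rintro ⟨b, hb, h⟩
      exact ⟨_, ⟨b, hb, rfl⟩, h⟩
    · rintro ⟨X, ⟨b, hb, rfl⟩, h⟩
      exact ⟨b, hb, h⟩

end VirtAb

namespace VirtAb

/-! ### Semilinear systems of minimal representatives -/

section Semilinear

theorem isSemilinearSet_le {M : Type*} [AddCommMonoid M] [AddMonoid.FG M] (a b : ℕ)
    (f g : M →+ ℕ) : IsSemilinearSet {x | a + f x ≤ b + g x} := by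
  have h := isSemilinearSet_setOfPred_eq a b
    (f.comp (AddMonoidHom.fst M ℕ) + AddMonoidHom.snd M ℕ) (g.comp (AddMonoidHom.fst M ℕ))
  convert h.image (AddMonoidHom.fst M ℕ) using 1
  ext x
  simp only [Set.mem_ofPred_eq, AddMonoidHom.add_apply, AddMonoidHom.comp_apply,
    AddMonoidHom.coe_fst, AddMonoidHom.coe_snd, Set.mem_image, Prod.exists, exists_and_right,
    exists_eq_right]
  exact ⟨fun h => ⟨b + g x - (a + f x), by omega⟩, fun ⟨k, hk⟩ => by omega⟩

theorem isSemilinearSet_sub_mem {M V : Type*} [AddCommMonoid M] [AddMonoid.FG M]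
    [AddCommGroup V] {K : AddSubgroup V} (hK : K.FG) (a b : V) (f g : M →+ V) :
    IsSemilinearSet {x | (a + f x) - (b + g x) ∈ K} := by
  obtain ⟨n, φ, hφ⟩ := AddSubmonoid.fg_iff_exists_fin_addMonoidHom.1
    ((AddSubgroup.fg_iff_addSubmonoid_fg K).1 hK)
  have h := isSemilinearSet_setOfPred_eq a b
    (f.comp (AddMonoidHom.fst M (Fin n → ℕ)))
    (g.comp (AddMonoidHom.fst M (Fin n → ℕ)) + φ.comp (AddMonoidHom.snd M (Fin n → ℕ)))
  convert h.image (AddMonoidHom.fst M (Fin n → ℕ)) using 1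
  ext x
  have hx : (a + f x) - (b + g x) ∈ K ↔ (a + f x) - (b + g x) ∈ AddMonoidHom.mrange φ := by
    rw [hφ]; rfl
  simp only [Set.mem_ofPred_eq, AddMonoidHom.add_apply, AddMonoidHom.comp_apply,
    AddMonoidHom.coe_fst, AddMonoidHom.coe_snd, Set.mem_image, Prod.exists, exists_and_right,
    exists_eq_right, hx, AddMonoidHom.mem_mrange]
  refine exists_congr fun e => ?_
  rw [eq_sub_iff_add_eq, eq_comm, add_comm (φ e), add_assoc]

theorem isSemilinearSet_lex (m : ℕ) :
    IsSemilinearSet {x : (Fin m → ℕ) × (Fin m → ℕ) | toLex x.2 < toLex x.1} := by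
  have : {x : (Fin m → ℕ) × (Fin m → ℕ) | toLex x.2 < toLex x.1} =
      ⋃ i, ((⋂ j ∈ {j | j < i}, {x | x.2 j = x.1 j}) ∩ {x | x.2 i < x.1 i}) := by
    ext x
    simp only [Set.mem_ofPred_eq, Set.mem_iUnion, Set.mem_inter_iff, Set.mem_iInter]
    exact Iff.rfl
  rw [this]
  refine .iUnion fun i => .inter (.biInter (Set.toFinite _) fun j _ => ?_) ?_
  · have := isSemilinearSet_setOfPred_eq 0 0
      ((Pi.evalAddMonoidHom (fun _ : Fin m => ℕ) j).comp (AddMonoidHom.snd _ (Fin m → ℕ)))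
      ((Pi.evalAddMonoidHom (fun _ : Fin m => ℕ) j).comp (AddMonoidHom.fst (Fin m → ℕ) _))
    simpa using this
  · have := isSemilinearSet_le (M := (Fin m → ℕ) × (Fin m → ℕ)) 1 0
      ((Pi.evalAddMonoidHom (fun _ : Fin m => ℕ) i).comp (AddMonoidHom.snd _ (Fin m → ℕ)))
      ((Pi.evalAddMonoidHom (fun _ : Fin m => ℕ) i).comp (AddMonoidHom.fst (Fin m → ℕ) _))
    convert this using 1
    ext x
    simp [Nat.lt_iff_add_one_le, add_comm]

/-- Given finitely many affine maps `c p + L p` on `ℕ^(m p)`, coloured by `κ p`, and affine weights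
`ω p + Λ p`, one can choose from the domain of each map a semilinear set of exponents such that every
coset of `K` of a given colour that is hit at all is hit exactly once by the chosen exponents, and
with the smallest possible weight. -/
theorem exists_semilinear_transversal {N : ℕ} {V C : Type*} [AddCommGroup V] {K : AddSubgroup V}
    (hK : K.FG) (m : Fin N → ℕ) (κ : Fin N → C) (c : Fin N → V)
    (L : ∀ p, (Fin (m p) → ℕ) →+ V) (ω : Fin N → ℕ) (Λ : ∀ p, (Fin (m p) → ℕ) →+ ℕ) :
    ∃ U : ∀ p, Set (Fin (m p) → ℕ), (∀ p, IsSemilinearSet (U p)) ∧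
      (∀ p' w', ∃ p, ∃ w ∈ U p, κ p = κ p' ∧ (c p + L p w) - (c p' + L p' w') ∈ K ∧
        ω p + Λ p w ≤ ω p' + Λ p' w') ∧
      ∀ p w p' w', w ∈ U p → w' ∈ U p' → κ p = κ p' →
        (c p + L p w) - (c p' + L p' w') ∈ K →
        (⟨p, w⟩ : Σ p, Fin (m p) → ℕ) = ⟨p', w'⟩ := by
  let same : (Σ p, Fin (m p) → ℕ) → (Σ p, Fin (m p) → ℕ) → Prop := fun x y =>
    κ x.1 = κ y.1 ∧ (c x.1 + L x.1 x.2) - (c y.1 + L y.1 y.2) ∈ K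
  let wt : (Σ p, Fin (m p) → ℕ) → ℕ := fun x => ω x.1 + Λ x.1 x.2
  have symm : ∀ {x y}, same x y → same y x := fun {x y} h =>
    ⟨h.1.symm, by have := K.neg_mem h.2; rwa [neg_sub] at this⟩
  have trans : ∀ {x y z}, same x y → same y z → same x z := fun {x y z} h h' =>
    ⟨h.1.trans h'.1, by have := K.add_mem h.2 h'.2; rwa [sub_add_sub_cancel] at this⟩
  let better : ∀ p : Fin N, (Fin (m p) → ℕ) → Prop := fun p w =>
    ∃ p' w', same ⟨p, w⟩ ⟨p', w'⟩ ∧ (1 + wt ⟨p', w'⟩ ≤ wt ⟨p, w⟩ ∨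
      (p' < p ∧ wt ⟨p', w'⟩ ≤ wt ⟨p, w⟩))
  let betterLex : ∀ p : Fin N, (Fin (m p) → ℕ) → Prop := fun p w =>
    ∃ w', same ⟨p, w⟩ ⟨p, w'⟩ ∧ wt ⟨p, w'⟩ ≤ wt ⟨p, w⟩ ∧ toLex w' < toLex w
  refine ⟨fun p => {w | better p w ∨ betterLex p w}ᶜ, fun p => ?_, ?_, ?_⟩
  · refine IsSemilinearSet.compl ?_
    have hsame : ∀ p', κ p = κ p' →
        IsSemilinearSet {x : (Fin (m p) → ℕ) × (Fin (m p') → ℕ) | same ⟨p, x.1⟩ ⟨p', x.2⟩} := by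
      intro p' hκ
      have := isSemilinearSet_sub_mem hK (c p) (c p')
        ((L p).comp (AddMonoidHom.fst _ (Fin (m p') → ℕ)))
        ((L p').comp (AddMonoidHom.snd (Fin (m p) → ℕ) _))
      convert this using 1
      ext x
      simp [same, hκ]
    have hle : ∀ a p', IsSemilinearSet
        {x : (Fin (m p) → ℕ) × (Fin (m p') → ℕ) | a + wt ⟨p', x.2⟩ ≤ wt ⟨p, x.1⟩} := by
      intro a p'
      have := isSemilinearSet_le (a + ω p') (ω p)
        ((Λ p').comp (AddMonoidHom.snd (Fin (m p) → ℕ) _))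
        ((Λ p).comp (AddMonoidHom.fst _ (Fin (m p') → ℕ)))
      simpa [wt, add_assoc] using this
    have h1 : {w | better p w ∨ betterLex p w} =
        (⋃ p' ∈ {p' | κ p = κ p'}, AddMonoidHom.fst _ _ ''
          ({x : (Fin (m p) → ℕ) × (Fin (m p') → ℕ) | same ⟨p, x.1⟩ ⟨p', x.2⟩} ∩
            {x | 1 + wt ⟨p', x.2⟩ ≤ wt ⟨p, x.1⟩})) ∪
        (⋃ p' ∈ {p' | κ p = κ p' ∧ p' < p}, AddMonoidHom.fst _ _ ''
          ({x : (Fin (m p) → ℕ) × (Fin (m p') → ℕ) | same ⟨p, x.1⟩ ⟨p', x.2⟩} ∩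
            {x | 0 + wt ⟨p', x.2⟩ ≤ wt ⟨p, x.1⟩})) ∪
        AddMonoidHom.fst _ _ ''
          (({x : (Fin (m p) → ℕ) × (Fin (m p) → ℕ) | same ⟨p, x.1⟩ ⟨p, x.2⟩} ∩
            {x | 0 + wt ⟨p, x.2⟩ ≤ wt ⟨p, x.1⟩}) ∩ {x | toLex x.2 < toLex x.1}) := by
      ext w
      simp only [Set.mem_ofPred_eq, Set.mem_union, Set.mem_iUnion, Set.mem_image,
        Set.mem_inter_iff, Prod.exists, AddMonoidHom.coe_fst, exists_prop, zero_add, better,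
        betterLex]
      constructor
      · rintro (⟨p', w', hs, h | h⟩ | ⟨w', h1, h2, h3⟩)
        · exact Or.inl (Or.inl ⟨p', hs.1, w, w', ⟨hs, h⟩, rfl⟩)
        · exact Or.inl (Or.inr ⟨p', ⟨hs.1, h.1⟩, w, w', ⟨hs, h.2⟩, rfl⟩)
        · exact Or.inr ⟨w, w', ⟨⟨h1, h2⟩, h3⟩, rfl⟩
      · rintro ((⟨p', -, v, w', ⟨hs, h⟩, rfl⟩ | ⟨p', hp, v, w', ⟨hs, h⟩, rfl⟩) |
          ⟨v, w', ⟨⟨h1, h2⟩, h3⟩, rfl⟩)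
        · exact Or.inl ⟨p', w', hs, Or.inl h⟩
        · exact Or.inl ⟨p', w', hs, Or.inr ⟨hp.2, h⟩⟩
        · exact Or.inr ⟨w', h1, h2, h3⟩
    rw [h1]
    refine .union (.union (.biUnion (Set.toFinite _) fun p' hp' => ?_)
      (.biUnion (Set.toFinite _) fun p' hp' => ?_)) ?_
    · exact ((hsame p' hp').inter (hle 1 p')).image _
    · exact ((hsame p' hp'.1).inter (hle 0 p')).image _
    · exact (((hsame p rfl).inter (hle 0 p)).inter (isSemilinearSet_lex _)).image _
  · intro p₀ w₀
    obtain ⟨x₁, hx₁, hmin₁⟩ := (measure wt).wf.has_min {x | same x ⟨p₀, w₀⟩}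
      ⟨⟨p₀, w₀⟩, rfl, by simp⟩
    obtain ⟨x₂, hx₂, hmin₂⟩ := (measure fun x : Σ p, Fin (m p) → ℕ => (x.1 : ℕ)).wf.has_min
      {x | same x ⟨p₀, w₀⟩ ∧ wt x = wt x₁} ⟨x₁, hx₁, rfl⟩
    obtain ⟨p, w₂⟩ := x₂
    obtain ⟨w, hw, hmin₃⟩ := (wellFounded_lt (α := Lex (Fin (m p) → ℕ))).has_min
      {w | same ⟨p, ofLex w⟩ ⟨p₀, w₀⟩ ∧ wt ⟨p, ofLex w⟩ = wt x₁} ⟨toLex w₂, hx₂⟩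
    have hle₁ : ∀ x, same x ⟨p₀, w₀⟩ → wt x₁ ≤ wt x := fun x hx => not_lt.1 (hmin₁ x hx)
    refine ⟨p, ofLex w, ?_, hw.1.1, hw.1.2, ?_⟩
    · rintro (⟨p', w', hs, h | ⟨hp, h⟩⟩ | ⟨w', hs, h, hl⟩)
      · have := hle₁ _ (trans (symm hs) hw.1)
        have := hw.2
        omega
      · have h1 := trans (symm hs) hw.1
        have h2 := hle₁ _ h1
        have h3 := hw.2
        exact hmin₂ ⟨p', w'⟩ ⟨h1, by omega⟩ hp
      · have h1 := trans (symm hs) hw.1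
        have h2 := hle₁ _ h1
        have h3 := hw.2
        exact hmin₃ (toLex w') ⟨h1, by simp only [ofLex_toLex]; omega⟩ hl
    · have := hle₁ ⟨p₀, w₀⟩ ⟨rfl, by simp⟩
      exact hw.2.le.trans this
  · intro p w p' w' hw hw' hκ hd
    have hs : same ⟨p, w⟩ ⟨p', w'⟩ := ⟨hκ, hd⟩
    simp only [Set.mem_compl_iff, Set.mem_ofPred_eq, not_or] at hw hw'
    have h1 : wt ⟨p, w⟩ = wt ⟨p', w'⟩ := by
      have h2 : ¬ (1 + wt ⟨p', w'⟩ ≤ wt ⟨p, w⟩) := fun h => hw.1 ⟨p', w', hs, Or.inl h⟩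
      have h3 : ¬ (1 + wt ⟨p, w⟩ ≤ wt ⟨p', w'⟩) := fun h => hw'.1 ⟨p, w, symm hs, Or.inl h⟩
      omega
    have h2 : p = p' := by
      rcases lt_trichotomy p p' with h | h | h
      · exact (hw'.1 ⟨p, w, symm hs, Or.inr ⟨h, h1.le⟩⟩).elim
      · exact h
      · exact (hw.1 ⟨p', w', hs, Or.inr ⟨h, h1.ge⟩⟩).elim
    subst h2
    rcases lt_trichotomy (toLex w) (toLex w') with h | h | h
    · exact (hw'.2 ⟨w, symm hs, h1.le, h⟩).elim
    · rw [toLex_inj] at h; rw [h]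
    · exact (hw.2 ⟨w', hs, h1.ge, h⟩).elim

end Semilinear

end VirtAb

namespace VirtAb

namespace Description

variable {G : Type u} [Group G] (D : Description G)

/-! ### Coordinates on the abelian subgroup -/

theorem evalVec_mem (v : Fin D.n → ℤ) : evalVec D.basis v ∈ D.A := (D.basis _).2

theorem evalVec_zero : evalVec D.basis 0 = 1 := by simp [evalVec]

theorem evalVec_add (v w : Fin D.n → ℤ) :
    evalVec D.basis (v + w) = evalVec D.basis v * evalVec D.basis w := by simp [evalVec]

theorem evalVec_neg (v : Fin D.n → ℤ) : evalVec D.basis (-v) = (evalVec D.basis v)⁻¹ := by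
  simp [evalVec]

theorem evalVec_sub (v w : Fin D.n → ℤ) :
    evalVec D.basis (v - w) = evalVec D.basis v * (evalVec D.basis w)⁻¹ := by
  rw [sub_eq_add_neg, evalVec_add, evalVec_neg]

theorem evalVec_nsmul (k : ℕ) (v : Fin D.n → ℤ) :
    evalVec D.basis (k • v) = evalVec D.basis v ^ k := by
  rw [evalVec, ofAdd_nsmul, map_pow, Subgroup.coe_pow]
  rfl

theorem evalVec_injective : Function.Injective (evalVec D.basis) := by
  intro v w h
  simpa [evalVec] using h

theorem evalVec_list_sum (l : List (Fin D.n → ℤ)) :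
    evalVec D.basis l.sum = (l.map (evalVec D.basis)).prod := by
  induction l with
  | nil => exact D.evalVec_zero
  | cons v l ih => simp [evalVec_add, ih]

open Classical in
/-- The coordinate vector of an element of the abelian subgroup (and zero for other elements). -/
noncomputable def vec (a : G) : Fin D.n → ℤ :=
  if h : a ∈ D.A then Multiplicative.toAdd (D.basis.symm ⟨a, h⟩) else 0

theorem evalVec_vec {a : G} (h : a ∈ D.A) : evalVec D.basis (D.vec a) = a := by
  simp [evalVec, vec, h]

theorem mul_comm_of_mem {a b : G} (ha : a ∈ D.A) (hb : b ∈ D.A) : a * b = b * a := by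
  rw [← D.evalVec_vec ha, ← D.evalVec_vec hb, ← evalVec_add, add_comm, evalVec_add]

theorem conj_mem {a : G} (ha : a ∈ D.A) (g : G) : g * a * g⁻¹ ∈ D.A :=
  D.normal.conj_mem a ha g

theorem evalNormalForm_injective : Function.Injective (evalNormalForm D.basis D.t) := by
  rintro ⟨v, i⟩ ⟨w, j⟩ h
  simp only [evalNormalForm] at h
  have hij : i = j := by
    refine (D.transversal (D.t i)).unique ?_ ?_
    · rw [mul_inv_cancel]; exact one_mem _
    · have : D.t i * (D.t j)⁻¹ = (evalVec D.basis v)⁻¹ * evalVec D.basis w := by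
        rw [eq_inv_mul_iff_mul_eq, ← mul_assoc, h, mul_inv_cancel_right]
      rw [this]
      exact D.A.mul_mem (D.A.inv_mem (D.evalVec_mem v)) (D.evalVec_mem w)
  subst hij
  rw [D.evalVec_injective (mul_right_cancel h)]

theorem index_eq : D.A.index = D.d := by
  have := D.normal
  rw [Subgroup.index, ← Nat.card_fin D.d]
  refine (Nat.card_congr (Equiv.ofBijective (fun j => (D.t j : G ⧸ D.A)) ⟨?_, ?_⟩)).symm
  · intro i j h
    have h1 : (D.t i : G ⧸ D.A) * (D.t j : G ⧸ D.A)⁻¹ = 1 := by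
      rw [mul_inv_eq_one]; exact h
    refine (D.transversal (D.t i)).unique ?_ ?_
    · simp only [mul_inv_cancel]; exact one_mem _
    · exact (QuotientGroup.eq_one_iff _).1 h1
  · intro q
    obtain ⟨g, rfl⟩ := QuotientGroup.mk_surjective q
    obtain ⟨j, hj, -⟩ := D.transversal g
    refine ⟨j, ?_⟩
    have h1 : (g : G ⧸ D.A) * (D.t j : G ⧸ D.A)⁻¹ = 1 := (QuotientGroup.eq_one_iff _).2 hj
    exact (mul_inv_eq_one.1 h1).symm

/-! ### Weights -/

theorem evalGens_append (l l' : List (Fin D.m)) :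
    D.evalGens (l ++ l') = D.evalGens l * D.evalGens l' := by simp [evalGens]

theorem exists_evalGens (g : G) : ∃ l, D.evalGens l = g := by
  have h : g ∈ Submonoid.closure (Set.range D.gen) := by
    have := D.generates
    change Submonoid.closure (Set.range D.gen) = ⊤ at this
    rw [this]; trivial
  induction h using Submonoid.closure_induction with
  | mem x hx =>
    obtain ⟨i, rfl⟩ := hx
    exact ⟨[i], by simp [evalGens]⟩
  | one => exact ⟨[], rfl⟩
  | mul x y _ _ hx hy =>
    obtain ⟨l, rfl⟩ := hx
    obtain ⟨l', rfl⟩ := hy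
    exact ⟨l ++ l', D.evalGens_append l l'⟩

theorem omega_evalGens_le (l : List (Fin D.m)) :
    D.omega (D.evalGens l) ≤ (l.map D.weight).sum := Nat.sInf_le ⟨l, rfl, rfl⟩

theorem exists_weight_eq_omega (g : G) :
    ∃ l, D.evalGens l = g ∧ (l.map D.weight).sum = D.omega g := by
  obtain ⟨l, hl⟩ := D.exists_evalGens g
  exact Nat.sInf_mem (s := {c | ∃ l : List (Fin D.m), D.evalGens l = g ∧
    (l.map D.weight).sum = c}) ⟨_, l, hl, rfl⟩

theorem omega_one : D.omega 1 = 0 :=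
  Nat.le_zero.1 (D.omega_evalGens_le [])

theorem omega_mul_le (g h : G) : D.omega (g * h) ≤ D.omega g + D.omega h := by
  obtain ⟨l, rfl, hl⟩ := D.exists_weight_eq_omega g
  obtain ⟨l', rfl, hl'⟩ := D.exists_weight_eq_omega h
  rw [← hl, ← hl', ← evalGens_append]
  refine (D.omega_evalGens_le _).trans_eq ?_
  simp

theorem omega_prod_le (w : List G) : D.omega w.prod ≤ D.wordWeight w := by
  induction w with
  | nil => simp [omega_one]
  | cons g w ih =>
    rw [List.prod_cons]
    refine (D.omega_mul_le _ _).trans ?_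
    simpa [wordWeight] using ih

theorem wordWeight_append (w w' : List G) :
    D.wordWeight (w ++ w') = D.wordWeight w + D.wordWeight w' := by simp [wordWeight]

theorem wordWeight_cons (g : G) (w : List G) :
    D.wordWeight (g :: w) = D.omega g + D.wordWeight w := by simp [wordWeight]

/-! ### Products and weights of patterned words -/

theorem prod_conj_block (h : G) (u : Fin D.r → ℕ) :
    h * (D.block u).prod =
      evalVec D.basis (∑ i, u i • D.vec (h * D.x i * h⁻¹)) * h := by
  have h1 : (D.block u).prod = ((List.finRange D.r).map fun i => D.x i ^ u i).prod := by
    simp only [block, List.flatMap, List.prod_flatten, List.map_map]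
    congr 1
    refine List.map_congr_left fun i _ => ?_
    simp
  have h2 : ∑ i, u i • D.vec (h * D.x i * h⁻¹) =
      ((List.finRange D.r).map fun i => u i • D.vec (h * D.x i * h⁻¹)).sum := by
    rw [← List.ofFn_eq_map, List.sum_ofFn]
  rw [h1, h2, evalVec_list_sum, List.map_map]
  have h3 : ∀ l : List (Fin D.r), h * (l.map fun i => D.x i ^ u i).prod =
      (l.map (evalVec D.basis ∘ fun i => u i • D.vec (h * D.x i * h⁻¹))).prod * h := by
    intro l
    induction l with
    | nil => simp
    | cons i l ih =>
      simp only [List.map_cons, List.prod_cons, Function.comp_apply, evalVec_nsmul,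
        D.evalVec_vec (D.conj_mem (D.x_mem i) h), conj_pow] at ih ⊢
      rw [mul_assoc, ← ih]
      group
  exact h3 _

theorem wordWeight_block (u : Fin D.r → ℕ) :
    D.wordWeight (D.block u) = ∑ i, u i * D.omega (D.x i) := by
  simp only [wordWeight, block, List.flatMap, List.map_flatten, List.sum_flatten, List.map_map]
  rw [← List.sum_ofFn, List.ofFn_eq_map]
  congr 1
  refine List.map_congr_left fun i _ => ?_
  simp

/-- The product of the first `j` letters of a pattern. -/
noncomputable def patternPrefix (p : List (Fin D.s)) (j : ℕ) : G := ((p.take j).map D.y).prod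

theorem mul_prod_interleave (h : G) (p : List (Fin D.s)) (v : Fin (p.length + 1) → Fin D.r → ℕ) :
    h * (D.interleave p v).prod = evalVec D.basis (∑ j, ∑ i, v j i •
      D.vec (h * D.patternPrefix p j * D.x i * (h * D.patternPrefix p j)⁻¹)) *
        (h * (p.map D.y).prod) := by
  induction p generalizing h with
  | nil => simp [interleave, patternPrefix, prod_conj_block]
  | cons k p ih =>
    simp only [interleave, List.prod_append, List.prod_cons]
    rw [← mul_assoc, prod_conj_block, mul_assoc, ← mul_assoc h, ih,
      Fin.sum_univ_succ (n := (k :: p).length), evalVec_add]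
    simp [patternPrefix, mul_assoc]

theorem prod_interleave (p : List (Fin D.s)) (v : Fin (p.length + 1) → Fin D.r → ℕ) :
    (D.interleave p v).prod = evalVec D.basis (∑ j, ∑ i, v j i •
      D.vec (D.patternPrefix p j * D.x i * (D.patternPrefix p j)⁻¹)) * (p.map D.y).prod := by
  simpa using D.mul_prod_interleave 1 p v

theorem wordWeight_interleave (p : List (Fin D.s)) (v : Fin (p.length + 1) → Fin D.r → ℕ) :
    D.wordWeight (D.interleave p v) = (∑ j, ∑ i, v j i * D.omega (D.x i)) +
      (p.map fun i => D.omega (D.y i)).sum := by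
  induction p with
  | nil => simp [interleave, wordWeight_block]
  | cons k p ih =>
    simp only [interleave, wordWeight_append, wordWeight_cons, wordWeight_block, ih]
    rw [Fin.sum_univ_succ (n := (k :: p).length)]
    simp only [List.map_cons, List.sum_cons]
    have e : ∀ a b c d : ℕ, a + (b + (c + d)) = a + c + (b + d) := fun a b c d => by omega
    exact e _ _ _ _

/-! ### Every element has a geodesic patterned word -/

theorem exists_interleave_eq (p : List (Fin D.s)) (v : Fin (p.length + 1) → Fin D.r → ℕ) :
    ∃ rest, ∀ u, D.interleave p (Fin.cons u fun j => v j.succ) = D.block u ++ rest := by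
  cases p with
  | nil => exact ⟨[], fun u => by simp [interleave]⟩
  | cons k p => exact ⟨D.y k :: D.interleave p fun j => v j.succ, fun u => by
      simp only [interleave]; rfl⟩

open Classical in
theorem exists_interleave_of_list (L : List G) (hL : ∀ g ∈ L, g ∈ D.extendedGenerators) :
    ∃ (p : List (Fin D.s)) (v : Fin (p.length + 1) → Fin D.r → ℕ),
      p.length = (L.filter fun g => g ∉ D.A).length ∧
      (D.interleave p v).prod = L.prod ∧ D.wordWeight (D.interleave p v) = D.wordWeight L := by
  induction L with
  | nil =>
    refine ⟨[], fun _ _ => 0, by simp, ?_, ?_⟩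
    · simp [prod_interleave, evalVec_zero]
    · rw [wordWeight_interleave]; simp [wordWeight]
  | cons g L ih =>
    obtain ⟨p, v, hp, h1, h2⟩ := ih fun g hg => hL g (List.mem_cons_of_mem _ hg)
    have hg := hL g (by simp)
    by_cases hgA : g ∈ D.A
    · obtain ⟨i, rfl⟩ : g ∈ Set.range D.x := by rw [D.range_x]; exact ⟨hg, hgA⟩
      obtain ⟨rest, hr⟩ := D.exists_interleave_eq p v
      have hv : v = Fin.cons (v 0) fun j => v j.succ := (Fin.cons_self_tail v).symm
      rw [hv, hr] at h1 h2
      refine ⟨p, Fin.cons (v 0 + Pi.single i 1) fun j => v j.succ, by simp [hp, hgA], ?_, ?_⟩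
      · have e1 := D.prod_conj_block 1 (v 0)
        have e2 := D.prod_conj_block 1 (v 0 + Pi.single i 1)
        simp only [one_mul, inv_one, mul_one] at e1 e2
        rw [hr, List.prod_append, List.prod_cons, ← h1, List.prod_append, e1, e2, ← mul_assoc]
        congr 1
        simp only [Pi.add_apply, add_smul, Finset.sum_add_distrib, evalVec_add]
        have e3 : ∑ k, (Pi.single i 1 : Fin D.r → ℕ) k • D.vec (D.x k) = D.vec (D.x i) := by
          rw [Finset.sum_eq_single i] <;> simp +contextual
        rw [e3, D.evalVec_vec (D.x_mem i)]
        exact D.mul_comm_of_mem (D.evalVec_mem _) (D.x_mem i)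
      · rw [hr, wordWeight_cons, ← h2, wordWeight_append, wordWeight_append, wordWeight_block,
          wordWeight_block]
        simp only [Pi.add_apply, add_mul, Finset.sum_add_distrib]
        have e3 : ∑ k, (Pi.single i 1 : Fin D.r → ℕ) k * D.omega (D.x k) = D.omega (D.x i) := by
          rw [Finset.sum_eq_single i] <;> simp +contextual
        rw [e3]
        ring
    · obtain ⟨k, rfl⟩ : g ∈ Set.range D.y := by rw [D.range_y]; exact ⟨hg, hgA⟩
      refine ⟨k :: p, Fin.cons 0 v, by simp [hp, hgA], ?_, ?_⟩
      · have hb : D.block 0 = [] := by simp [block]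
        have e : D.interleave (k :: p) (Fin.cons 0 v) = D.block 0 ++ D.y k :: D.interleave p v := by
          simp only [interleave]; rfl
        rw [e, hb, List.nil_append, List.prod_cons, h1, List.prod_cons]
      · have hb : D.block 0 = [] := by simp [block]
        have e : D.interleave (k :: p) (Fin.cons 0 v) = D.block 0 ++ D.y k :: D.interleave p v := by
          simp only [interleave]; rfl
        rw [e, hb, List.nil_append, wordWeight_cons, wordWeight_cons, h2]

/-- The classes modulo `A` of the elements `u · g`, where `u` runs through the suffixes of a word. -/
def suffixClasses (r : List (Fin D.m)) (g : G) : List (G ⧸ D.A) :=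
  r.tails.map fun t => ((D.evalGens t * g : G) : G ⧸ D.A)

open Classical in
theorem exists_reduced_decomposition (l : List (Fin D.m)) :
    ∃ (r : List (Fin D.m)) (W : List G) (T : Finset (G ⧸ D.A)),
      D.evalGens r * W.prod = D.evalGens l ∧
      (r.map D.weight).sum + D.wordWeight W ≤ (l.map D.weight).sum ∧
      (∀ g ∈ W, g ∈ D.extendedGenerators) ∧
      (∀ q ∈ T, ∃ W₁ W₂, W = W₁ ++ W₂ ∧ ((W₂.prod : G) : G ⧸ D.A) = q) ∧
      (W.filter fun g => g ∉ D.A).length + 1 ≤ T.card ∧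
      (D.suffixClasses r W.prod).Nodup ∧ ∀ q ∈ D.suffixClasses r W.prod, q ∈ T := by
  have hnormal := D.normal
  have hfi := D.finiteIndex
  have hfin : Finite (G ⧸ D.A) := inferInstance
  have hfin' := Fintype.ofFinite (G ⧸ D.A)
  have hcard : ∀ T : Finset (G ⧸ D.A), T.card ≤ D.A.index := fun T => by
    rw [Subgroup.index, Nat.card_eq_fintype_card]; exact T.card_le_univ
  induction l with
  | nil =>
    refine ⟨[], [], {1}, by simp, by simp [wordWeight], by simp, ?_, by simp, ?_, ?_⟩
    · intro q hq
      exact ⟨[], [], rfl, by simpa [eq_comm] using hq⟩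
    · simp [suffixClasses]
    · simp [suffixClasses, evalGens]
  | cons i l ih =>
    obtain ⟨r, W, T, hprod, hwt, hW, hT, hY, hnd, hr⟩ := ih
    have hlen : r.length + 1 ≤ T.card := by
      have h1 : (D.suffixClasses r W.prod).toFinset ⊆ T := fun q hq =>
        hr q (List.mem_toFinset.1 hq)
      have h2 := Finset.card_le_card h1
      rwa [List.toFinset_card_of_nodup hnd, suffixClasses, List.length_map,
        List.length_tails] at h2
    have hcons : ∀ r, D.evalGens (i :: r) = D.gen i * D.evalGens r := fun r => by simp [evalGens]
    have hprod' : D.evalGens (i :: r) * W.prod = D.evalGens (i :: l) := by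
      rw [hcons, hcons, mul_assoc, hprod]
    have hmem : ∀ w : List (Fin D.m), w.length ≤ r.length → D.evalGens (i :: w) ∈
        D.extendedGenerators := fun w hw => ⟨i :: w, by simp, by
      have := hcard T
      simp only [List.length_cons]
      omega, rfl⟩
    set q : G ⧸ D.A := ((D.evalGens (i :: r) * W.prod : G) : G ⧸ D.A) with hq
    by_cases hqT : q ∈ T
    · by_cases hqr : q ∈ D.suffixClasses r W.prod
      · obtain ⟨t, ht, htq⟩ := List.mem_map.1 hqr
        obtain ⟨w, rfl⟩ := (List.mem_tails _ _).1 ht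
        obtain ⟨W₁, W₂, hsplit, hW₂⟩ := hT q hqT
        have hx : D.evalGens (i :: w) ∈ D.A := by
          rw [← QuotientGroup.eq_one_iff]
          have h1 : ((D.evalGens (i :: w) : G) : G ⧸ D.A) * ((D.evalGens t * W.prod : G) : G ⧸ D.A)
              = ((D.evalGens t * W.prod : G) : G ⧸ D.A) := by
            rw [← QuotientGroup.mk_mul, ← mul_assoc, ← evalGens_append]
            exact htq.symm
          exact mul_eq_right.1 h1
        have hc : D.evalGens t * W₁.prod ∈ D.A := by
          rw [← QuotientGroup.eq_one_iff]
          have h1 : ((D.evalGens t * W₁.prod : G) : G ⧸ D.A) * ((W₂.prod : G) : G ⧸ D.A)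
              = ((W₂.prod : G) : G ⧸ D.A) := by
            rw [← QuotientGroup.mk_mul, mul_assoc, ← List.prod_append, ← hsplit]
            exact htq.trans hW₂.symm
          exact mul_eq_right.1 h1
        have hx1 : ((D.evalGens (i :: w) : G) : G ⧸ D.A) = 1 := (QuotientGroup.eq_one_iff _).2 hx
        have hclass : (((W₁ ++ D.evalGens (i :: w) :: W₂).prod : G) : G ⧸ D.A) =
            ((W.prod : G) : G ⧸ D.A) := by
          rw [hsplit, List.prod_append, List.prod_cons, List.prod_append, QuotientGroup.mk_mul,
            QuotientGroup.mk_mul, hx1, one_mul, QuotientGroup.mk_mul]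
        have hsuf : D.suffixClasses t (W₁ ++ D.evalGens (i :: w) :: W₂).prod =
            D.suffixClasses t W.prod := by
          refine List.map_congr_left fun u _ => ?_
          rw [QuotientGroup.mk_mul, hclass, ← QuotientGroup.mk_mul]
        have hsub : (D.suffixClasses t W.prod).Sublist (D.suffixClasses (w ++ t) W.prod) := by
          refine List.Sublist.map _ ?_
          clear * -
          induction w with
          | nil => exact List.Sublist.refl _
          | cons a w ih => simp only [List.cons_append, List.tails_cons]; exact ih.cons _
        refine ⟨t, W₁ ++ D.evalGens (i :: w) :: W₂, T, ?_, ?_, ?_, ?_, ?_, ?_, ?_⟩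
        · rw [← hprod', List.prod_append, List.prod_cons, ← mul_assoc, ← mul_assoc,
            D.mul_comm_of_mem hc hx, hsplit, List.prod_append, ← List.cons_append,
            evalGens_append]
          simp only [mul_assoc]
        · have h1 := D.omega_evalGens_le (i :: w)
          rw [hsplit, wordWeight_append] at hwt
          rw [wordWeight_append, wordWeight_cons]
          simp only [List.map_append, List.sum_append, List.map_cons, List.sum_cons] at *
          omega
        · intro g hg
          simp only [List.mem_append, List.mem_cons] at hg
          rcases hg with hg | rfl | hg
          · exact hW g (by simp [hsplit, hg])
          · exact hmem w (by simp)
          · exact hW g (by simp [hsplit, hg])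
        · intro q' hq'
          obtain ⟨V₁, V₂, hV, hVq⟩ := hT q' hq'
          rw [hsplit] at hV
          rcases List.append_eq_append_iff.1 hV with ⟨c, hc1, hc2⟩ | ⟨c, hc1, hc2⟩
          · exact ⟨W₁ ++ D.evalGens (i :: w) :: c, V₂, by simp [hc2], hVq⟩
          · refine ⟨V₁, c ++ D.evalGens (i :: w) :: W₂, by simp [hc1], ?_⟩
            rw [← hVq, hc2, List.prod_append, List.prod_cons, QuotientGroup.mk_mul,
              QuotientGroup.mk_mul, hx1, one_mul, List.prod_append, QuotientGroup.mk_mul]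
        · refine le_trans (le_of_eq ?_) hY
          rw [hsplit]
          simp [hx]
        · rw [hsuf]; exact hnd.sublist hsub
        · rw [hsuf]; exact fun q hq => hr q (hsub.subset hq)
      · refine ⟨i :: r, W, T, hprod', ?_, hW, hT, hY, ?_, ?_⟩
        · simp only [List.map_cons, List.sum_cons]; omega
        · have : D.suffixClasses (i :: r) W.prod = q :: D.suffixClasses r W.prod := by
            simp [suffixClasses, hq]
          rw [this]
          exact List.nodup_cons.2 ⟨hqr, hnd⟩
        · have : D.suffixClasses (i :: r) W.prod = q :: D.suffixClasses r W.prod := by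
            simp [suffixClasses, hq]
          rw [this]
          intro q' hq'
          rcases List.mem_cons.1 hq' with rfl | hq'
          · exact hqT
          · exact hr q' hq'
    · refine ⟨[], D.evalGens (i :: r) :: W, insert q T, ?_, ?_, ?_, ?_, ?_, ?_, ?_⟩
      · rw [List.prod_cons, hprod']; simp [evalGens]
      · have h1 := D.omega_evalGens_le (i :: r)
        rw [wordWeight_cons]
        simp only [List.map_cons, List.sum_cons, List.map_nil, List.sum_nil] at *
        omega
      · intro g hg
        rcases List.mem_cons.1 hg with rfl | hg
        · exact hmem r le_rfl
        · exact hW g hg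
      · intro q' hq'
        rcases Finset.mem_insert.1 hq' with rfl | hq'
        · exact ⟨[], _, rfl, by rw [List.prod_cons]⟩
        · obtain ⟨W₁, W₂, rfl, h⟩ := hT q' hq'
          exact ⟨_ :: W₁, W₂, rfl, h⟩
      · rw [Finset.card_insert_of_notMem hqT]
        refine Nat.add_le_add_right (le_trans ?_ hY) 1
        rw [List.filter_cons]
        split_ifs <;> simp
      · simp [suffixClasses]
      · intro q' hq'
        have : q' = q := by simpa [suffixClasses, evalGens, hq] using hq'
        rw [this]; exact Finset.mem_insert_self _ _

theorem exists_geodesic_patternedWord (g : G) : ∃ (p : D.Pattern) (w : Fin (D.dim p) → ℕ),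
    (D.patternedWord p w).prod = g ∧ D.wordWeight (D.patternedWord p w) = D.omega g := by
  classical
  obtain ⟨l, rfl, hl⟩ := D.exists_weight_eq_omega g
  obtain ⟨r, W, T, hprod, hwt, hW, -, hY, hnd, hr⟩ := D.exists_reduced_decomposition l
  have hfi := D.finiteIndex
  have hfin : Finite (G ⧸ D.A) := inferInstance
  have hfin' := Fintype.ofFinite (G ⧸ D.A)
  have hcard : T.card ≤ D.A.index := by
    rw [Subgroup.index, Nat.card_eq_fintype_card]; exact T.card_le_univ
  have hlen : r.length + 1 ≤ T.card := by
    have h1 : (D.suffixClasses r W.prod).toFinset ⊆ T := fun q hq =>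
      hr q (List.mem_toFinset.1 hq)
    have h2 := Finset.card_le_card h1
    rwa [List.toFinset_card_of_nodup hnd, suffixClasses, List.length_map,
      List.length_tails] at h2
  obtain ⟨W', h1, h2, h3, h4⟩ : ∃ W' : List G, W'.prod = D.evalGens l ∧
      D.wordWeight W' ≤ (l.map D.weight).sum ∧ (∀ g ∈ W', g ∈ D.extendedGenerators) ∧
      (W'.filter fun g => g ∉ D.A).length ≤ D.A.index := by
    rcases r with _ | ⟨i, r⟩
    · refine ⟨W, by simpa [evalGens] using hprod, by simpa using hwt, hW, by omega⟩
    · refine ⟨D.evalGens (i :: r) :: W, by rw [List.prod_cons, hprod], ?_, ?_, ?_⟩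
      · have := D.omega_evalGens_le (i :: r)
        rw [wordWeight_cons]
        omega
      · intro g hg
        rcases List.mem_cons.1 hg with rfl | hg
        · exact ⟨i :: r, by simp, by omega, rfl⟩
        · exact hW g hg
      · rw [List.filter_cons]
        split_ifs
        · simp only [List.length_cons]; omega
        · omega
  obtain ⟨p, v, hp, h5, h6⟩ := D.exists_interleave_of_list W' h3
  have hp' : p.length ≤ D.A.index := hp.trans_le h4
  have hword : D.patternedWord ⟨p, hp'⟩ (fun q => v (finProdFinEquiv.symm q).1
      (finProdFinEquiv.symm q).2) = D.interleave p v := by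
    simp [patternedWord]
  refine ⟨⟨p, hp'⟩, fun q => v (finProdFinEquiv.symm q).1 (finProdFinEquiv.symm q).2, ?_, ?_⟩
  · rw [hword, h5, h1]
  · rw [hword, h6]
    refine le_antisymm (h2.trans_eq hl) ?_
    rw [← h1]
    exact D.omega_prod_le W'

end Description

end VirtAb

namespace VirtAb

/-! ### Computing in a group from its description -/

namespace Code

/-- The normal form of a product of two letters, according to the table. -/
def mulLetters (c : DescriptionCode) (a b : LetterCode) : NormalFormCode :=
  ((c.2.2.1.filter fun e => decide (e.1 = (a, b))).map fun e => e.2).getD 0 ([], 0)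

/-- The normal form of the product of a normal form and a letter. -/
def mulLetter (c : DescriptionCode) (x : NormalFormCode) (a : LetterCode) : NormalFormCode :=
  (addVec x.1 (mulLetters c (.inr x.2) a).1, (mulLetters c (.inr x.2) a).2)

/-- Equality of normal forms. -/
def eqNormalForm (c : DescriptionCode) (x y : NormalFormCode) : Bool :=
  eqVec c.1 x.1 y.1 && decide (x.2 = y.2)

/-- The number of the transversal element `1`: the only idempotent one. -/
def identIndex (c : DescriptionCode) : ℕ :=
  ((List.range c.2.1).filter fun j =>
    eqNormalForm c (mulLetters c (.inr j) (.inr j)) ([], j)).getD 0 0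

/-- The normal form of the element represented by a word in the generators. -/
def evalWord (c : DescriptionCode) (w : List ℕ) : NormalFormCode :=
  (w.flatMap fun i => (c.2.2.2.getD i ([], 0)).1).foldl (mulLetter c) ([], identIndex c)

/-- The weight of a word in the generators. -/
def wordWeight (c : DescriptionCode) (w : List ℕ) : ℕ :=
  (w.map fun i => (c.2.2.2.getD i ([], 0)).2).sum

/-- The words of length `k` in `m` letters, in lexicographic order. -/
def words (m k : ℕ) : List (List ℕ) :=
  Nat.rec (motive := fun _ => List (List ℕ)) [[]]
    (fun _ acc => (List.range m).flatMap fun i => acc.map fun w => i :: w) k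

/-- Words representing the elements of the extended generating set. -/
def listS (c : DescriptionCode) : List (List ℕ) :=
  ((List.range c.2.1).flatMap fun k => words c.2.2.2.length (k + 1)).foldr
    (fun w acc => bif acc.any fun w' => eqNormalForm c (evalWord c w) (evalWord c w')
      then acc else w :: acc) []

/-- Words representing the extended generators in the abelian subgroup. -/
def listX (c : DescriptionCode) : List (List ℕ) :=
  (listS c).filter fun w => decide ((evalWord c w).2 = identIndex c)

/-- Words representing the extended generators outside the abelian subgroup. -/
def listY (c : DescriptionCode) : List (List ℕ) :=
  (listS c).filter fun w => !decide ((evalWord c w).2 = identIndex c)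

/-- The weight of the element represented by a word. -/
def omega (c : DescriptionCode) (w : List ℕ) : ℕ :=
  ((List.range (wordWeight c w + 1)).flatMap fun k => words c.2.2.2.length k).foldr
    (fun u acc => bif eqNormalForm c (evalWord c u) (evalWord c w)
      then min (wordWeight c u) acc else acc) (wordWeight c w)

/-- A word representing the product of the first `j` letters of a pattern. -/
def patternPrefix (c : DescriptionCode) (p : List ℕ) (j : ℕ) : List ℕ :=
  (p.take j).flatMap fun i => (listY c).getD i []

/-- The weight of `x_i`, followed by the coordinates of its conjugate by the product of the first `j`
letters of a pattern. -/
def column (c : DescriptionCode) (p : List ℕ) (j i : ℕ) : List ℤ :=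
  (omega c ((listX c).getD i []) : ℤ) ::
    addVec (evalWord c (patternPrefix c p j ++ (listX c).getD i [])).1
      (smulVec (-1) (evalWord c (patternPrefix c p j)).1)

/-- The number of coordinates for a pattern. -/
def dim (c : DescriptionCode) (p : List ℕ) : ℕ := (p.length + 1) * (listX c).length

/-- The list of all columns for a pattern. -/
def columns (c : DescriptionCode) (p : List ℕ) : List (List ℤ) :=
  (List.range (dim c p)).map fun q =>
    column c p (q / (listX c).length) (q % (listX c).length)

/-- The weight of a pattern, followed by the exponents in the normal form of its product. -/
def base (c : DescriptionCode) (p : List ℕ) : List ℤ :=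
  (((p.map fun i => omega c ((listY c).getD i [])).sum : ℕ) : ℤ) ::
    (evalWord c (patternPrefix c p p.length)).1

/-- The number of the transversal element in the normal form of the product of a pattern. -/
def color (c : DescriptionCode) (p : List ℕ) : ℕ :=
  (evalWord c (patternPrefix c p p.length)).2

/-- The list of all patterns. -/
def patterns (c : DescriptionCode) : List (List ℕ) :=
  (List.range (c.2.1 + 1)).flatMap fun k => words (listY c).length k

section Primrec

variable {α : Type*} [Primcodable α] {f : α → DescriptionCode}

@[fun_prop]
theorem primrec_mulLetters {a b : α → LetterCode} (hf : Primrec f) (ha : Primrec a)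
    (hb : Primrec b) : Primrec fun x => mulLetters (f x) (a x) (b x) := by
  unfold mulLetters; fun_prop

@[fun_prop]
theorem primrec_mulLetter {a : α → NormalFormCode} {b : α → LetterCode} (hf : Primrec f)
    (ha : Primrec a) (hb : Primrec b) : Primrec fun x => mulLetter (f x) (a x) (b x) := by
  unfold mulLetter; fun_prop

@[fun_prop]
theorem primrec_eqNormalForm {a b : α → NormalFormCode} (hf : Primrec f) (ha : Primrec a)
    (hb : Primrec b) : Primrec fun x => eqNormalForm (f x) (a x) (b x) := by
  unfold eqNormalForm; fun_prop

@[fun_prop]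
theorem primrec_identIndex (hf : Primrec f) : Primrec fun x => identIndex (f x) := by
  unfold identIndex; fun_prop

@[fun_prop]
theorem primrec_evalWord {w : α → List ℕ} (hf : Primrec f) (hw : Primrec w) :
    Primrec fun x => evalWord (f x) (w x) := by
  unfold evalWord; fun_prop

@[fun_prop]
theorem primrec_wordWeight {w : α → List ℕ} (hf : Primrec f) (hw : Primrec w) :
    Primrec fun x => wordWeight (f x) (w x) := by
  unfold wordWeight; fun_prop

@[fun_prop]
theorem primrec_words {m k : α → ℕ} (hm : Primrec m) (hk : Primrec k) :
    Primrec fun x => words (m x) (k x) := by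
  unfold words; fun_prop

@[fun_prop]
theorem primrec_listS (hf : Primrec f) : Primrec fun x => listS (f x) := by
  unfold listS; fun_prop

@[fun_prop]
theorem primrec_listX (hf : Primrec f) : Primrec fun x => listX (f x) := by
  unfold listX; fun_prop

@[fun_prop]
theorem primrec_listY (hf : Primrec f) : Primrec fun x => listY (f x) := by
  unfold listY; fun_prop

@[fun_prop]
theorem primrec_omega {w : α → List ℕ} (hf : Primrec f) (hw : Primrec w) :
    Primrec fun x => omega (f x) (w x) := by
  unfold omega; fun_prop

@[fun_prop]
theorem primrec_patternPrefix {p : α → List ℕ} {j : α → ℕ} (hf : Primrec f) (hp : Primrec p)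
    (hj : Primrec j) : Primrec fun x => patternPrefix (f x) (p x) (j x) := by
  unfold patternPrefix; fun_prop

@[fun_prop]
theorem primrec_column {p : α → List ℕ} {j i : α → ℕ} (hf : Primrec f) (hp : Primrec p)
    (hj : Primrec j) (hi : Primrec i) : Primrec fun x => column (f x) (p x) (j x) (i x) := by
  unfold column; fun_prop

@[fun_prop]
theorem primrec_dim {p : α → List ℕ} (hf : Primrec f) (hp : Primrec p) :
    Primrec fun x => dim (f x) (p x) := by
  unfold dim; fun_prop

@[fun_prop]
theorem primrec_columns {p : α → List ℕ} (hf : Primrec f) (hp : Primrec p) :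
    Primrec fun x => columns (f x) (p x) := by
  unfold columns; fun_prop

@[fun_prop]
theorem primrec_base {p : α → List ℕ} (hf : Primrec f) (hp : Primrec p) :
    Primrec fun x => base (f x) (p x) := by
  unfold base; fun_prop

@[fun_prop]
theorem primrec_color {p : α → List ℕ} (hf : Primrec f) (hp : Primrec p) :
    Primrec fun x => color (f x) (p x) := by
  unfold color; fun_prop

@[fun_prop]
theorem primrec_patterns (hf : Primrec f) : Primrec fun x => patterns (f x) := by
  unfold patterns; fun_prop

end Primrec

end Code

theorem Letter.code_injective {n d : ℕ} : Function.Injective (Letter.code (n := n) (d := d)) := by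
  rintro (⟨i, s⟩ | j) (⟨i', s'⟩ | j') h <;>
    simp only [Letter.code, Sum.inl.injEq, Sum.inr.injEq, Prod.mk.injEq, reduceCtorEq,
      Fin.val_inj] at h ⊢
  · exact h
  · exact h

theorem getD_filter_map_of_injective {β κ ν : Type*} [DecidableEq κ] {K : β → κ}
    (hK : Function.Injective K) (V : β → ν) {l : List β} {b : β} (hb : b ∈ l) (d : ν) :
    (((l.map fun b => (K b, V b)).filter fun e => decide (e.1 = K b)).map fun e => e.2).getD 0 d =
      V b := by
  induction l with
  | nil => simp at hb
  | cons a l ih =>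
    by_cases h : K a = K b
    · rw [hK h]; simp
    · have : b ∈ l := (List.mem_cons.1 hb).resolve_left fun e => h (by rw [e])
      rw [List.map_cons, List.filter_cons_of_neg (by simpa using h), ih this]

namespace Description

variable {G : Type u} [Group G] (D : Description G)

theorem code_mulLetters (a b : Letter D.n D.d) :
    Code.mulLetters D.code a.code b.code = (D.f a b).code := by
  have h := getD_filter_map_of_injective
    (K := fun p : Letter D.n D.d × Letter D.n D.d => (Letter.code p.1, Letter.code p.2))
    (fun p q h => Prod.ext (Letter.code_injective (Prod.mk.inj h).1)
      (Letter.code_injective (Prod.mk.inj h).2))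
    (fun p => NormalForm.code (D.f p.1 p.2))
    (List.pair_mem_product.2 ⟨mem_allLetters a, mem_allLetters b⟩) ([], 0)
  exact h

/-- The normal form with the given code represents the given element. -/
def Represents (x : NormalFormCode) (g : G) : Prop :=
  ∃ j : Fin D.d, x.2 = j ∧ evalVec D.basis (vecOfList D.n x.1) * D.t j = g

variable {D}

theorem Represents.mulLetter {x : NormalFormCode} {g : G} (h : D.Represents x g)
    (a : Letter D.n D.d) :
    D.Represents (Code.mulLetter D.code x a.code) (g * evalLetter D.basis D.t a) := by
  obtain ⟨j, hj, rfl⟩ := h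
  have h1 : (Sum.inr x.2 : LetterCode) = Letter.code (.inr j : Letter D.n D.d) := by
    rw [hj]; rfl
  have h2 := D.f_spec (.inr j) a
  refine ⟨(D.f (.inr j) a).2, ?_, ?_⟩
  · rw [Code.mulLetter, h1, code_mulLetters]; rfl
  · rw [Code.mulLetter, h1, code_mulLetters, vecOfList_addVec, evalVec_add, mul_assoc, mul_assoc]
    congr 1
    simp only [NormalForm.code, vecOfList_ofFn]
    exact h2

theorem Represents.foldl {x : NormalFormCode} {g : G} (h : D.Represents x g)
    (l : List (Letter D.n D.d)) :
    D.Represents ((l.map Letter.code).foldl (Code.mulLetter D.code) x)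
      (g * (l.map (evalLetter D.basis D.t)).prod) := by
  induction l generalizing x g with
  | nil => simpa using h
  | cons a l ih =>
    simp only [List.map_cons, List.foldl_cons, List.prod_cons, ← mul_assoc]
    exact ih (h.mulLetter a)

theorem Represents.eqNormalForm_iff {x y : NormalFormCode} {g h : G} (hx : D.Represents x g)
    (hy : D.Represents y h) : Code.eqNormalForm D.code x y = true ↔ g = h := by
  obtain ⟨i, hi, rfl⟩ := hx
  obtain ⟨j, hj, rfl⟩ := hy
  simp only [Code.eqNormalForm, Bool.and_eq_true, eqVec_iff, decide_eq_true_eq]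
  constructor
  · rintro ⟨h1, h2⟩
    have : i = j := Fin.ext (by rw [← hi, ← hj, h2])
    change vecOfList D.n x.1 = vecOfList D.n y.1 at h1
    rw [h1, this]
  · intro h
    have := D.evalNormalForm_injective (a₁ := (vecOfList D.n x.1, i))
      (a₂ := (vecOfList D.n y.1, j)) h
    rw [Prod.mk.injEq] at this
    exact ⟨this.1, by rw [hi, hj, this.2]⟩

variable (D)

theorem represents_identIndex : D.Represents ([], Code.identIndex D.code) 1 := by
  have key : ∀ j : Fin D.d, Code.eqNormalForm D.code (Code.mulLetters D.code (.inr (j : ℕ))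
      (.inr (j : ℕ))) ([], (j : ℕ)) = true ↔ D.t j = 1 := by
    intro j
    have h1 : D.Represents (Code.mulLetters D.code (.inr (j : ℕ)) (.inr (j : ℕ)))
        (D.t j * D.t j) := by
      rw [show (Sum.inr (j : ℕ) : LetterCode) = Letter.code (.inr j : Letter D.n D.d) from rfl,
        code_mulLetters]
      refine ⟨_, rfl, ?_⟩
      rw [NormalForm.code, vecOfList_ofFn]
      exact D.f_spec _ _
    have h2 : D.Represents ([], (j : ℕ)) (D.t j) := ⟨j, rfl, by simp [evalVec_zero]⟩
    rw [h1.eqNormalForm_iff h2, mul_eq_left]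
  obtain ⟨j₀, hj₀⟩ := D.one_mem_transversal
  set l := (List.range D.d).filter fun j =>
    Code.eqNormalForm D.code (Code.mulLetters D.code (.inr j) (.inr j)) ([], j) with hl
  have hne : l ≠ [] := by
    intro h0
    have : (j₀ : ℕ) ∈ l := List.mem_filter.2 ⟨List.mem_range.2 j₀.2, (key j₀).2 hj₀⟩
    rw [h0] at this
    simp at this
  have hmem : Code.identIndex D.code ∈ l := by
    change l.getD 0 0 ∈ l
    rw [List.getD_eq_getElem _ _ (List.length_pos_iff.2 hne)]
    exact List.getElem_mem _
  obtain ⟨h1, h2⟩ := List.mem_filter.1 hmem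
  refine ⟨⟨_, List.mem_range.1 h1⟩, rfl, ?_⟩
  rw [vecOfList_nil, evalVec_zero, one_mul]
  exact (key ⟨_, List.mem_range.1 h1⟩).1 h2

theorem code_gens_length : D.code.2.2.2.length = D.m := by simp [code]

theorem code_gens_getD (i : Fin D.m) : D.code.2.2.2.getD i ([], 0) =
    ((D.gens i).map Letter.code, D.weight i) := by
  simp [code, List.getD]

theorem represents_evalWord (w : List (Fin D.m)) :
    D.Represents (Code.evalWord D.code (w.map Fin.val)) (D.evalGens w) := by
  have h1 : ((w.map Fin.val).flatMap fun i => (D.code.2.2.2.getD i ([], 0)).1) =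
      (w.flatMap D.gens).map Letter.code := by
    induction w with
    | nil => rfl
    | cons i w ih =>
      simp only [List.map_cons, List.flatMap_cons, ih, code_gens_getD, List.map_append]
  have h2 : D.evalGens w = 1 * ((w.flatMap D.gens).map (evalLetter D.basis D.t)).prod := by
    clear h1
    rw [one_mul]
    induction w with
    | nil => rfl
    | cons i w ih =>
      rw [List.flatMap_cons, List.map_append, List.prod_append, ← ih]
      simp [evalGens, gen]
  rw [Code.evalWord, h1, h2]
  exact D.represents_identIndex.foldl _

theorem code_wordWeight (w : List (Fin D.m)) :
    Code.wordWeight D.code (w.map Fin.val) = (w.map D.weight).sum := by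
  rw [Code.wordWeight, List.map_map]
  congr 1
  refine List.map_congr_left fun i _ => ?_
  simp only [Function.comp_apply, code_gens_getD]

theorem code_words (m k : ℕ) :
    Code.words m k = (wordsOfLength m k).map (List.map Fin.val) := by
  induction k with
  | zero => rfl
  | succ k ih =>
    change ((List.range m).flatMap fun i => (Code.words m k).map fun w => i :: w) = _
    rw [ih, wordsOfLength, ← List.map_coe_finRange_eq_range, List.flatMap_map, List.map_flatMap]
    congr 1
    funext i
    simp only [List.map_map]
    rfl

open Classical in
theorem exists_code_listS : ∃ L : List (List (Fin D.m)),
    Code.listS D.code = L.map (List.map Fin.val) ∧ L.map D.evalGens = D.listS := by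
  have key : ∀ M : List (List (Fin D.m)), ∃ L : List (List (Fin D.m)),
      (M.map (List.map Fin.val)).foldr
        (fun w acc => bif acc.any fun w' => Code.eqNormalForm D.code (Code.evalWord D.code w)
          (Code.evalWord D.code w') then acc else w :: acc) [] = L.map (List.map Fin.val) ∧
      L.map D.evalGens = (M.map D.evalGens).dedup := by
    intro M
    induction M with
    | nil => exact ⟨[], rfl, by simp⟩
    | cons w M ih =>
      obtain ⟨L, h1, h2⟩ := ih
      have h3 : ((L.map (List.map Fin.val)).any fun w' => Code.eqNormalForm D.code
          (Code.evalWord D.code (w.map Fin.val)) (Code.evalWord D.code w')) = true ↔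
          D.evalGens w ∈ M.map D.evalGens := by
        rw [← List.mem_dedup, ← h2]
        simp only [List.any_eq_true, List.mem_map, exists_exists_and_eq_and]
        refine exists_congr fun w' => and_congr_right fun _ => ?_
        rw [(D.represents_evalWord w).eqNormalForm_iff (D.represents_evalWord w'), eq_comm]
      rw [List.map_cons, List.foldr_cons, h1, List.map_cons]
      by_cases h4 : D.evalGens w ∈ M.map D.evalGens
      · exact ⟨L, by rw [h3.2 h4, cond_true], by rw [h2, List.dedup_cons_of_mem h4]⟩
      · refine ⟨w :: L, ?_, by rw [List.map_cons, h2, List.dedup_cons_of_notMem h4]⟩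
        rw [← h3, Bool.not_eq_true] at h4
        rw [h4, cond_false, List.map_cons]
  obtain ⟨L, h1, h2⟩ := key ((List.range D.d).flatMap fun k => wordsOfLength D.m (k + 1))
  refine ⟨L, ?_, ?_⟩
  · rw [← h1, Code.listS, code_gens_length]
    simp only [code_words, List.map_flatMap]
    rfl
  · rw [h2, List.map_flatMap, listS, index_eq]

variable {D} in
theorem Represents.snd_eq_identIndex_iff {x : NormalFormCode} {g : G} (h : D.Represents x g) :
    x.2 = Code.identIndex D.code ↔ g ∈ D.A := by
  obtain ⟨i, hi, rfl⟩ := h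
  obtain ⟨j, hj, hj'⟩ := D.represents_identIndex
  simp only [vecOfList_nil, evalVec_zero, one_mul] at hj hj'
  rw [hi, hj, Fin.val_inj, D.A.mul_mem_cancel_left (D.evalVec_mem _)]
  constructor
  · rintro rfl
    rw [hj']; exact one_mem _
  · intro h
    refine (D.transversal (D.t i)).unique ?_ ?_
    · simp only [mul_inv_cancel]; exact one_mem _
    · simpa [hj'] using h

open Classical in
theorem exists_code_listX : ∃ L : List (List (Fin D.m)),
    Code.listX D.code = L.map (List.map Fin.val) ∧ L.map D.evalGens = D.listX := by
  obtain ⟨L, h1, h2⟩ := D.exists_code_listS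
  refine ⟨L.filter fun w => D.evalGens w ∈ D.A, ?_, ?_⟩
  · rw [Code.listX, h1, List.filter_map]
    congr 1
    refine List.filter_congr fun w _ => ?_
    simp [(D.represents_evalWord w).snd_eq_identIndex_iff]
  · rw [listX, ← h2, List.filter_map]
    rfl

open Classical in
theorem exists_code_listY : ∃ L : List (List (Fin D.m)),
    Code.listY D.code = L.map (List.map Fin.val) ∧ L.map D.evalGens = D.listY := by
  obtain ⟨L, h1, h2⟩ := D.exists_code_listS
  refine ⟨L.filter fun w => D.evalGens w ∉ D.A, ?_, ?_⟩
  · rw [Code.listY, h1, List.filter_map]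
    congr 1
    refine List.filter_congr fun w _ => ?_
    simp [(D.represents_evalWord w).snd_eq_identIndex_iff]
  · rw [listY, ← h2, List.filter_map]
    rfl

theorem code_listX_length : (Code.listX D.code).length = D.r := by
  obtain ⟨L, h1, h2⟩ := D.exists_code_listX
  rw [r, h1, ← h2, List.length_map, List.length_map]

theorem code_listY_length : (Code.listY D.code).length = D.s := by
  obtain ⟨L, h1, h2⟩ := D.exists_code_listY
  rw [s, h1, ← h2, List.length_map, List.length_map]

theorem exists_code_x (i : Fin D.r) : ∃ w : List (Fin D.m),
    (Code.listX D.code).getD i [] = w.map Fin.val ∧ D.evalGens w = D.x i := by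
  obtain ⟨L, h1, h2⟩ := D.exists_code_listX
  have hl : D.r = L.length := by rw [r, ← h2, List.length_map]
  have hi : (i : ℕ) < L.length := hl ▸ i.2
  refine ⟨L[i], by rw [h1]; simp [List.getD, hi], ?_⟩
  change D.evalGens L[i] = D.listX[(i : ℕ)]'_
  simp only [← h2, List.getElem_map]
  rfl

theorem exists_code_y (i : Fin D.s) : ∃ w : List (Fin D.m),
    (Code.listY D.code).getD i [] = w.map Fin.val ∧ D.evalGens w = D.y i := by
  obtain ⟨L, h1, h2⟩ := D.exists_code_listY
  have hl : D.s = L.length := by rw [s, ← h2, List.length_map]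
  have hi : (i : ℕ) < L.length := hl ▸ i.2
  refine ⟨L[i], by rw [h1]; simp [List.getD, hi], ?_⟩
  change D.evalGens L[i] = D.listY[(i : ℕ)]'_
  simp only [← h2, List.getElem_map]
  rfl

theorem length_le_weight (w : List (Fin D.m)) : w.length ≤ (w.map D.weight).sum := by
  induction w with
  | nil => simp
  | cons i w ih =>
    have := D.weight_pos i
    simp only [List.length_cons, List.map_cons, List.sum_cons]
    omega

theorem code_omega (w : List (Fin D.m)) :
    Code.omega D.code (w.map Fin.val) = D.omega (D.evalGens w) := by
  have key : ∀ (M : List (List (Fin D.m))) (a : ℕ), D.omega (D.evalGens w) ≤ a →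
      let b := (M.map (List.map Fin.val)).foldr
        (fun u acc => bif Code.eqNormalForm D.code (Code.evalWord D.code u)
          (Code.evalWord D.code (w.map Fin.val))
          then min (Code.wordWeight D.code u) acc else acc) a
      D.omega (D.evalGens w) ≤ b ∧
        ∀ u ∈ M, D.evalGens u = D.evalGens w → b ≤ (u.map D.weight).sum := by
    intro M a ha
    induction M with
    | nil => exact ⟨ha, by simp⟩
    | cons u M ih =>
      simp only [List.map_cons, List.foldr_cons] at ih ⊢
      set b := (M.map (List.map Fin.val)).foldr
        (fun u acc => bif Code.eqNormalForm D.code (Code.evalWord D.code u)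
          (Code.evalWord D.code (w.map Fin.val))
          then min (Code.wordWeight D.code u) acc else acc) a with hb
      by_cases hu : D.evalGens u = D.evalGens w
      · have h1 := ((D.represents_evalWord u).eqNormalForm_iff (D.represents_evalWord w)).2 hu
        rw [h1, cond_true, code_wordWeight]
        refine ⟨le_min (hu ▸ D.omega_evalGens_le u) ih.1, fun u' hu' he => ?_⟩
        rcases List.mem_cons.1 hu' with rfl | hu'
        · exact min_le_left _ _
        · exact (min_le_right _ _).trans (ih.2 u' hu' he)
      · have h1 := mt ((D.represents_evalWord u).eqNormalForm_iff (D.represents_evalWord w)).1 hu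
        rw [Bool.not_eq_true] at h1
        rw [h1, cond_false]
        refine ⟨ih.1, fun u' hu' he => ?_⟩
        rcases List.mem_cons.1 hu' with rfl | hu'
        · exact (hu he).elim
        · exact ih.2 u' hu' he
  have h0 := D.omega_evalGens_le w
  have h1 := key ((List.range ((w.map D.weight).sum + 1)).flatMap fun k => wordsOfLength D.m k)
    (w.map D.weight).sum h0
  have h2 : Code.omega D.code (w.map Fin.val) =
      (((List.range ((w.map D.weight).sum + 1)).flatMap fun k => wordsOfLength D.m k).map
        (List.map Fin.val)).foldr
        (fun u acc => bif Code.eqNormalForm D.code (Code.evalWord D.code u)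
          (Code.evalWord D.code (w.map Fin.val))
          then min (Code.wordWeight D.code u) acc else acc) (w.map D.weight).sum := by
    rw [Code.omega, code_gens_length, code_wordWeight]
    simp only [code_words, List.map_flatMap]
  rw [h2]
  refine le_antisymm ?_ h1.1
  obtain ⟨u, hu, hu'⟩ := D.exists_weight_eq_omega (D.evalGens w)
  rw [← hu']
  refine h1.2 u ?_ hu
  have := D.length_le_weight u
  simp only [List.mem_flatMap, List.mem_range, mem_wordsOfLength, exists_eq_right']
  omega

theorem exists_code_patternPrefix (p : List (Fin D.s)) (j : ℕ) : ∃ w : List (Fin D.m),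
    Code.patternPrefix D.code (p.map Fin.val) j = w.map Fin.val ∧
      D.evalGens w = D.patternPrefix p j := by
  rw [Code.patternPrefix, patternPrefix, ← List.map_take]
  generalize p.take j = q
  induction q with
  | nil => exact ⟨[], rfl, rfl⟩
  | cons i q ih =>
    obtain ⟨w, h1, h2⟩ := ih
    obtain ⟨u, h3, h4⟩ := D.exists_code_y i
    exact ⟨u ++ w, by rw [List.map_cons, List.flatMap_cons, h1, h3, List.map_append], by
      rw [evalGens_append, h2, h4, List.map_cons, List.prod_cons]⟩

theorem vecOfList_column (p : List (Fin D.s)) (j : ℕ) (i : Fin D.r) :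
    vecOfList (D.n + 1) (Code.column D.code (p.map Fin.val) j i) =
      Fin.cons (D.omega (D.x i) : ℤ)
        (D.vec (D.patternPrefix p j * D.x i * (D.patternPrefix p j)⁻¹)) := by
  obtain ⟨w, hw, hw'⟩ := D.exists_code_patternPrefix p j
  obtain ⟨u, hu, hu'⟩ := D.exists_code_x i
  rw [Code.column, hw, hu, code_omega, hu', vecOfList_cons, ← List.map_append, vecOfList_addVec,
    vecOfList_smulVec]
  congr 1
  obtain ⟨k, hk, h1⟩ := D.represents_evalWord w
  obtain ⟨k', hk', h2⟩ := D.represents_evalWord (w ++ u)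
  set v := vecOfList D.n (Code.evalWord D.code (w.map Fin.val)).1
  set v' := vecOfList D.n (Code.evalWord D.code ((w ++ u).map Fin.val)).1
  rw [evalGens_append, hw', hu'] at h2
  rw [hw'] at h1
  have hA := D.conj_mem (D.x_mem i) (D.patternPrefix p j)
  set a := D.vec (D.patternPrefix p j * D.x i * (D.patternPrefix p j)⁻¹) with ha
  have h3 : evalNormalForm D.basis D.t (v', k') = evalNormalForm D.basis D.t (a + v, k) := by
    rw [evalNormalForm, evalNormalForm, h2, evalVec_add, mul_assoc, h1, ha, D.evalVec_vec hA,
      inv_mul_cancel_right]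
  have h4 := congrArg Prod.fst (D.evalNormalForm_injective h3)
  simp only at h4
  rw [h4]
  module

theorem code_dim (p : D.Pattern) : Code.dim D.code (p.1.map Fin.val) = D.dim p := by
  rw [Code.dim, List.length_map, code_listX_length]

theorem code_columns_length (p : D.Pattern) :
    (Code.columns D.code (p.1.map Fin.val)).length = D.dim p := by
  rw [Code.columns, List.length_map, List.length_range, code_dim]

theorem code_mem_patterns {l : List ℕ} :
    l ∈ Code.patterns D.code ↔ ∃ p : D.Pattern, p.1.map Fin.val = l := by
  rw [Code.patterns, code_listY_length]
  simp only [code_words, List.mem_flatMap, List.mem_range, List.mem_map, mem_wordsOfLength]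
  constructor
  · rintro ⟨k, hk, p, hp, rfl⟩
    refine ⟨⟨p, ?_⟩, rfl⟩
    rw [index_eq, hp]
    exact Nat.lt_succ_iff.1 hk
  · rintro ⟨p, rfl⟩
    refine ⟨p.1.length, ?_, p.1, rfl, rfl⟩
    exact Nat.lt_succ_of_le (p.2.trans_eq D.index_eq)

theorem map_val_injective : Function.Injective fun p : D.Pattern => p.1.map Fin.val :=
  fun _ _ h => Subtype.ext (List.map_injective_iff.2 Fin.val_injective h)

theorem exists_color (p : D.Pattern) : ∃ (j : Fin D.d) (b : Fin D.n → ℤ),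
    Code.color D.code (p.1.map Fin.val) = j ∧
      vecOfList (D.n + 1) (Code.base D.code (p.1.map Fin.val)) =
        Fin.cons ((p.1.map fun i => D.omega (D.y i)).sum : ℤ) b ∧
      evalVec D.basis b * D.t j = (p.1.map D.y).prod := by
  obtain ⟨w, hw, hw'⟩ := D.exists_code_patternPrefix p.1 p.1.length
  obtain ⟨j, hj, h⟩ := D.represents_evalWord w
  refine ⟨j, vecOfList D.n (Code.evalWord D.code (w.map Fin.val)).1, ?_, ?_, ?_⟩
  · rw [Code.color, List.length_map, hw, hj]
  · rw [Code.base, List.length_map, hw, vecOfList_cons]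
    congr 2
    rw [List.map_map]
    congr 1
    refine List.map_congr_left fun i _ => ?_
    obtain ⟨u, hu, hu'⟩ := D.exists_code_y i
    simp only [Function.comp_apply, hu, code_omega, hu']
  · rw [h, hw', patternPrefix, List.take_length]

/-- The number of the transversal element in the normal form of a patterned word. -/
noncomputable def color (p : D.Pattern) : Fin D.d := (D.exists_color p).choose

theorem code_color (p : D.Pattern) : Code.color D.code (p.1.map Fin.val) = D.color p :=
  (D.exists_color p).choose_spec.choose_spec.1

/-- The weight of the patterned word with exponents `w`, followed by the exponents of its normal
form. -/
noncomputable def value (p : D.Pattern) (w : Fin (D.dim p) → ℕ) : Fin (D.n + 1) → ℤ :=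
  vecOfList (D.n + 1) (Code.base D.code (p.1.map Fin.val)) +
    ∑ q, w q • vecOfList (D.n + 1) ((Code.columns D.code (p.1.map Fin.val)).getD q [])

theorem vecOfList_columns (p : D.Pattern) (j : Fin (p.1.length + 1)) (i : Fin D.r) :
    vecOfList (D.n + 1) ((Code.columns D.code (p.1.map Fin.val)).getD
      (finProdFinEquiv (j, i) : Fin (D.dim p)) []) = Fin.cons (D.omega (D.x i) : ℤ)
        (D.vec (D.patternPrefix p.1 j * D.x i * (D.patternPrefix p.1 j)⁻¹)) := by
  have hlt := (finProdFinEquiv (j, i) : Fin (D.dim p)).2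
  rw [Code.columns, getD_map_range, code_dim, if_pos hlt, code_listX_length,
    ← vecOfList_column]
  congr 2
  · simp only [finProdFinEquiv_apply_val]
    rw [Nat.add_mul_div_left _ _ (Nat.pos_of_ne_zero fun h => by have := i.2; omega),
      Nat.div_eq_of_lt i.2, zero_add]
  · simp only [finProdFinEquiv_apply_val]
    rw [Nat.add_mul_mod_self_left, Nat.mod_eq_of_lt i.2]

theorem value_eq (p : D.Pattern) (w : Fin (D.dim p) → ℕ) :
    ∃ v, D.value p w = Fin.cons (D.wordWeight (D.patternedWord p w) : ℤ) v ∧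
      (D.patternedWord p w).prod = evalVec D.basis v * D.t (D.color p) := by
  obtain ⟨b, -, h1, h2⟩ := (D.exists_color p).choose_spec
  change evalVec D.basis b * D.t (D.color p) = _ at h2
  refine ⟨b + ∑ j, ∑ i, w (finProdFinEquiv (j, i)) •
    D.vec (D.patternPrefix p.1 j * D.x i * (D.patternPrefix p.1 j)⁻¹), ?_, ?_⟩
  · rw [value, h1, ← finProdFinEquiv.sum_comp, Fintype.sum_prod_type, patternedWord,
      wordWeight_interleave]
    simp only [vecOfList_columns]
    funext l
    refine Fin.cases ?_ (fun l => ?_) l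
    · simp only [Pi.add_apply, Finset.sum_apply, Pi.smul_apply, Fin.cons_zero]
      simp only [nsmul_eq_mul]
      push_cast
      ring
    · simp only [Pi.add_apply, Finset.sum_apply, Pi.smul_apply, Fin.cons_succ]
  · rw [patternedWord, prod_interleave, ← h2, ← mul_assoc, ← evalVec_add, add_comm]

/-! ### Cosets -/

/-- The coordinate vectors of the elements of the subgroup generated by the given elements. -/
def lattice {k : ℕ} (h : Fin k → Fin D.n → ℤ) : AddSubgroup (Fin D.n → ℤ) :=
  AddSubgroup.closure (Set.range h)

theorem evalVec_mem_spanSubgroup {k : ℕ} (h : Fin k → Fin D.n → ℤ) (v : Fin D.n → ℤ) :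
    evalVec D.basis v ∈ D.spanSubgroup h ↔ v ∈ D.lattice h := by
  let E : Multiplicative (Fin D.n → ℤ) →* G := D.A.subtype.comp D.basis.toMonoidHom
  have h1 : D.spanSubgroup h = (AddSubgroup.toSubgroup (D.lattice h)).map E := by
    rw [lattice, AddSubgroup.toSubgroup_closure, MonoidHom.map_closure, spanSubgroup]
    congr 1
    ext g
    simp only [Set.mem_range, Set.mem_image]
    constructor
    · rintro ⟨j, rfl⟩
      exact ⟨Multiplicative.ofAdd (h j), ⟨j, rfl⟩, rfl⟩
    · rintro ⟨x, ⟨j, hj⟩, rfl⟩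
      exact ⟨j, by rw [hj]; rfl⟩
  rw [h1, Subgroup.mem_map]
  constructor
  · rintro ⟨x, hx, hxv⟩
    have : Multiplicative.toAdd x = v := D.evalVec_injective hxv
    rw [← this]
    exact hx
  · intro hv
    exact ⟨Multiplicative.ofAdd v, hv, rfl⟩

theorem mul_inv_mem_spanSubgroup_iff {k : ℕ} (h : Fin k → Fin D.n → ℤ) (v v' : Fin D.n → ℤ)
    (j j' : Fin D.d) : (evalVec D.basis v * D.t j) * (evalVec D.basis v' * D.t j')⁻¹ ∈
      D.spanSubgroup h ↔ j = j' ∧ v - v' ∈ D.lattice h := by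
  have hle : D.spanSubgroup h ≤ D.A := by
    rw [spanSubgroup, Subgroup.closure_le]
    rintro _ ⟨i, rfl⟩
    exact D.evalVec_mem _
  constructor
  · intro hm
    have hj : j = j' := by
      refine (D.transversal (D.t j)).unique ?_ ?_
      · simp only [mul_inv_cancel]; exact one_mem _
      · have h1 : D.t j * (D.t j')⁻¹ = (evalVec D.basis v)⁻¹ *
            ((evalVec D.basis v * D.t j) * (evalVec D.basis v' * D.t j')⁻¹) *
              evalVec D.basis v' := by group
        rw [h1]
        exact D.A.mul_mem (D.A.mul_mem (D.A.inv_mem (D.evalVec_mem _)) (hle hm)) (D.evalVec_mem _)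
    subst hj
    refine ⟨rfl, ?_⟩
    rw [← evalVec_mem_spanSubgroup, evalVec_sub]
    convert hm using 1
    group
  · rintro ⟨rfl, hm⟩
    rw [← evalVec_mem_spanSubgroup, evalVec_sub] at hm
    convert hm using 1
    group

end Description

end VirtAb

namespace VirtAb

/-! ### Monoids spanned by images of lists -/

theorem mem_monoidSpan_append_iff {n : ℕ} {l m : List (List ℤ)} {z : Fin n → ℤ} :
    z ∈ monoidSpan n (l ++ m) ↔ ∃ y ∈ monoidSpan n l, z - y ∈ monoidSpan n m := by
  rw [monoidSpan_append, AddSubmonoid.mem_sup]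
  refine exists_congr fun y => and_congr_right fun _ => ?_
  constructor
  · rintro ⟨x, hx, rfl⟩
    rwa [add_sub_cancel_left]
  · exact fun h => ⟨_, h, by abel⟩

theorem monoidSpan_map {m n : ℕ} {f : List ℕ → List ℤ} {F : (Fin m → ℕ) →+ (Fin n → ℤ)}
    (h : ∀ u, vecOfList n (f u) = F (natVec m u)) (P : List (List ℕ)) :
    monoidSpan n (P.map f) = (AddSubmonoid.closure {v | ∃ u ∈ P, natVec m u = v}).map F := by
  rw [monoidSpan, AddMonoidHom.map_mclosure]
  congr 1
  ext v
  simp only [List.mem_map, exists_exists_and_eq_and, Set.mem_ofPred_eq, Set.mem_image, h]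

theorem mem_monoidSpan_map_append_iff {m n : ℕ} {f : List ℕ → List ℤ}
    {F : (Fin m → ℕ) →+ (Fin n → ℤ)} (h : ∀ u, vecOfList n (f u) = F (natVec m u))
    {P : List (List ℕ)} {R : List (List ℤ)} {z : Fin n → ℤ} :
    z ∈ monoidSpan n (P.map f ++ R) ↔
      ∃ a ∈ AddSubmonoid.closure {v | ∃ u ∈ P, natVec m u = v}, z - F a ∈ monoidSpan n R := by
  rw [mem_monoidSpan_append_iff, monoidSpan_map h]
  simp only [AddSubmonoid.mem_map, exists_exists_and_eq_and]

theorem mem_monoidSpan_neg_map_append_iff {m n : ℕ} {f : List ℕ → List ℤ}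
    {F : (Fin m → ℕ) →+ (Fin n → ℤ)} (h : ∀ u, vecOfList n (f u) = F (natVec m u))
    {P : List (List ℕ)} {R : List (List ℤ)} {z : Fin n → ℤ} :
    z ∈ monoidSpan n ((P.map f).map (smulVec (-1)) ++ R) ↔
      ∃ a ∈ AddSubmonoid.closure {v | ∃ u ∈ P, natVec m u = v}, z + F a ∈ monoidSpan n R := by
  rw [List.map_map, mem_monoidSpan_map_append_iff (F := -F)]
  · simp
  · intro u
    rw [Function.comp_apply, vecOfList_smulVec, h]
    simp

theorem vecOfList_cons_tail (n : ℕ) (x : ℤ) (l : List ℤ) :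
    vecOfList (n + 1) (x :: l.tail) = Fin.cons x (Fin.tail (vecOfList (n + 1) l)) := by
  rw [vecOfList_cons]
  congr 1
  funext i
  cases l <;> simp [vecOfList, Fin.tail]

/-! ### Certificates for regular sets of representatives -/

/-- A pattern together with a linear set of exponent vectors. -/
abbrev PatternPiece : Type := List ℕ × LinPiece

/-- A list of linear sets of words, with certificates for the fact that the words represent every
coset with minimal weight and for the fact that they represent each coset only once. -/
abbrev Certificate : Type :=
  List PatternPiece × List (List (List LinSys) × List (List ℤ)) × List (List (List ℤ))

namespace Code

/-- Generators of `0 × H` as a monoid. -/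
def latticeColumns (Hs : List (List ℤ)) : List (List ℤ) :=
  (Hs.map fun u => 0 :: u) ++ Hs.map fun u => 0 :: smulVec (-1) u

/-- The weight and the coordinates of the word given by the base of a linear set. -/
def pieceBase (c : DescriptionCode) (q : PatternPiece) : List ℤ :=
  addVec (base c q.1) (lincomb (columns c q.1) (castList q.2.1))

/-- The contributions of the periods of a linear set to the weight and the coordinates. -/
def pieceColumns (c : DescriptionCode) (q : PatternPiece) : List (List ℤ) :=
  q.2.2.1.map fun u => lincomb (columns c q.1) (castList u)

/-- A linear system expressing that a word in a linear set represents the same coset as, and is not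
heavier than, a word with the given pattern. -/
def coverSystem (c : DescriptionCode) (Hs : List (List ℤ)) (p : List ℕ) (q : PatternPiece) :
    LinSys :=
  ((pieceColumns c q).map (smulVec (-1)) ++ (latticeColumns Hs ++ [[-1]]),
    addVec (pieceBase c q) (smulVec (-1) (base c p)))

/-- The systems `coverSystem` for all linear sets of a list. -/
def coverSystems (c : DescriptionCode) (Hs : List (List ℤ)) (l : List PatternPiece)
    (p : List ℕ) : List LinSys :=
  (l.filter fun q => decide (color c q.1 = color c p)).map fun q => coverSystem c Hs p q

/-- Like `pieceBase`, with the weight replaced by the number of the pattern (for `i = 0`) or an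
exponent (for `i > 0`). -/
def tagBase (c : DescriptionCode) (q : PatternPiece) (i : ℕ) : List ℤ :=
  (((Encodable.encode q.1 :: q.2.1).getD i 0 : ℕ) : ℤ) :: (pieceBase c q).tail

/-- Like `pieceColumns`, with the weight replaced as in `tagBase`. -/
def tagColumns (c : DescriptionCode) (q : PatternPiece) (i : ℕ) : List (List ℤ) :=
  q.2.2.1.map fun u =>
    (((0 :: u).getD i 0 : ℕ) : ℤ) :: (lincomb (columns c q.1) (castList u)).tail

/-- A linear system expressing that two words in the given linear sets represent the same coset and
differ in the pattern or an exponent. -/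
def overlapSystem (c : DescriptionCode) (Hs : List (List ℤ)) (q q' : PatternPiece) (i : ℕ) :
    LinSys :=
  ((tagColumns c q i).map (smulVec (-1)) ++ (tagColumns c q' i ++ (latticeColumns Hs ++ [[1]])),
    addVec (tagBase c q i) (smulVec (-1) (addVec (tagBase c q' i) [1])))

/-- The systems `overlapSystem` for all pairs of linear sets of a list. -/
def overlapSystems (c : DescriptionCode) (Hs : List (List ℤ)) (l : List PatternPiece) :
    List LinSys :=
  l.flatMap fun q => (l.filter fun q' => decide (color c q.1 = color c q'.1)).flatMap fun q' =>
    (List.range (min (dim c q.1) (dim c q'.1) + 1)).map fun i => overlapSystem c Hs q q' i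

/-- Whether the pieces have patterns and their data are correct. -/
def checkPieces (c : DescriptionCode) (l : List PatternPiece) : Bool :=
  l.all fun q => ((patterns c).any fun p => decide (q.1 = p)) && q.2.check (dim c q.1)

/-- Checks the certificates for the systems `coverSystems`. -/
def checkCovering (c : DescriptionCode) (Hs : List (List ℤ)) (l : List PatternPiece)
    (C : List (List (List LinSys) × List (List ℤ))) : Bool :=
  (patterns c).all fun p => C.any fun e =>
    checkCovers (c.1 + 1) (columns c p) (coverSystems c Hs l p) e

/-- Checks the certificates for the systems `overlapSystems`. -/
def checkSeparated (c : DescriptionCode) (Hs : List (List ℤ)) (l : List PatternPiece)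
    (C : List (List (List ℤ))) : Bool :=
  (overlapSystems c Hs l).all fun e => C.any fun S => checkInfeasible (c.1 + 1) e.1 e.2 S

/-- Checks a certificate. -/
def checkCertificate (x : DescriptionCode × List (List ℤ)) (s : Certificate) : Bool :=
  checkPieces x.1 s.1 && checkCovering x.1 x.2 s.1 s.2.1 && checkSeparated x.1 x.2 s.1 s.2.2

/-- A description of the polyhedral set of the exponents of words with a given pattern. -/
def polyhedralCode (c : DescriptionCode) (l : List PatternPiece) (p : List ℕ) : PolyhedralCode :=
  (l.filter fun q => decide (q.1 = p)).map fun q => q.2.code (dim c p)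

section Primrec

variable {α : Type*} [Primcodable α] {f : α → DescriptionCode} {Hs : α → List (List ℤ)}

@[fun_prop]
theorem primrec_latticeColumns (hH : Primrec Hs) : Primrec fun x => latticeColumns (Hs x) := by
  unfold latticeColumns; fun_prop

@[fun_prop]
theorem primrec_pieceBase {q : α → PatternPiece} (hf : Primrec f) (hq : Primrec q) :
    Primrec fun x => pieceBase (f x) (q x) := by
  unfold pieceBase; fun_prop

@[fun_prop]
theorem primrec_pieceColumns {q : α → PatternPiece} (hf : Primrec f) (hq : Primrec q) :
    Primrec fun x => pieceColumns (f x) (q x) := by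
  unfold pieceColumns; fun_prop

@[fun_prop]
theorem primrec_coverSystem {p : α → List ℕ} {q : α → PatternPiece} (hf : Primrec f)
    (hH : Primrec Hs) (hp : Primrec p) (hq : Primrec q) :
    Primrec fun x => coverSystem (f x) (Hs x) (p x) (q x) := by
  unfold coverSystem; fun_prop

@[fun_prop]
theorem primrec_coverSystems {l : α → List PatternPiece} {p : α → List ℕ} (hf : Primrec f)
    (hH : Primrec Hs) (hl : Primrec l) (hp : Primrec p) :
    Primrec fun x => coverSystems (f x) (Hs x) (l x) (p x) := by
  unfold coverSystems; fun_prop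

@[fun_prop]
theorem primrec_tagBase {q : α → PatternPiece} {i : α → ℕ} (hf : Primrec f) (hq : Primrec q)
    (hi : Primrec i) : Primrec fun x => tagBase (f x) (q x) (i x) := by
  unfold tagBase; fun_prop

@[fun_prop]
theorem primrec_tagColumns {q : α → PatternPiece} {i : α → ℕ} (hf : Primrec f) (hq : Primrec q)
    (hi : Primrec i) : Primrec fun x => tagColumns (f x) (q x) (i x) := by
  unfold tagColumns; fun_prop

@[fun_prop]
theorem primrec_overlapSystem {q q' : α → PatternPiece} {i : α → ℕ} (hf : Primrec f)
    (hH : Primrec Hs) (hq : Primrec q) (hq' : Primrec q') (hi : Primrec i) :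
    Primrec fun x => overlapSystem (f x) (Hs x) (q x) (q' x) (i x) := by
  unfold overlapSystem; fun_prop

@[fun_prop]
theorem primrec_overlapSystems {l : α → List PatternPiece} (hf : Primrec f)
    (hH : Primrec Hs) (hl : Primrec l) : Primrec fun x => overlapSystems (f x) (Hs x) (l x) := by
  unfold overlapSystems; fun_prop

@[fun_prop]
theorem primrec_checkPieces {l : α → List PatternPiece} (hf : Primrec f)
    (hl : Primrec l) : Primrec fun x => checkPieces (f x) (l x) := by
  unfold checkPieces; fun_prop

@[fun_prop]
theorem primrec_checkCovering {l : α → List PatternPiece}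
    {C : α → List (List (List LinSys) × List (List ℤ))} (hf : Primrec f) (hH : Primrec Hs)
    (hl : Primrec l) (hC : Primrec C) :
    Primrec fun x => checkCovering (f x) (Hs x) (l x) (C x) := by
  unfold checkCovering; fun_prop

@[fun_prop]
theorem primrec_checkSeparated {l : α → List PatternPiece} {C : α → List (List (List ℤ))}
    (hf : Primrec f) (hH : Primrec Hs) (hl : Primrec l) (hC : Primrec C) :
    Primrec fun x => checkSeparated (f x) (Hs x) (l x) (C x) := by
  unfold checkSeparated; fun_prop

theorem primrec_checkCertificate : Primrec₂ checkCertificate := by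
  unfold Primrec₂ checkCertificate; fun_prop

@[fun_prop]
theorem primrec_polyhedralCode {l : α → List PatternPiece} {p : α → List ℕ} (hf : Primrec f)
    (hl : Primrec l) (hp : Primrec p) : Primrec fun x => polyhedralCode (f x) (l x) (p x) := by
  unfold polyhedralCode; fun_prop

end Primrec

end Code

/-- An unbounded search for an object that passes a check. -/
theorem exists_partrec_search {α β : Type*} [Primcodable α] [Primcodable β] {check : α → β → Bool}
    (h : Primrec₂ check) : ∃ f : α →. β, Partrec f ∧ (∀ a, ∀ b ∈ f a, check a b = true) ∧
      ∀ a b, check a b = true → (f a).Dom := by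
  let F : α → ℕ → Option β := fun a n =>
    (Encodable.decode n : Option β).bind fun b => bif check a b then some b else none
  have hF : Primrec₂ F := by
    refine Primrec.option_bind (Primrec.decode.comp Primrec.snd) ?_
    exact Primrec.cond (h.comp (Primrec.fst.comp Primrec.fst) Primrec.snd)
      (Primrec.option_some.comp Primrec.snd) (Primrec.const none)
  have hF' : ∀ a n b, b ∈ F a n → check a b = true := by
    intro a n b hb
    obtain ⟨b', -, hb'⟩ := Option.mem_bind_iff.1 hb
    cases hc : check a b' with
    | false => simp [hc] at hb'
    | true =>
      have : b' = b := by simpa [hc] using hb'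
      rwa [← this]
  refine ⟨fun a => Nat.rfindOpt (F a), Partrec.rfindOpt hF.to_comp, fun a b hb => ?_,
    fun a b hb => ?_⟩
  · obtain ⟨n, hn⟩ := Nat.rfindOpt_spec hb
    exact hF' a n b hn
  · exact Nat.rfindOpt_dom.2 ⟨Encodable.encode b, b, by simp [F, hb]⟩

end VirtAb

namespace VirtAb

namespace Description

variable {G : Type u} [Group G] (D : Description G)

/-! ### The meaning of the linear systems -/

/-- The contribution of exponents to the weight and the coordinates of a patterned word. -/
noncomputable def columnHom (p : D.Pattern) : (Fin (D.dim p) → ℕ) →+ (Fin (D.n + 1) → ℤ) where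
  toFun w := ∑ q, w q • vecOfList (D.n + 1) ((Code.columns D.code (p.1.map Fin.val)).getD q [])
  map_zero' := by simp
  map_add' := by simp [add_smul, Finset.sum_add_distrib]

theorem value_def (p : D.Pattern) (w : Fin (D.dim p) → ℕ) : D.value p w =
    vecOfList (D.n + 1) (Code.base D.code (p.1.map Fin.val)) + D.columnHom p w := rfl

theorem vecOfList_lincomb_columns (p : D.Pattern) (u : List ℕ) :
    vecOfList (D.n + 1) (lincomb (Code.columns D.code (p.1.map Fin.val)) (castList u)) =
      D.columnHom p (natVec (D.dim p) u) := by
  have h := D.code_columns_length p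
  set l := Code.columns D.code (p.1.map Fin.val) with hl
  rw [vecOfList_lincomb, comb_eq_sum]
  change _ = ∑ q : Fin (D.dim p), natVec (D.dim p) u q • vecOfList (D.n + 1) (l.getD q [])
  have h1 : (l.map (vecOfList (D.n + 1))).length = D.dim p := by rw [List.length_map, h]
  rw [← (finCongr h1).sum_comp]
  refine Finset.sum_congr rfl fun i _ => ?_
  have hi : (i : ℕ) < l.length := i.2.trans_eq (List.length_map _)
  have hc := getD_castList u i
  simp only [List.getD_eq_getElem?_getD] at hc
  simp [natVec, hi, hc]

theorem monoidSpan_columns (p : D.Pattern) :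
    monoidSpan (D.n + 1) (Code.columns D.code (p.1.map Fin.val)) =
      AddMonoidHom.mrange (D.columnHom p) := by
  have h := D.code_columns_length p
  refine le_antisymm ?_ ?_
  · rw [monoidSpan, AddSubmonoid.closure_le]
    rintro _ ⟨c, hc, rfl⟩
    obtain ⟨i, hi, rfl⟩ := List.mem_iff_getElem.1 hc
    refine ⟨Pi.single ⟨i, h ▸ hi⟩ 1, ?_⟩
    change ∑ q : Fin (D.dim p), _ = _
    rw [Finset.sum_eq_single ⟨i, h ▸ hi⟩]
    · simp [List.getD, hi]
    · intro q _ hq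
      rw [Pi.single_eq_of_ne hq, zero_smul]
    · simp
  · rintro _ ⟨w, rfl⟩
    change ∑ q : Fin (D.dim p), _ ∈ _
    refine sum_mem fun q _ => AddSubmonoid.nsmul_mem _ (vecOfList_mem_monoidSpan ?_) _
    have hq : (q : ℕ) < (Code.columns D.code (p.1.map Fin.val)).length := h.symm ▸ q.2
    rw [List.getD_eq_getElem _ _ hq]
    exact List.getElem_mem _

variable {k : ℕ} (h : Fin k → Fin D.n → ℤ)

/-- The list of the coordinates of a basis. -/
def basisCode : List (List ℤ) := List.ofFn fun j => List.ofFn (h j)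

theorem mem_monoidSpan_latticeColumns_iff (z : Fin (D.n + 1) → ℤ) :
    z ∈ monoidSpan (D.n + 1) (Code.latticeColumns (D.basisCode h)) ↔
      z 0 = 0 ∧ Fin.tail z ∈ D.lattice h := by
  have h1 : monoidSpan (D.n + 1) (Code.latticeColumns (D.basisCode h)) =
      AddSubmonoid.closure
        ((fun v => (Fin.cons 0 v : Fin (D.n + 1) → ℤ)) '' (Set.range h ∪ -Set.range h)) := by
    rw [monoidSpan]
    congr 1
    ext v
    simp only [Code.latticeColumns, basisCode, List.map_ofFn, List.mem_append, List.mem_ofFn,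
      Set.mem_image, Set.mem_union, Set.mem_range, Set.mem_neg, Set.mem_ofPred_eq]
    constructor
    · rintro ⟨c, ⟨j, rfl⟩ | ⟨j, rfl⟩, rfl⟩
      · exact ⟨h j, Or.inl ⟨j, rfl⟩, by simp⟩
      · exact ⟨-h j, Or.inr ⟨j, by simp⟩, by simp⟩
    · rintro ⟨c, ⟨j, rfl⟩ | ⟨j, hj⟩, rfl⟩
      · exact ⟨_, Or.inl ⟨j, rfl⟩, by simp⟩
      · exact ⟨_, Or.inr ⟨j, rfl⟩, by simp [hj]⟩
  let C : (Fin D.n → ℤ) →+ (Fin (D.n + 1) → ℤ) :=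
    { toFun := fun v => Fin.cons 0 v
      map_zero' := by funext i; refine Fin.cases ?_ (fun i => ?_) i <;> simp
      map_add' := fun v w => by funext i; refine Fin.cases ?_ (fun i => ?_) i <;> simp }
  have h2 := AddMonoidHom.map_mclosure C (Set.range h ∪ -Set.range h)
  rw [← AddSubgroup.closure_toAddSubmonoid] at h2
  rw [h1]
  change z ∈ AddSubmonoid.closure (C '' _) ↔ _
  rw [← h2, AddSubmonoid.mem_map]
  constructor
  · rintro ⟨v, hv, rfl⟩
    exact ⟨rfl, hv⟩
  · rintro ⟨h0, hz⟩
    refine ⟨Fin.tail z, hz, ?_⟩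
    change Fin.cons 0 (Fin.tail z) = z
    rw [← h0, Fin.cons_self_tail]

theorem mem_monoidSpan_latticeColumns_append_iff {e : ℤ} (he : e * e = 1)
    (z : Fin (D.n + 1) → ℤ) :
    z ∈ monoidSpan (D.n + 1) (Code.latticeColumns (D.basisCode h) ++ [[e]]) ↔
      0 ≤ e * z 0 ∧ Fin.tail z ∈ D.lattice h := by
  have h1 : ∀ y, y ∈ monoidSpan (D.n + 1) [[e]] ↔
      ∃ s : ℕ, (Fin.cons (s * e) 0 : Fin (D.n + 1) → ℤ) = y := by
    intro y
    have : monoidSpan (D.n + 1) [[e]] = AddSubmonoid.closure {vecOfList (D.n + 1) [e]} := by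
      rw [monoidSpan]
      congr 1
      ext v
      simp [eq_comm]
    rw [this, AddSubmonoid.mem_closure_singleton]
    refine exists_congr fun s => ?_
    rw [vecOfList_cons, vecOfList_nil]
    have : (s • Fin.cons e 0 : Fin (D.n + 1) → ℤ) = Fin.cons (s * e) 0 := by
      funext i; refine Fin.cases ?_ (fun i => ?_) i <;> simp
    rw [this]
  rw [mem_monoidSpan_append_iff]
  simp only [h1, mem_monoidSpan_latticeColumns_iff]
  constructor
  · rintro ⟨y, ⟨hy0, hy⟩, s, hs⟩
    have h0 := congrFun hs 0
    rw [Pi.sub_apply, hy0, sub_zero, Fin.cons_zero] at h0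
    have ht : Fin.tail z = Fin.tail y := by
      funext i
      have := congrFun hs i.succ
      simp only [Fin.cons_succ, Pi.zero_apply, Pi.sub_apply] at this
      simp only [Fin.tail]; omega
    rw [← h0, ht]
    refine ⟨?_, hy⟩
    rw [mul_left_comm, he, mul_one]
    positivity
  · rintro ⟨h0, hz⟩
    refine ⟨Fin.cons 0 (Fin.tail z), ⟨rfl, hz⟩, (e * z 0).toNat, ?_⟩
    rw [Int.toNat_of_nonneg h0, mul_right_comm, he, one_mul]
    funext i
    refine Fin.cases ?_ (fun i => ?_) i <;> simp [Fin.tail]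

/-- The exponent vectors of the words with the given pattern in the given linear sets. -/
def pieceSet (l : List PatternPiece) (p : D.Pattern) : Set (Fin (D.dim p) → ℕ) :=
  {w | ∃ q ∈ l, q.1 = p.1.map Fin.val ∧ w ∈ q.2.toSet (D.dim p)}

/-- Every patterned word represents the same coset as a word in the given sets which is not heavier. -/
def IsCovering (Z : ∀ p : D.Pattern, Set (Fin (D.dim p) → ℕ)) : Prop :=
  ∀ p' w', ∃ p, ∃ w ∈ Z p, D.color p = D.color p' ∧
    Fin.tail (D.value p w) - Fin.tail (D.value p' w') ∈ D.lattice h ∧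
    D.value p w 0 ≤ D.value p' w' 0

/-- Different words in the given sets represent different cosets. -/
def IsSeparated (Z : ∀ p : D.Pattern, Set (Fin (D.dim p) → ℕ)) : Prop :=
  ∀ p, ∀ w ∈ Z p, ∀ p', ∀ w' ∈ Z p', D.color p = D.color p' →
    Fin.tail (D.value p w) - Fin.tail (D.value p' w') ∈ D.lattice h →
    (⟨p, w⟩ : Σ p : D.Pattern, Fin (D.dim p) → ℕ) = ⟨p', w'⟩

theorem vecOfList_pieceBase (p : D.Pattern) (q : LinPiece) :
    vecOfList (D.n + 1) (Code.pieceBase D.code (p.1.map Fin.val, q)) =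
      D.value p (natVec (D.dim p) q.1) := by
  rw [Code.pieceBase, vecOfList_addVec, vecOfList_lincomb_columns, value_def]

theorem value_add (p : D.Pattern) (w a : Fin (D.dim p) → ℕ) :
    D.value p (w + a) = D.value p w + D.columnHom p a := by
  rw [value_def, value_def, map_add, add_assoc]

theorem coverSystem_solvable_iff (p p' : D.Pattern) (q : LinPiece) (w' : Fin (D.dim p') → ℕ) :
    vecOfList (D.n + 1) (Code.coverSystem D.code (D.basisCode h) (p'.1.map Fin.val)
      (p.1.map Fin.val, q)).2 - D.columnHom p' w' ∈ monoidSpan (D.n + 1)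
        (Code.coverSystem D.code (D.basisCode h) (p'.1.map Fin.val) (p.1.map Fin.val, q)).1 ↔
    ∃ w ∈ q.toSet (D.dim p), Fin.tail (D.value p w) - Fin.tail (D.value p' w') ∈ D.lattice h ∧
      D.value p w 0 ≤ D.value p' w' 0 := by
  rw [Code.coverSystem, Code.pieceColumns,
    mem_monoidSpan_neg_map_append_iff (D.vecOfList_lincomb_columns p)]
  simp only [vecOfList_addVec, vecOfList_smulVec, vecOfList_pieceBase,
    mem_monoidSpan_latticeColumns_append_iff D h (by norm_num : (-1 : ℤ) * -1 = 1)]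
  have key : ∀ a, D.value p (natVec (D.dim p) q.1) +
      (-1 : ℤ) • vecOfList (D.n + 1) (Code.base D.code (p'.1.map Fin.val)) - D.columnHom p' w' +
        D.columnHom p a = D.value p (natVec (D.dim p) q.1 + a) - D.value p' w' := by
    intro a
    rw [value_add, D.value_def p' w']
    module
  simp only [key, LinPiece.toSet, Set.mem_ofPred_eq]
  have ht : ∀ x y : Fin (D.n + 1) → ℤ, Fin.tail (x - y) = Fin.tail x - Fin.tail y :=
    fun _ _ => rfl
  constructor
  · rintro ⟨a, ha, h1, h2⟩
    refine ⟨_, ⟨a, ha, rfl⟩, ht _ _ ▸ h2, ?_⟩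
    rw [Pi.sub_apply] at h1
    linarith
  · rintro ⟨_, ⟨a, ha, rfl⟩, h1, h2⟩
    refine ⟨a, ha, ?_, ht _ _ ▸ h1⟩
    rw [Pi.sub_apply]
    linarith

theorem isCovering_iff {l : List PatternPiece}
    (hl : ∀ q ∈ l, q.1 ∈ Code.patterns D.code) :
    D.IsCovering h (D.pieceSet l) ↔ ∀ p ∈ Code.patterns D.code,
      Covers (D.n + 1) (Code.columns D.code p)
        (Code.coverSystems D.code (D.basisCode h) l p) := by
  have h1 : (∀ p ∈ Code.patterns D.code, Covers (D.n + 1) (Code.columns D.code p)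
        (Code.coverSystems D.code (D.basisCode h) l p)) ↔ ∀ p : D.Pattern,
      Covers (D.n + 1) (Code.columns D.code (p.1.map Fin.val))
        (Code.coverSystems D.code (D.basisCode h) l (p.1.map Fin.val)) := by
    simp only [code_mem_patterns]
    exact ⟨fun h p => h _ ⟨p, rfl⟩, by rintro h _ ⟨p, rfl⟩; exact h p⟩
  rw [h1, IsCovering]
  refine forall_congr' fun p' => ?_
  rw [Covers, monoidSpan_columns]
  simp only [AddMonoidHom.mem_mrange, forall_exists_index, forall_apply_eq_imp_iff]
  refine forall_congr' fun w' => ?_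
  simp only [Code.coverSystems, List.mem_map, List.mem_filter, decide_eq_true_eq,
    exists_exists_and_eq_and, pieceSet, Set.mem_ofPred_eq]
  constructor
  · rintro ⟨p, w, ⟨⟨q₁, q⟩, hq, rfl, hw⟩, hc, h2⟩
    refine ⟨_, ⟨hq, ?_⟩, (D.coverSystem_solvable_iff h p p' q w').2 ⟨w, hw, h2⟩⟩
    rw [code_color, code_color, hc]
  · rintro ⟨⟨q₁, q⟩, ⟨hq, hc⟩, h2⟩
    obtain ⟨p, rfl⟩ := D.code_mem_patterns.1 (hl _ hq)
    obtain ⟨w, hw, h3⟩ := (D.coverSystem_solvable_iff h p p' q w').1 h2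
    rw [code_color, code_color, Fin.val_inj] at hc
    exact ⟨p, w, ⟨_, hq, rfl, hw⟩, hc, h3⟩

/-- The number of the pattern (for `i = 0`) or an exponent (for `i > 0`) of a patterned word. -/
noncomputable def tag (p : D.Pattern) (w : Fin (D.dim p) → ℕ) (i : ℕ) : ℕ :=
  (Encodable.encode (p.1.map Fin.val) :: List.ofFn w).getD i 0

/-- Like `columnHom`, with the weight replaced by a `tag`. -/
noncomputable def tagHom (p : D.Pattern) (i : ℕ) :
    (Fin (D.dim p) → ℕ) →+ (Fin (D.n + 1) → ℤ) where
  toFun w := Fin.cons (((0 :: List.ofFn w).getD i 0 : ℕ) : ℤ) (Fin.tail (D.columnHom p w))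
  map_zero' := by
    funext j
    refine Fin.cases ?_ (fun j => ?_) j
    · cases i with
      | zero => simp
      | succ i => by_cases hi : i < D.dim p <;> simp [List.getD, hi]
    · simp [Fin.tail]
  map_add' v w := by
    funext j
    refine Fin.cases ?_ (fun j => ?_) j
    · cases i with
      | zero => simp
      | succ i => by_cases hi : i < D.dim p <;> simp [List.getD, hi]
    · simp [Fin.tail]

theorem tag_add (p : D.Pattern) (w a : Fin (D.dim p) → ℕ) (i : ℕ) :
    (D.tag p (w + a) i : ℤ) = D.tag p w i + D.tagHom p i a 0 := by
  change _ = (D.tag p w i : ℤ) + ((0 :: List.ofFn a).getD i 0 : ℕ)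
  cases i with
  | zero => simp [tag]
  | succ i => by_cases hi : i < D.dim p <;> simp [tag, List.getD, hi]

theorem getD_ofFn_natVec {m i : ℕ} (u : List ℕ) (hi : i < m + 1) (x : ℕ) :
    (x :: u).getD i 0 = (x :: List.ofFn (natVec m u)).getD i 0 := by
  cases i with
  | zero => rfl
  | succ i =>
    have hi' : i < m := by omega
    simp [List.getD, natVec, hi']

theorem vecOfList_tagBase (p : D.Pattern) (q : LinPiece) {i : ℕ} (hi : i < D.dim p + 1) :
    vecOfList (D.n + 1) (Code.tagBase D.code (p.1.map Fin.val, q) i) =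
      Fin.cons (D.tag p (natVec (D.dim p) q.1) i : ℤ)
        (Fin.tail (D.value p (natVec (D.dim p) q.1))) := by
  rw [Code.tagBase, vecOfList_cons_tail, vecOfList_pieceBase, tag, getD_ofFn_natVec _ hi]

theorem vecOfList_tagColumn (p : D.Pattern) {i : ℕ} (hi : i < D.dim p + 1) (u : List ℕ) :
    vecOfList (D.n + 1) ((((0 :: u).getD i 0 : ℕ) : ℤ) ::
      (lincomb (Code.columns D.code (p.1.map Fin.val)) (castList u)).tail) =
      D.tagHom p i (natVec (D.dim p) u) := by
  rw [vecOfList_cons_tail, vecOfList_lincomb_columns, getD_ofFn_natVec _ hi]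
  rfl

theorem overlapSystem_solvable_iff (p p' : D.Pattern) (q q' : LinPiece) {i : ℕ}
    (hi : i < D.dim p + 1) (hi' : i < D.dim p' + 1) :
    vecOfList (D.n + 1) (Code.overlapSystem D.code (D.basisCode h) (p.1.map Fin.val, q)
      (p'.1.map Fin.val, q') i).2 ∈ monoidSpan (D.n + 1)
        (Code.overlapSystem D.code (D.basisCode h) (p.1.map Fin.val, q)
          (p'.1.map Fin.val, q') i).1 ↔
    ∃ w ∈ q.toSet (D.dim p), ∃ w' ∈ q'.toSet (D.dim p'),
      Fin.tail (D.value p w) - Fin.tail (D.value p' w') ∈ D.lattice h ∧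
      D.tag p' w' i < D.tag p w i := by
  rw [Code.overlapSystem, Code.tagColumns,
    mem_monoidSpan_neg_map_append_iff (D.vecOfList_tagColumn p hi)]
  simp only [Code.tagColumns, mem_monoidSpan_map_append_iff (D.vecOfList_tagColumn p' hi'),
    mem_monoidSpan_latticeColumns_append_iff D h (one_mul (1 : ℤ)), one_mul, vecOfList_addVec,
    vecOfList_smulVec, vecOfList_tagBase D p q hi, vecOfList_tagBase D p' q' hi']
  have key : ∀ a a', (Fin.cons (D.tag p (natVec (D.dim p) q.1) i : ℤ)
        (Fin.tail (D.value p (natVec (D.dim p) q.1))) : Fin (D.n + 1) → ℤ) +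
      (-1 : ℤ) • ((Fin.cons (D.tag p' (natVec (D.dim p') q'.1) i : ℤ)
        (Fin.tail (D.value p' (natVec (D.dim p') q'.1))) : Fin (D.n + 1) → ℤ) +
          vecOfList (D.n + 1) [1]) + D.tagHom p i a - D.tagHom p' i a' =
      Fin.cons ((D.tag p (natVec (D.dim p) q.1 + a) i : ℤ) -
        D.tag p' (natVec (D.dim p') q'.1 + a') i - 1)
        (Fin.tail (D.value p (natVec (D.dim p) q.1 + a)) -
          Fin.tail (D.value p' (natVec (D.dim p') q'.1 + a'))) := by
    intro a a'
    rw [tag_add, tag_add, value_add, value_add, vecOfList_cons, vecOfList_nil]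
    funext j
    refine Fin.cases ?_ (fun j => ?_) j
    · simp only [Pi.add_apply, Pi.sub_apply, Pi.smul_apply, Fin.cons_zero, smul_eq_mul]
      ring
    · have h1 : D.tagHom p i a j.succ = D.columnHom p a j.succ := rfl
      have h2 : D.tagHom p' i a' j.succ = D.columnHom p' a' j.succ := rfl
      simp only [Pi.add_apply, Pi.sub_apply, Pi.smul_apply, Fin.cons_succ, smul_eq_mul, h1, h2,
        Fin.tail, Pi.zero_apply]
      ring
  simp only [key, LinPiece.toSet, Set.mem_ofPred_eq, Fin.cons_zero, Fin.tail_cons]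
  constructor
  · rintro ⟨a, ha, a', ha', h1, h2⟩
    exact ⟨_, ⟨a, ha, rfl⟩, _, ⟨a', ha', rfl⟩, h2, by omega⟩
  · rintro ⟨_, ⟨a, ha, rfl⟩, _, ⟨a', ha', rfl⟩, h1, h2⟩
    exact ⟨a, ha, a', ha', by omega, h1⟩

theorem forall_tag_eq_iff {p p' : D.Pattern} {w : Fin (D.dim p) → ℕ} {w' : Fin (D.dim p') → ℕ} :
    (∀ i < min (D.dim p) (D.dim p') + 1, D.tag p w i = D.tag p' w' i) ↔
      (⟨p, w⟩ : Σ p : D.Pattern, Fin (D.dim p) → ℕ) = ⟨p', w'⟩ := by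
  constructor
  · intro h
    have h0 := h 0 (Nat.succ_pos _)
    have hp : p = p' := D.map_val_injective (Encodable.encode_injective h0)
    subst hp
    congr 1
    funext i
    have := h (i + 1) (by simp)
    simpa [tag, List.getD] using this
  · intro h i _
    cases h
    rfl

theorem isSeparated_iff {l : List PatternPiece} (hl : ∀ q ∈ l, q.1 ∈ Code.patterns D.code) :
    D.IsSeparated h (D.pieceSet l) ↔
      ∀ e ∈ Code.overlapSystems D.code (D.basisCode h) l,
        vecOfList (D.n + 1) e.2 ∉ monoidSpan (D.n + 1) e.1 := by
  constructor
  · intro hs e he hmem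
    simp only [Code.overlapSystems, List.mem_flatMap, List.mem_filter, decide_eq_true_eq,
      List.mem_map, List.mem_range] at he
    obtain ⟨⟨q₁, q⟩, hq, ⟨q₁', q'⟩, ⟨hq', hc⟩, i, hi, rfl⟩ := he
    obtain ⟨p, rfl⟩ := D.code_mem_patterns.1 (hl _ hq)
    obtain ⟨p', rfl⟩ := D.code_mem_patterns.1 (hl _ hq')
    simp only [code_dim] at hi
    simp only [code_color, Fin.val_inj] at hc
    obtain ⟨w, hw, w', hw', h1, h2⟩ :=
      (D.overlapSystem_solvable_iff h p p' q q' (by omega) (by omega)).1 hmem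
    have := D.forall_tag_eq_iff.2 (hs p w ⟨_, hq, rfl, hw⟩ p' w' ⟨_, hq', rfl, hw'⟩ hc h1) i hi
    omega
  · intro hs
    have key : ∀ p, ∀ w ∈ D.pieceSet l p, ∀ p', ∀ w' ∈ D.pieceSet l p', D.color p = D.color p' →
        Fin.tail (D.value p w) - Fin.tail (D.value p' w') ∈ D.lattice h →
        ∀ i < min (D.dim p) (D.dim p') + 1, D.tag p w i ≤ D.tag p' w' i := by
      rintro p w ⟨⟨_, q⟩, hq, rfl, hw⟩ p' w' ⟨⟨_, q'⟩, hq', rfl, hw'⟩ hc h1 i hi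
      by_contra! h2
      refine hs _ ?_ ((D.overlapSystem_solvable_iff h p p' q q' (i := i)
        (by omega) (by omega)).2 ⟨w, hw, w', hw', h1, h2⟩)
      simp only [Code.overlapSystems, List.mem_flatMap, List.mem_filter, decide_eq_true_eq,
        List.mem_map, List.mem_range]
      exact ⟨_, hq, _, ⟨hq', by rw [code_color, code_color, hc]⟩, i, by simpa only [code_dim], rfl⟩
    intro p w hw p' w' hw' hc h1
    refine D.forall_tag_eq_iff.1 fun i hi => le_antisymm (key p w hw p' w' hw' hc h1 i hi) ?_
    refine key p' w' hw' p w hw hc.symm ?_ i (by rwa [min_comm])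
    rw [← neg_sub]
    exact neg_mem h1

theorem checkPieces_iff {l : List PatternPiece} : Code.checkPieces D.code l = true ↔
    ∀ q ∈ l, q.1 ∈ Code.patterns D.code ∧ q.2.check (Code.dim D.code q.1) = true := by
  simp only [Code.checkPieces, List.all_eq_true, Bool.and_eq_true, List.any_eq_true,
    decide_eq_true_eq, exists_eq_right']

theorem isCovering_and_isSeparated_of_checkCertificate {s : Certificate}
    (hs : Code.checkCertificate (D.code, D.basisCode h) s = true) :
    D.IsCovering h (D.pieceSet s.1) ∧ D.IsSeparated h (D.pieceSet s.1) := by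
  simp only [Code.checkCertificate, Bool.and_eq_true, checkPieces_iff] at hs
  obtain ⟨⟨h1, h2⟩, h3⟩ := hs
  have hl := fun q hq => (h1 q hq).1
  simp only [Code.checkCovering, Code.checkSeparated, List.all_eq_true, List.any_eq_true] at h2 h3
  refine ⟨(D.isCovering_iff h hl).2 fun p hp => ?_, (D.isSeparated_iff h hl).2 fun e he => ?_⟩
  · obtain ⟨C, -, hC⟩ := h2 p hp
    exact covers_of_checkCovers hC
  · obtain ⟨S, -, hS⟩ := h3 e he
    exact not_mem_of_checkInfeasible hS

theorem exists_checkCertificate_of_pieces {l : List PatternPiece}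
    (hl : ∀ q ∈ l, q.1 ∈ Code.patterns D.code ∧ q.2.check (Code.dim D.code q.1) = true)
    (hc : D.IsCovering h (D.pieceSet l)) (hs : D.IsSeparated h (D.pieceSet l)) :
    ∃ s, Code.checkCertificate (D.code, D.basisCode h) s = true := by
  have hl' := fun q hq => (hl q hq).1
  obtain ⟨C, hC⟩ := exists_list_forall_mem (Code.patterns D.code)
    (fun p e => checkCovers (D.n + 1) (Code.columns D.code p)
      (Code.coverSystems D.code (D.basisCode h) l p) e = true)
    fun p hp => exists_checkCovers ((D.isCovering_iff h hl').1 hc p hp)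
  obtain ⟨S, hS⟩ := exists_list_forall_mem (Code.overlapSystems D.code (D.basisCode h) l)
    (fun e S => checkInfeasible (D.n + 1) e.1 e.2 S = true)
    fun e he => exists_checkInfeasible ((D.isSeparated_iff h hl').1 hs e he)
  refine ⟨(l, C, S), ?_⟩
  simp only [Code.checkCertificate, Bool.and_eq_true, checkPieces_iff, Code.checkCovering,
    Code.checkSeparated, List.all_eq_true, List.any_eq_true]
  exact ⟨⟨hl, hC⟩, hS⟩

theorem finite_pattern : Finite D.Pattern :=
  (List.finite_length_le (Fin D.s) D.A.index).to_subtype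

theorem exists_value_zero (p : D.Pattern) : ∃ (c : ℕ) (Λ : (Fin (D.dim p) → ℕ) →+ ℕ),
    ∀ w, D.value p w 0 = ((c + Λ w : ℕ) : ℤ) := by
  obtain ⟨b, -, h1, -⟩ := (D.exists_color p).choose_spec
  have hcol : ∀ q : Fin (D.dim p), ∃ a : ℕ, vecOfList (D.n + 1)
      ((Code.columns D.code (p.1.map Fin.val)).getD q []) 0 = (a : ℤ) := by
    intro q
    obtain ⟨⟨j, i⟩, rfl⟩ := finProdFinEquiv.surjective q
    exact ⟨_, congrFun (D.vecOfList_columns p j i) 0⟩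
  choose a ha using hcol
  refine ⟨(p.1.map fun i => D.omega (D.y i)).sum,
    { toFun := fun w => ∑ q, w q * a q
      map_zero' := by simp
      map_add' := by simp [add_mul, Finset.sum_add_distrib] }, fun w => ?_⟩
  rw [value, h1]
  simp only [Pi.add_apply, Finset.sum_apply, Pi.smul_apply, Fin.cons_zero, ha,
    AddMonoidHom.coe_mk, ZeroHom.coe_mk]
  simp only [nsmul_eq_mul]
  push_cast
  rfl

theorem exists_checkCertificate :
    ∃ s, Code.checkCertificate (D.code, D.basisCode h) s = true := by
  have := D.finite_pattern
  obtain ⟨N, ⟨e⟩⟩ := Finite.exists_equiv_fin D.Pattern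
  choose c Λ hΛ using D.exists_value_zero
  let L : ∀ p, (Fin (D.dim p) → ℕ) →+ (Fin D.n → ℤ) := fun p =>
    { toFun := fun w => Fin.tail (D.columnHom p w)
      map_zero' := by rw [map_zero]; rfl
      map_add' := fun v w => by rw [map_add]; rfl }
  have hfg : (D.lattice h).FG := (AddSubgroup.fg_iff _).2 ⟨_, rfl, Set.finite_range h⟩
  obtain ⟨U, hU, hcov, hsep⟩ := exists_semilinear_transversal hfg (fun i => D.dim (e.symm i))
    (fun i => D.color (e.symm i))
    (fun i => Fin.tail (vecOfList (D.n + 1) (Code.base D.code ((e.symm i).1.map Fin.val))))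
    (fun i => L (e.symm i)) (fun i => c (e.symm i)) (fun i => Λ (e.symm i))
  choose l hl hlU using fun i => exists_linPieces_of_isSemilinearSet (hU i)
  let P : List PatternPiece := (List.finRange N).flatMap fun i =>
    (l i).map fun q => ((e.symm i).1.map Fin.val, q)
  have hP : ∀ i w, w ∈ D.pieceSet P (e.symm i) ↔ w ∈ U i := by
    intro i w
    rw [hlU]
    simp only [pieceSet, P, List.mem_flatMap, List.mem_finRange, true_and, List.mem_map,
      Set.mem_ofPred_eq]
    constructor
    · rintro ⟨_, ⟨i', q, hq, rfl⟩, hi, hw⟩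
      obtain rfl := e.symm.injective (D.map_val_injective hi)
      exact ⟨q, hq, hw⟩
    · rintro ⟨q, hq, hw⟩
      exact ⟨_, ⟨i, q, hq, rfl⟩, rfl, hw⟩
  refine D.exists_checkCertificate_of_pieces h (l := P) ?_ ?_ ?_
  · intro q hq
    simp only [P, List.mem_flatMap, List.mem_finRange, true_and, List.mem_map] at hq
    obtain ⟨i, q, hq, rfl⟩ := hq
    refine ⟨D.code_mem_patterns.2 ⟨_, rfl⟩, ?_⟩
    rw [code_dim]
    exact hl i q hq
  · intro p' w'
    obtain ⟨i', rfl⟩ := e.symm.surjective p'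
    obtain ⟨i, w, hw, h1, h2, h3⟩ := hcov i' w'
    refine ⟨_, w, (hP i w).2 hw, h1, h2, ?_⟩
    rw [hΛ, hΛ]
    exact_mod_cast h3
  · intro p w hw p' w' hw' h1 h2
    obtain ⟨i, rfl⟩ := e.symm.surjective p
    obtain ⟨i', rfl⟩ := e.symm.surjective p'
    cases hsep i w i' w' ((hP i w).1 hw) ((hP i' w').1 hw') h1 h2
    rfl

/-! ### Sets of representatives of the cosets -/

theorem prod_mul_inv_mem_spanSubgroup_iff (p p' : D.Pattern) (w : Fin (D.dim p) → ℕ)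
    (w' : Fin (D.dim p') → ℕ) :
    (D.patternedWord p w).prod * ((D.patternedWord p' w').prod)⁻¹ ∈ D.spanSubgroup h ↔
      D.color p = D.color p' ∧
        Fin.tail (D.value p w) - Fin.tail (D.value p' w') ∈ D.lattice h := by
  obtain ⟨v, h1, h2⟩ := D.value_eq p w
  obtain ⟨v', h1', h2'⟩ := D.value_eq p' w'
  rw [h1, h1', h2, h2', mul_inv_mem_spanSubgroup_iff, Fin.tail_cons, Fin.tail_cons]

theorem value_zero (p : D.Pattern) (w : Fin (D.dim p) → ℕ) :
    D.value p w 0 = D.wordWeight (D.patternedWord p w) := by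
  obtain ⟨v, h1, -⟩ := D.value_eq p w
  rw [h1, Fin.cons_zero]

variable {D h}

theorem IsCovering.exists_mem {Z : ∀ p : D.Pattern, Set (Fin (D.dim p) → ℕ)}
    (hc : D.IsCovering h Z) (g : G) : ∃ p, ∃ w ∈ Z p,
      (D.patternedWord p w).prod * g⁻¹ ∈ D.spanSubgroup h ∧
        D.wordWeight (D.patternedWord p w) ≤ D.omega g := by
  obtain ⟨p', w', rfl, hg⟩ := D.exists_geodesic_patternedWord g
  obtain ⟨p, w, hw, h1, h2, h3⟩ := hc p' w'
  refine ⟨p, w, hw, (D.prod_mul_inv_mem_spanSubgroup_iff h p p' w w').2 ⟨h1, h2⟩, ?_⟩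
  rw [value_zero, value_zero] at h3
  rw [← hg]
  exact_mod_cast h3

theorem IsSeparated.eq {Z : ∀ p : D.Pattern, Set (Fin (D.dim p) → ℕ)}
    (hs : D.IsSeparated h Z) {p p' : D.Pattern} {w : Fin (D.dim p) → ℕ}
    {w' : Fin (D.dim p') → ℕ} (hw : w ∈ Z p) (hw' : w' ∈ Z p')
    (hm : (D.patternedWord p w).prod * ((D.patternedWord p' w').prod)⁻¹ ∈ D.spanSubgroup h) :
    (⟨p, w⟩ : Σ p : D.Pattern, Fin (D.dim p) → ℕ) = ⟨p', w'⟩ := by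
  rw [prod_mul_inv_mem_spanSubgroup_iff] at hm
  exact hs p w hw p' w' hw' hm.1 hm.2

theorem wordWeight_le_omega {Z : ∀ p : D.Pattern, Set (Fin (D.dim p) → ℕ)}
    (hc : D.IsCovering h Z) (hs : D.IsSeparated h Z) {p : D.Pattern} {w : Fin (D.dim p) → ℕ}
    (hw : w ∈ Z p) {g : G} (hg : g * ((D.patternedWord p w).prod)⁻¹ ∈ D.spanSubgroup h) :
    D.wordWeight (D.patternedWord p w) ≤ D.omega g := by
  obtain ⟨p', w', hw', h1, h2⟩ := hc.exists_mem g
  have h3 := mul_mem h1 hg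
  rw [mul_assoc, inv_mul_cancel_left] at h3
  cases hs.eq hw' hw h3
  exact h2

theorem isGeodesic_and_wordWeight_eq_omegaSet {Z : ∀ p : D.Pattern, Set (Fin (D.dim p) → ℕ)}
    (hc : D.IsCovering h Z) (hs : D.IsSeparated h Z) {p : D.Pattern} {w : Fin (D.dim p) → ℕ}
    (hw : w ∈ Z p) : D.IsGeodesic (D.patternedWord p w) ∧ D.wordWeight (D.patternedWord p w) =
      D.omegaSet {g : G | g * ((D.patternedWord p w).prod)⁻¹ ∈ D.spanSubgroup h} := by
  have hmem : (D.patternedWord p w).prod ∈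
      {g : G | g * ((D.patternedWord p w).prod)⁻¹ ∈ D.spanSubgroup h} := by
    rw [Set.mem_ofPred_eq, mul_inv_cancel]; exact one_mem _
  have h1 : D.IsGeodesic (D.patternedWord p w) :=
    le_antisymm (wordWeight_le_omega hc hs hw hmem) (D.omega_prod_le _)
  refine ⟨h1, le_antisymm (le_csInf ⟨_, _, hmem, rfl⟩ ?_) ?_⟩
  · rintro _ ⟨g, hg, rfl⟩
    exact wordWeight_le_omega hc hs hw hg
  · rw [h1]
    exact Nat.sInf_le ⟨_, hmem, rfl⟩

theorem phiImage_image (p : D.Pattern) (Z : Set (Fin (D.dim p) → ℕ)) :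
    D.phiImage p (D.patternedWord p '' Z) = {z | ∃ w ∈ Z, z = fun q => ((w q : ℕ) : ℤ)} := by
  ext z
  simp only [phiImage, Set.mem_ofPred_eq]
  constructor
  · rintro ⟨x, ⟨w, hw, hx⟩, rfl⟩
    obtain rfl : x = (D.phi p).symm w := Subtype.ext hx.symm
    exact ⟨w, hw, by rw [Equiv.apply_symm_apply]⟩
  · rintro ⟨w, hw, rfl⟩
    exact ⟨(D.phi p).symm w, ⟨w, hw, rfl⟩, by rw [Equiv.apply_symm_apply]⟩

theorem phiImage_pieceSet {l : List PatternPiece} (hl : Code.checkPieces D.code l = true)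
    (p : D.Pattern) : D.phiImage p (D.patternedWord p '' D.pieceSet l p) =
      PolyhedralCode.toSet (D.dim p) (Code.polyhedralCode D.code l (p.1.map Fin.val)) := by
  rw [checkPieces_iff] at hl
  rw [phiImage_image]
  ext z
  simp only [PolyhedralCode.toSet, Code.polyhedralCode, pieceSet, Set.mem_ofPred_eq, List.mem_map,
    List.mem_filter, decide_eq_true_eq, code_dim]
  constructor
  · rintro ⟨w, ⟨q, hq, hp, hw⟩, rfl⟩
    have h1 := (hl q hq).2
    rw [hp, code_dim] at h1
    exact ⟨_, ⟨q, ⟨hq, hp⟩, rfl⟩, (LinPiece.mem_code_iff h1 _).2 ⟨w, hw, rfl⟩⟩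
  · rintro ⟨_, ⟨q, ⟨hq, hp⟩, rfl⟩, hz⟩
    have h1 := (hl q hq).2
    rw [hp, code_dim] at h1
    obtain ⟨w, hw, rfl⟩ := (LinPiece.mem_code_iff h1 _).1 hz
    exact ⟨w, ⟨q, hq, hp, hw⟩, rfl⟩

theorem bijOn_rightRel {Z : ∀ p : D.Pattern, Set (Fin (D.dim p) → ℕ)}
    (hc : D.IsCovering h Z) (hs : D.IsSeparated h Z) :
    Set.BijOn (fun w : List G => (Quotient.mk (QuotientGroup.rightRel (D.spanSubgroup h)) w.prod))
      (⋃ p : D.Pattern, D.patternedWord p '' Z p) Set.univ := by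
  refine ⟨fun _ _ => Set.mem_univ _, fun a ha b hb hab => ?_, fun x _ => ?_⟩
  · obtain ⟨p, w, hw, rfl⟩ := Set.mem_iUnion.1 ha
    obtain ⟨p', w', hw', rfl⟩ := Set.mem_iUnion.1 hb
    cases hs.eq hw' hw (QuotientGroup.rightRel_apply.1 (Quotient.exact hab))
    rfl
  · obtain ⟨g, rfl⟩ := Quotient.exists_rep x
    obtain ⟨p, w, hw, h1, -⟩ := hc.exists_mem g
    refine ⟨_, Set.mem_iUnion.2 ⟨p, w, hw, rfl⟩, (Quotient.sound ?_).symm⟩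
    exact QuotientGroup.rightRel_apply.2 h1

theorem pairwise_disjoint_image {Z : ∀ p : D.Pattern, Set (Fin (D.dim p) → ℕ)}
    (hs : D.IsSeparated h Z) : Pairwise (fun p q : D.Pattern =>
      Disjoint (D.patternedWord p '' Z p) (D.patternedWord q '' Z q)) := by
  intro p q hpq
  rw [Set.disjoint_left]
  rintro _ ⟨w, hw, rfl⟩ ⟨w', hw', he⟩
  refine hpq (congrArg Sigma.fst (hs.eq hw hw' ?_))
  rw [he, mul_inv_cancel]
  exact one_mem _

end Description

end VirtAb

theorem theorem3 :
    ∃ Φ : VirtAb.DescriptionCode × List (List ℤ) × List ℕ →. VirtAb.PolyhedralCode,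
      Partrec Φ ∧
      ∀ (G : Type*) [Group G] (D : VirtAb.Description G)
        (k : ℕ) (h : Fin k → Fin D.n → ℤ) (_ : LinearIndependent ℤ h)
        (H : Subgroup G) (_ : H = D.spanSubgroup h),
        ∃ U : D.Pattern → Set (List G),
          (∀ p : D.Pattern,
            U p ⊆ D.W p ∧
            (∀ w ∈ U p, D.IsGeodesic w ∧
              D.wordWeight w = D.omegaSet {g : G | g * w.prod⁻¹ ∈ H}) ∧
            VirtAb.IsPolyhedral (D.phiImage p (U p)) ∧
            ∃ c ∈ Φ (D.input h p), D.phiImage p (U p) = VirtAb.PolyhedralCode.toSet (D.dim p) c) ∧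
          Pairwise (fun p q : D.Pattern => Disjoint (U p) (U q)) ∧
          Set.BijOn (fun w : List G => (Quotient.mk (QuotientGroup.rightRel H) w.prod))
            (⋃ p : D.Pattern, U p) Set.univ := by
  obtain ⟨f, hf, hcheck, hdom⟩ := VirtAb.exists_partrec_search VirtAb.Code.primrec_checkCertificate
  refine ⟨fun x => (f (x.1, x.2.1)).map fun s => VirtAb.Code.polyhedralCode x.1 s.1 x.2.2,
    ?_, ?_⟩
  · refine (hf.comp (Primrec.to_comp (by fun_prop))).map (Primrec.to_comp (by fun_prop))
  · rintro G _ D k h - H rfl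
    obtain ⟨s₀, hs₀⟩ := D.exists_checkCertificate h
    obtain ⟨s, hs⟩ := Part.dom_iff_mem.1 (hdom _ _ hs₀)
    have h1 := hcheck _ _ hs
    obtain ⟨hc, hsep⟩ := D.isCovering_and_isSeparated_of_checkCertificate h h1
    have h2 : VirtAb.Code.checkPieces D.code s.1 = true := by
      simp only [VirtAb.Code.checkCertificate, Bool.and_eq_true] at h1
      exact h1.1.1
    refine ⟨fun p => D.patternedWord p '' D.pieceSet s.1 p, fun p => ⟨?_, ?_, ?_, ?_⟩,
      VirtAb.Description.pairwise_disjoint_image hsep,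
      VirtAb.Description.bijOn_rightRel hc hsep⟩
    · exact Set.image_subset_range _ _
    · rintro _ ⟨w, hw, rfl⟩
      exact VirtAb.Description.isGeodesic_and_wordWeight_eq_omegaSet hc hsep hw
    · rw [VirtAb.Description.phiImage_pieceSet h2]
      exact VirtAb.isPolyhedral_toSet _ _
    · exact ⟨_, Part.mem_map _ hs, VirtAb.Description.phiImage_pieceSet h2 p⟩
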